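/- For a Borel probability measure $P$ on $\mathbb{R}^d$ and $n\ge 1$ let $$V_n(P)=\inf\Big\{\int \min_{a\in\alpha}\|x-a\|^2\,dP(x) : \alpha\subset\mathbb{R}^d,\ 1\le \operatorname{card}(\alpha)\le n\Big\},$$ and call $\alpha$ an optimal set of $n$-means for $P$ if $1\le\operatorname{card}(\alpha)\le n$ and $\alpha$ attains this infimum. Let $P=\frac12P_1+\frac12P_2$ be the mixed distribution on the boundary of the semicircular disc, where $P_1$ is the uniform distribution on the base $\{(t,0):-1\le t\le 1\}$ and $P_2$ is the uniform distribution (with respect to arc length) on the arc $\{(\cos t,\sin t):0\le t\le\pi\}$, and put $V_n=V_n(P)$. Below, $x\approx c$ means that $c$ is the value of $x$ correctly rounded to six significant digits (that is, $|x-c|$ is at most half a unit of the sixth significant digit of $c$); coordinates written as $0$, and the symmetries $\pm$, are exact. * $n=2$: the set $\{(-\frac14-\frac1\pi,\frac1\pi),(\frac14+\frac1\pi,\frac1\pi)\}$ is the only optimal set of two-means, and $$V_2=2\Big(\frac{96-24\pi+7\pi^2}{192\pi^2}+\frac{-96-8\pi+17\pi^2}{64\pi^2}\Big)\approx 0.242369.$$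 * $n=3$: there are $p\approx0.634868$, $q\approx0.154710$, $r\approx0.927980$ such that $\{(\pm p,q),(0,r)\}$ is an optimal set of three-means, and $V_3\approx0.147821$. * $n=4$: there are $p\approx0.788235$, $q\approx0.219171$, $r\approx0.932871$ such that $\{(0,0),(\pm p,q),(0,r)\}$ is an optimal set of four-means, and $V_4\approx0.0984120$. * $n=5$: there are $p\approx0.797190$, $q\approx0.120767$, $u\approx0.439705$, $v\approx0.856689$ such that $\{(0,0),(\pm p,q),(\pm u,v)\}$ is an optimal set of five-means, and $V_5\approx0.0654358$. * $n=6$: there are $p\approx0.781728$, $q\approx0.0661157$, $u\approx0.672351$, $v\approx0.707635$, $r\approx0.976117$ such that $\{(0,0),(\pm p,q),(\pm u,v),(0,r)\}$ is an optimal set of six-means, and $V_6\approx0.0499565$. * $n=7$: there are $s\approx0.294267$, $p\approx0.865678$, $q\approx0.0989137$, $u\approx0.652260$, $v\approx0.728637$, $r\approx0.977935$ such that $\{(\pm s,0),(\pm p,q),(\pm u,v),(0,r)\}$ is an optimal set of seven-means, and $V_7\approx0.0366668$. * $n=8$: there are $s\approx0.286766$, $p\approx0.853609$, $q\approx0.0615721$,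 $u\approx0.777386$, $v\approx0.604469$, $w\approx0.294109$, $z\approx0.939793$ such that $\{(\pm s,0),(\pm p,q),(\pm u,v),(\pm w,z)\}$ is an optimal set of eight-means, and $V_8\approx0.0290573$. * $n=9$: there are $s\approx0.458992$, $p\approx0.902056$, $q\approx0.0840085$, $u\approx0.764954$, $v\approx0.621235$, $w\approx0.287671$, $z\approx0.942514$ such that $\{(0,0),(\pm s,0),(\pm p,q),(\pm u,v),(\pm w,z)\}$ is an optimal set of nine-means, and $V_9\approx0.0233983$. -/

import Mathlib

open MeasureTheory
open scoped ENNReal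

/-- The distortion `∫ min_{a ∈ α} ‖x - a‖² dP(x)` of a set `α ⊆ ℝᵈ` with respect to a measure `P`.
For a finite nonempty `α` the infimum is a minimum; for `α = ∅` it is `∞`. -/
noncomputable def distortion {d : ℕ} (P : Measure (EuclideanSpace ℝ (Fin d)))
    (α : Set (EuclideanSpace ℝ (Fin d))) : ℝ≥0∞ :=
  ∫⁻ x, ⨅ a ∈ α, ENNReal.ofReal (‖x - a‖ ^ 2) ∂P

/-- The `n`th quantization error `V_n(P)`: the infimum of the distortion over all sets
with at most `n` points. -/
noncomputable def quantizationError {d : ℕ} (P : Measure (EuclideanSpace ℝ (Fin d)))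
    (n : ℕ) : ℝ≥0∞ :=
  ⨅ (α : Set (EuclideanSpace ℝ (Fin d))) (_ : α.encard ≤ n), distortion P α

/-- `α` is an optimal set of `n`-means for `P`: it has at most `n` points and attains the
infimum that defines `V_n(P)`. -/
def IsOptimalSetOfMeans {d : ℕ} (P : Measure (EuclideanSpace ℝ (Fin d))) (n : ℕ)
    (α : Set (EuclideanSpace ℝ (Fin d))) : Prop :=
  α.encard ≤ n ∧ distortion P α = quantizationError P n

/-- The uniform distribution on the base `{(t, 0) : -1 ≤ t ≤ 1}` of the half disc: the image of
the uniform distribution on `[-1, 1]` under the arc length parametrization. -/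
noncomputable def uniformBase : Measure (EuclideanSpace ℝ (Fin 2)) :=
  Measure.map (fun t : ℝ => !₂[t, 0])
    (ProbabilityTheory.cond (volume : Measure ℝ) (Set.Icc (-1) 1))

/-- The uniform distribution on the arc `{(cos t, sin t) : 0 ≤ t ≤ π}`: the image of
the uniform distribution on `[0, π]` under the arc length parametrization. -/
noncomputable def uniformArc : Measure (EuclideanSpace ℝ (Fin 2)) :=
  Measure.map (fun t : ℝ => !₂[Real.cos t, Real.sin t])
    (ProbabilityTheory.cond (volume : Measure ℝ) (Set.Icc 0 Real.pi))

/-- The mixed uniform distribution `½ P₁ + ½ P₂` on the boundary of the half disc. -/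
noncomputable def semicircleMixed : Measure (EuclideanSpace ℝ (Fin 2)) :=
  (2⁻¹ : ℝ≥0∞) • uniformBase + (2⁻¹ : ℝ≥0∞) • uniformArc

/-- `x` rounds to the decimal number `c` at `k` decimal places, that is, it differs from `c`
by at most half a unit of the `k`th decimal place. -/
def RoundsTo (x c : ℝ) (k : ℕ) : Prop :=
  |x - c| ≤ 1 / 2 * (1 / 10) ^ k

/-! The proof is linear programming duality with computer-checked numerics. Give every point of the
base and of the arc a price, and let the gain of a point `p` be the integral of the positive part of
price minus squared distance to `p`. For any family `P` the nearest squared distance is at least the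
price minus the sum of these positive parts, so the cost is at least the total price minus the sum
of the gains (`dual_bound`). Families may be taken in the closed half disc, since projection onto it
brings points nearer to the whole boundary (`exists_retract`).

The candidate for an optimum has two mirror-symmetric corner cells, made of the part `[b, 1]` of the
base and the arc up to the angle `θ`, with `k` equal cells on the rest of the base and `m` equal
cells on the rest of the arc. Its cost is `partitionCost k m b θ`. This is stationary in `(b, θ)`
exactly when the boundary points of the corner cell are equidistant from the two neighbouring
centroids. Then one constant price on the base and one on the arc fit all cells, and the dual value
equals the cost of the partition (`partitionCost_eq`). Optimality is thereby reduced to bounding the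
gain of a single point under constant prices. A point that serves only the base gains at most `β ^ 3
/ 3`, and a point that serves only the arc gains at most `arcGain h`. For a point near a corner the
centroid has to be shown to be best.

Three ingredients complete this argument.

(1) The sum of the gains depends on how many points lie near the top, the middle of the base and the
two corners. All distributions other than `(m, k, 1, 1)` are excluded by further dual bounds with
explicit prices, some of them lowered next to occupied corners (`cost_ge_of_zone_bounds`,
`counts_eq_of_excludes`). The gains of corner points are bounded there by trapezoidal sums at the
points of a grid, computed in integers by the kernel (`gain_le_of_checkRect`).

(2) In the corner zone the same grid bound handles points away from the centroid. Near it, the loss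
of gain is bounded below by a quadratic form whose positivity is checked by interval arithmetic
(`gain_le_cornerGain`, `Design.gain_le`).

(3) For three or more points, a stationary pair is obtained as a minimum on a tiny rectangle on
whose boundary the gradient points outwards, or on an interval when `b = 0`. The rectangle or
interval is small enough to give all decimals by interval arithmetic.

For two points the partition is into the right and left halves and is explicit. Uniqueness follows
because the gain is strictly smaller away from the centroid, and the projection onto the half disc
does not move points that end up in its interior. -/

namespace HalfDisc

/-! ### Distortion of a finite family as a sum of two real integrals -/

/-- Squared distance from the point `(t, 0)` of the base to `p`. -/
def sqBase (p : ℝ × ℝ) (t : ℝ) : ℝ := (t - p.1) ^ 2 + p.2 ^ 2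

/-- Squared distance from the point `(cos t, sin t)` of the arc to `p`. -/
noncomputable def sqArc (p : ℝ × ℝ) (t : ℝ) : ℝ :=
  (Real.cos t - p.1) ^ 2 + (Real.sin t - p.2) ^ 2

/-- The point of the Euclidean plane with given coordinates. -/
noncomputable def toPlane (p : ℝ × ℝ) : EuclideanSpace ℝ (Fin 2) := !₂[p.1, p.2]

/-- The distortion of a finite family of points, as a sum of two real integrals. -/
noncomputable def cost {ι : Type*} [Fintype ι] [Nonempty ι] (P : ι → ℝ × ℝ) : ℝ :=
  1 / 4 * (∫ t in (-1 : ℝ)..1, Finset.univ.inf' Finset.univ_nonempty fun i => sqBase (P i) t) +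
  1 / (2 * Real.pi) *
    ∫ t in (0 : ℝ)..Real.pi, Finset.univ.inf' Finset.univ_nonempty fun i => sqArc (P i) t

theorem sqBase_nonneg (p : ℝ × ℝ) (t : ℝ) : 0 ≤ sqBase p t := by unfold sqBase; positivity

theorem sqArc_nonneg (p : ℝ × ℝ) (t : ℝ) : 0 ≤ sqArc p t := by unfold sqArc; positivity

theorem continuous_sqBase (p : ℝ × ℝ) : Continuous (sqBase p) := by unfold sqBase; fun_prop

theorem continuous_sqArc (p : ℝ × ℝ) : Continuous (sqArc p) := by unfold sqArc; fun_prop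

theorem norm_base_sub (p : ℝ × ℝ) (t : ℝ) :
    ‖(!₂[t, 0] : EuclideanSpace ℝ (Fin 2)) - toPlane p‖ ^ 2 = sqBase p t := by
  rw [EuclideanSpace.norm_sq_eq]
  simp [toPlane, sqBase, Fin.sum_univ_two]

theorem norm_arc_sub (p : ℝ × ℝ) (t : ℝ) :
    ‖(!₂[Real.cos t, Real.sin t] : EuclideanSpace ℝ (Fin 2)) - toPlane p‖ ^ 2 = sqArc p t := by
  rw [EuclideanSpace.norm_sq_eq]
  simp [toPlane, sqArc, Fin.sum_univ_two]

theorem toPlane_surjective : Function.Surjective toPlane := by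
  intro v
  refine ⟨(v 0, v 1), ?_⟩
  ext i
  fin_cases i <;> simp [toPlane]

theorem lintegral_map_cond (φ : ℝ → EuclideanSpace ℝ (Fin 2)) (hφ : Measurable φ) (a b : ℝ)
    (hab : a < b) (F : EuclideanSpace ℝ (Fin 2) → ℝ≥0∞) (hF : Measurable F) (g : ℝ → ℝ)
    (hg : Continuous g) (hg0 : ∀ t, 0 ≤ g t) (hFg : ∀ t, F (φ t) = ENNReal.ofReal (g t)) :
    ∫⁻ x, F x ∂(Measure.map φ (ProbabilityTheory.cond (volume : Measure ℝ) (Set.Icc a b))) =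
      ENNReal.ofReal ((b - a)⁻¹ * ∫ t in a..b, g t) := by
  rw [lintegral_map hF hφ, ProbabilityTheory.cond, lintegral_smul_measure, Real.volume_Icc]
  simp_rw [hFg]
  rw [← ofReal_integral_eq_lintegral_ofReal (hg.integrableOn_Icc) (Filter.Eventually.of_forall hg0),
    smul_eq_mul, ← ENNReal.ofReal_inv_of_pos (by linarith),
    ← ENNReal.ofReal_mul (by rw [inv_nonneg]; linarith), intervalIntegral.integral_of_le hab.le,
    integral_Icc_eq_integral_Ioc]

/-- The factors in `cost` are the weight `1/2` times the normalisations `1/2` and `1/π` of the two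
uniform laws. Working with families instead of sets allows repetitions, so "at most `n` points"
becomes "a family indexed by `Fin n`". -/
theorem distortion_range {ι : Type*} [Fintype ι] [Nonempty ι] (P : ι → ℝ × ℝ) :
    distortion semicircleMixed (Set.range fun i => toPlane (P i)) = ENNReal.ofReal (cost P) := by
  have hF : Measurable fun x : EuclideanSpace ℝ (Fin 2) =>
      ⨅ a ∈ Set.range fun i => toPlane (P i), ENNReal.ofReal (‖x - a‖ ^ 2) := by
    refine Measurable.biInf _ (Set.finite_range _).countable fun a _ => ?_
    exact ENNReal.measurable_ofReal.comp ((measurable_id.sub_const a).norm.pow_const 2)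
  have hinf : ∀ (x : EuclideanSpace ℝ (Fin 2)) (g : ι → ℝ), (∀ i, ‖x - toPlane (P i)‖ ^ 2 = g i) →
      (⨅ a ∈ Set.range fun i => toPlane (P i), ENNReal.ofReal (‖x - a‖ ^ 2)) =
        ENNReal.ofReal (Finset.univ.inf' Finset.univ_nonempty g) := by
    intro x g hg
    rw [iInf_range]
    simp_rw [hg]
    apply le_antisymm
    · obtain ⟨i, -, hi⟩ := Finset.exists_mem_eq_inf' (Finset.univ_nonempty (α := ι)) g
      rw [hi]
      exact iInf_le _ i
    · exact le_iInf fun i => ENNReal.ofReal_le_ofReal (Finset.inf'_le _ (Finset.mem_univ i))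
  have hcB : Continuous fun t => Finset.univ.inf' Finset.univ_nonempty fun i => sqBase (P i) t :=
    Continuous.finset_inf'_apply _ fun i _ => continuous_sqBase _
  have hcA : Continuous fun t => Finset.univ.inf' Finset.univ_nonempty fun i => sqArc (P i) t :=
    Continuous.finset_inf'_apply _ fun i _ => continuous_sqArc _
  have h0B : ∀ t, 0 ≤ Finset.univ.inf' Finset.univ_nonempty fun i => sqBase (P i) t := fun t =>
    Finset.le_inf' _ _ fun i _ => sqBase_nonneg _ _
  have h0A : ∀ t, 0 ≤ Finset.univ.inf' Finset.univ_nonempty fun i => sqArc (P i) t := fun t =>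
    Finset.le_inf' _ _ fun i _ => sqArc_nonneg _ _
  have hIB : 0 ≤ ∫ t in (-1 : ℝ)..1,
      Finset.univ.inf' Finset.univ_nonempty fun i => sqBase (P i) t :=
    intervalIntegral.integral_nonneg (by norm_num) fun t _ => h0B t
  have hIA : 0 ≤ ∫ t in (0 : ℝ)..Real.pi,
      Finset.univ.inf' Finset.univ_nonempty fun i => sqArc (P i) t :=
    intervalIntegral.integral_nonneg Real.pi_pos.le fun t _ => h0A t
  have hm1 : Measurable fun t : ℝ => (!₂[t, 0] : EuclideanSpace ℝ (Fin 2)) := by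
    apply Continuous.measurable; fun_prop
  have hm2 : Measurable fun t : ℝ =>
      (!₂[Real.cos t, Real.sin t] : EuclideanSpace ℝ (Fin 2)) := by
    apply Continuous.measurable; fun_prop
  have h2 : (2⁻¹ : ℝ≥0∞) = ENNReal.ofReal 2⁻¹ := by
    rw [ENNReal.ofReal_inv_of_pos (by norm_num)]; norm_num
  rw [distortion, semicircleMixed, lintegral_add_measure, lintegral_smul_measure,
    lintegral_smul_measure, uniformBase, uniformArc,
    lintegral_map_cond _ hm1 (-1) 1 (by norm_num) _ hF _ hcB h0B
      fun t => hinf _ _ fun i => norm_base_sub _ _,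
    lintegral_map_cond _ hm2 0 Real.pi Real.pi_pos _ hF _ hcA h0A
      fun t => hinf _ _ fun i => norm_arc_sub _ _, h2, smul_eq_mul, smul_eq_mul,
    ← ENNReal.ofReal_mul (by norm_num), ← ENNReal.ofReal_mul (by norm_num),
    ← ENNReal.ofReal_add (by positivity)
      (mul_nonneg (by norm_num) (mul_nonneg (by rw [sub_zero]; exact inv_nonneg.2 Real.pi_pos.le) hIA)), cost]
  congr 1
  have := Real.pi_pos
  field_simp
  ring

end HalfDisc

/-! ### Weak duality, reflection, and projection onto the half disc -/

namespace HalfDisc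

/-- The mass that `p` can save when the points of the base and of the arc pay at most `gB`
and `gA` each. -/
noncomputable def gain (gB gA : ℝ → ℝ) (p : ℝ × ℝ) : ℝ :=
  1 / 4 * (∫ t in (-1 : ℝ)..1, max 0 (gB t - sqBase p t)) +
  1 / (2 * Real.pi) * ∫ t in (0 : ℝ)..Real.pi, max 0 (gA t - sqArc p t)

/-- At an index `i` where the minimum is attained, the single term `max 0 (g - q i)` already brings
`g` down to `q i` or below; the remaining terms are nonnegative. -/
theorem sub_sum_max_le_inf' {ι : Type*} [Fintype ι] [Nonempty ι] (g : ℝ) (q : ι → ℝ) :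
    g - ∑ i, max 0 (g - q i) ≤ Finset.univ.inf' Finset.univ_nonempty q := by
  obtain ⟨i, -, hi⟩ := Finset.exists_mem_eq_inf' (Finset.univ_nonempty (α := ι)) q
  rw [hi]
  have h1 : max 0 (g - q i) ≤ ∑ i, max 0 (g - q i) :=
    Finset.single_le_sum (f := fun i => max 0 (g - q i)) (fun _ _ => le_max_left _ _)
      (Finset.mem_univ i)
  have h2 := le_max_right 0 (g - q i)
  linarith

theorem integral_sub_sum_max_le {ι : Type*} [Fintype ι] [Nonempty ι] (a b : ℝ) (hab : a ≤ b)
    (g : ℝ → ℝ) (q : ι → ℝ → ℝ) (hg : Continuous g) (hq : ∀ i, Continuous (q i)) :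
    (∫ t in a..b, g t) - ∑ i, (∫ t in a..b, max 0 (g t - q i t)) ≤
      ∫ t in a..b, Finset.univ.inf' Finset.univ_nonempty fun i => q i t := by
  have hm : ∀ i, Continuous fun t => max 0 (g t - q i t) := fun i => by
    have := hq i
    fun_prop
  have hc : Continuous fun t => Finset.univ.inf' Finset.univ_nonempty fun i => q i t :=
    Continuous.finset_inf'_apply _ fun i _ => hq i
  rw [← intervalIntegral.integral_finsetSum fun i _ => (hm i).intervalIntegrable _ _,
    ← intervalIntegral.integral_sub (hg.intervalIntegrable _ _)
      ((continuous_finsetSum _ fun i _ => hm i).intervalIntegrable _ _)]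
  refine intervalIntegral.integral_mono_on hab ?_ (hc.intervalIntegrable _ _) fun t _ =>
    sub_sum_max_le_inf' (g t) fun i => q i t
  exact (hg.sub (continuous_finsetSum _ fun i _ => hm i)).intervalIntegrable _ _

/-- Weak duality: prices `gB`, `gA` give a lower bound for the cost. -/
theorem dual_bound {ι : Type*} [Fintype ι] [Nonempty ι] (P : ι → ℝ × ℝ) (gB gA : ℝ → ℝ)
    (hB : Continuous gB) (hA : Continuous gA) :
    1 / 4 * (∫ t in (-1 : ℝ)..1, gB t) + 1 / (2 * Real.pi) * (∫ t in (0 : ℝ)..Real.pi, gA t) -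
      ∑ i, gain gB gA (P i) ≤ cost P := by
  have h1 := integral_sub_sum_max_le (-1) 1 (by norm_num) gB (fun i => sqBase (P i)) hB
    fun i => continuous_sqBase _
  have h2 := integral_sub_sum_max_le 0 Real.pi Real.pi_pos.le gA (fun i => sqArc (P i)) hA
    fun i => continuous_sqArc _
  have h3 : (0 : ℝ) ≤ 1 / (2 * Real.pi) := by have := Real.pi_pos; positivity
  have h4 := mul_le_mul_of_nonneg_left h1 (by norm_num : (0 : ℝ) ≤ 1 / 4)
  have h5 := mul_le_mul_of_nonneg_left h2 h3
  simp only [gain, cost, Finset.sum_add_distrib, ← Finset.mul_sum]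
  rw [mul_sub] at h4 h5
  linarith

theorem gain_mono {gB gA gB' gA' : ℝ → ℝ} {p p' : ℝ × ℝ} (hB : Continuous gB) (hA : Continuous gA)
    (hB' : Continuous gB') (hA' : Continuous gA')
    (h1 : ∀ t ∈ Set.Icc (-1 : ℝ) 1, gB t - sqBase p t ≤ gB' t - sqBase p' t)
    (h2 : ∀ t ∈ Set.Icc (0 : ℝ) Real.pi, gA t - sqArc p t ≤ gA' t - sqArc p' t) :
    gain gB gA p ≤ gain gB' gA' p' := by
  have c1 := continuous_sqBase p
  have c2 := continuous_sqBase p'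
  have c3 := continuous_sqArc p
  have c4 := continuous_sqArc p'
  have h3 : (0 : ℝ) ≤ 1 / (2 * Real.pi) := by have := Real.pi_pos; positivity
  unfold gain
  refine add_le_add (mul_le_mul_of_nonneg_left ?_ (by norm_num)) (mul_le_mul_of_nonneg_left ?_ h3)
  · refine intervalIntegral.integral_mono_on (by norm_num) ?_ ?_ fun t ht =>
      max_le_max le_rfl (h1 t ht)
    all_goals exact Continuous.intervalIntegrable (by fun_prop) _ _
  · refine intervalIntegral.integral_mono_on Real.pi_pos.le ?_ ?_ fun t ht =>
      max_le_max le_rfl (h2 t ht)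
    all_goals exact Continuous.intervalIntegrable (by fun_prop) _ _

/-- Reflection in the vertical axis acts as `t ↦ -t` on the base and `t ↦ π - t` on the arc. All
estimates for the left corner are deduced from the right one through this identity. -/
theorem gain_mirror (gB gA : ℝ → ℝ) (p : ℝ × ℝ) :
    gain gB gA (-p.1, p.2) = gain (fun t => gB (-t)) (fun t => gA (Real.pi - t)) p := by
  unfold gain
  congr 2
  · have := intervalIntegral.integral_comp_neg (a := -1) (b := 1)
      (fun t => max 0 (gB t - sqBase (-p.1, p.2) t))
    rw [neg_neg] at this
    rw [← this]
    refine intervalIntegral.integral_congr fun t _ => ?_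
    simp only [sqBase]
    ring_nf
  · have := intervalIntegral.integral_comp_sub_left (a := 0) (b := Real.pi)
      (fun t => max 0 (gA t - sqArc (-p.1, p.2) t)) Real.pi
    rw [sub_self, sub_zero] at this
    rw [← this]
    refine intervalIntegral.integral_congr fun t _ => ?_
    simp only [sqArc, Real.cos_pi_sub, Real.sin_pi_sub]
    ring_nf

theorem cost_mono {ι : Type*} [Fintype ι] [Nonempty ι] {P P' : ι → ℝ × ℝ}
    (h1 : ∀ i, ∀ t ∈ Set.Icc (-1 : ℝ) 1, sqBase (P i) t ≤ sqBase (P' i) t)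
    (h2 : ∀ i, ∀ t ∈ Set.Icc (0 : ℝ) Real.pi, sqArc (P i) t ≤ sqArc (P' i) t) :
    cost P ≤ cost P' := by
  have h3 : (0 : ℝ) ≤ 1 / (2 * Real.pi) := by have := Real.pi_pos; positivity
  have cB : ∀ Q : ι → ℝ × ℝ,
      Continuous fun t => Finset.univ.inf' Finset.univ_nonempty fun i => sqBase (Q i) t :=
    fun Q => Continuous.finset_inf'_apply _ fun i _ => continuous_sqBase _
  have cA : ∀ Q : ι → ℝ × ℝ,
      Continuous fun t => Finset.univ.inf' Finset.univ_nonempty fun i => sqArc (Q i) t :=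
    fun Q => Continuous.finset_inf'_apply _ fun i _ => continuous_sqArc _
  refine add_le_add (mul_le_mul_of_nonneg_left ?_ (by norm_num)) (mul_le_mul_of_nonneg_left ?_ h3)
  · refine intervalIntegral.integral_mono_on (by norm_num) ((cB _).intervalIntegrable _ _)
      ((cB _).intervalIntegrable _ _) fun t ht => ?_
    exact Finset.le_inf' _ _ fun i hi => (Finset.inf'_le _ hi).trans (h1 i t ht)
  · refine intervalIntegral.integral_mono_on Real.pi_pos.le ((cA _).intervalIntegrable _ _)
      ((cA _).intervalIntegrable _ _) fun t ht => ?_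
    exact Finset.le_inf' _ _ fun i hi => (Finset.inf'_le _ hi).trans (h2 i t ht)

/-- The closed upper half of the unit disc. -/
def InHalfDisc (p : ℝ × ℝ) : Prop := 0 ≤ p.2 ∧ p.1 ^ 2 + p.2 ^ 2 ≤ 1

/-- Metric projection onto the unit disc. The last clause records that a point whose image lies
strictly inside has not moved; it carries uniqueness from the half disc to the plane. -/
theorem exists_radial_retract (x y : ℝ) (hy : 0 ≤ y) : ∃ p : ℝ × ℝ, InHalfDisc p ∧
    (∀ u v : ℝ, u ^ 2 + v ^ 2 ≤ 1 → (u - p.1) ^ 2 + (v - p.2) ^ 2 ≤ (u - x) ^ 2 + (v - y) ^ 2) ∧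
    (p.1 ^ 2 + p.2 ^ 2 < 1 → p = (x, y)) := by
  by_cases h : x ^ 2 + y ^ 2 ≤ 1
  · exact ⟨(x, y), ⟨hy, h⟩, fun u v _ => le_rfl, fun _ => rfl⟩
  · push Not at h
    set r := Real.sqrt (x ^ 2 + y ^ 2) with hr
    have hr2 : r ^ 2 = x ^ 2 + y ^ 2 := Real.sq_sqrt (by positivity)
    have hr1 : 1 < r := by
      have : (1 : ℝ) ^ 2 < r ^ 2 := by rw [hr2]; linarith
      exact lt_of_pow_lt_pow_left₀ 2 (Real.sqrt_nonneg _) this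
    have hr0 : 0 < r := by linarith
    have hn : (x / r) ^ 2 + (y / r) ^ 2 = 1 := by
      rw [div_pow, div_pow, ← add_div, ← hr2]; field_simp
    refine ⟨(x / r, y / r), ⟨div_nonneg hy hr0.le, hn.le⟩, fun u v huv => ?_, fun h' => ?_⟩
    · have hx : x = r * (x / r) := by field_simp
      have hy' : y = r * (y / r) := by field_simp
      set a := x / r
      set b := y / r
      have hab : u * a + v * b ≤ 1 := by nlinarith [sq_nonneg (u - a), sq_nonneg (v - b)]
      -- The decrease of the squared distance factors in this way; both factors are nonnegative
      -- since `r > 1` and the inner product of two vectors of the disc is at most `1`.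
      have key : 0 ≤ (r - 1) * (r + 1 - 2 * (u * a + v * b)) :=
        mul_nonneg (by linarith) (by linarith)
      have : (u - x) ^ 2 + (v - y) ^ 2 - ((u - a) ^ 2 + (v - b) ^ 2) =
          (r - 1) * (r + 1 - 2 * (u * a + v * b)) := by
        rw [hx, hy']
        linear_combination (r ^ 2 - 1) * hn
      simp only
      linarith
    · simp only at h'
      linarith

/-- The base and the arc lie in the upper half plane, so replacing a negative ordinate by `0`
decreases all distances to them; the radial projection follows. -/
theorem exists_retract (a : ℝ × ℝ) : ∃ p : ℝ × ℝ, InHalfDisc p ∧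
    (∀ t ∈ Set.Icc (-1 : ℝ) 1, sqBase p t ≤ sqBase a t) ∧
    (∀ t ∈ Set.Icc (0 : ℝ) Real.pi, sqArc p t ≤ sqArc a t) ∧
    (0 < p.2 → p.1 ^ 2 + p.2 ^ 2 < 1 → p = a) := by
  obtain ⟨p, hp, hle, heq⟩ := exists_radial_retract a.1 (max a.2 0) (le_max_right _ _)
  have hmax : ∀ v : ℝ, 0 ≤ v → (v - max a.2 0) ^ 2 ≤ (v - a.2) ^ 2 := by
    intro v hv
    rcases le_total 0 a.2 with h | h
    · rw [max_eq_left h]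
    · rw [max_eq_right h]; nlinarith
  refine ⟨p, hp, fun t ht => ?_, fun t ht => ?_, fun h0 h1 => ?_⟩
  · have h := hle t 0 (by nlinarith [ht.1, ht.2])
    have h' := hmax 0 le_rfl
    unfold sqBase
    nlinarith
  · have h := hle (Real.cos t) (Real.sin t) (by rw [add_comm]; exact (Real.sin_sq_add_cos_sq t).le)
    have h' := hmax (Real.sin t) (Real.sin_nonneg_of_nonneg_of_le_pi ht.1 ht.2)
    unfold sqArc
    linarith
  · have hpa := heq h1
    rw [hpa] at h0
    simp only at h0
    have : 0 < a.2 := by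
      by_contra hc
      push Not at hc
      rw [max_eq_right hc] at h0
      exact lt_irrefl _ h0
    rw [hpa, max_eq_left this.le]

end HalfDisc

/-! ### Gains of points that serve only the base or only the arc -/

namespace HalfDisc

/-- On `[a, b]` the positive part is `f` cut off to `[c, d]`. The interval `[c, d]` may stick out of
`[a, b]`, which only adds nonnegative values. -/
theorem integral_max_le_of_nonpos_off {a b c d : ℝ} (hab : a ≤ b) (hcd : c ≤ d) {f : ℝ → ℝ}
    (hf : Continuous f) (hoff : ∀ t ∈ Set.Icc a b, t ∉ Set.Icc c d → f t ≤ 0)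
    (hon : ∀ t ∈ Set.Icc c d, 0 ≤ f t) :
    ∫ t in a..b, max 0 (f t) ≤ ∫ t in c..d, f t := by
  rw [intervalIntegral.integral_of_le hab, intervalIntegral.integral_of_le hcd,
    ← integral_Icc_eq_integral_Ioc, ← integral_Icc_eq_integral_Ioc]
  calc ∫ t in Set.Icc a b, max 0 (f t)
      = ∫ t in Set.Icc a b, (Set.Icc c d).indicator f t := by
        refine setIntegral_congr_fun measurableSet_Icc fun t ht => ?_
        by_cases h : t ∈ Set.Icc c d
        · simp only [Set.indicator_of_mem h, max_eq_right (hon t h)]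
        · simp only [Set.indicator_of_notMem h, max_eq_left (hoff t ht h)]
    _ = ∫ t in Set.Icc a b ∩ Set.Icc c d, f t := setIntegral_indicator measurableSet_Icc
    _ ≤ ∫ t in Set.Icc c d, f t := by
        refine setIntegral_mono_set hf.integrableOn_Icc ?_
          (Filter.Eventually.of_forall Set.inter_subset_right)
        exact (ae_restrict_iff' measurableSet_Icc).2 (Filter.Eventually.of_forall hon)

/-- The largest possible gain of a point that serves base points only. -/
theorem gain_le_of_far_from_arc {gB gA : ℝ → ℝ} {p : ℝ × ℝ} {β : ℝ} (hβ : 0 ≤ β)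
    (hcB : Continuous gB) (hB : ∀ t ∈ Set.Icc (-1 : ℝ) 1, gB t ≤ β ^ 2)
    (hA : ∀ t ∈ Set.Icc (0 : ℝ) Real.pi, gA t ≤ sqArc p t) :
    gain gB gA p ≤ β ^ 3 / 3 := by
  have hA0 : ∫ t in (0 : ℝ)..Real.pi, max 0 (gA t - sqArc p t) = 0 := by
    rw [intervalIntegral.integral_congr (g := fun _ => (0 : ℝ)), intervalIntegral.integral_zero]
    intro t ht
    rw [Set.uIcc_of_le Real.pi_pos.le] at ht
    exact max_eq_left (sub_nonpos.2 (hA t ht))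
  have c1 := continuous_sqBase p
  have hB1 : ∫ t in (-1 : ℝ)..1, max 0 (gB t - sqBase p t) ≤
      ∫ t in (-1 : ℝ)..1, max 0 (β ^ 2 - (t - p.1) ^ 2) := by
    refine intervalIntegral.integral_mono_on (by norm_num)
      (Continuous.intervalIntegrable (by fun_prop) _ _)
      (Continuous.intervalIntegrable (by fun_prop) _ _) fun t ht => max_le_max le_rfl ?_
    have := hB t ht
    unfold sqBase
    nlinarith [sq_nonneg p.2]
  -- Discarding the height of `p` leaves a parabolic cap of half-width `β`. Its full area `4 β³ / 3`
  -- is an upper bound even when the cap leaves `[-1, 1]`.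
  have hB2 : ∫ t in (-1 : ℝ)..1, max 0 (β ^ 2 - (t - p.1) ^ 2) ≤
      ∫ t in (p.1 - β)..(p.1 + β), (β ^ 2 - (t - p.1) ^ 2) := by
    refine integral_max_le_of_nonpos_off (by norm_num) (by linarith) (by fun_prop) ?_ ?_
    · intro t _ ht
      simp only [Set.mem_Icc, not_and_or, not_le] at ht
      rcases ht with h | h <;> nlinarith
    · intro t ht
      nlinarith [ht.1, ht.2]
  have hB3 : ∫ t in (p.1 - β)..(p.1 + β), (β ^ 2 - (t - p.1) ^ 2) = 4 / 3 * β ^ 3 := by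
    rw [intervalIntegral.integral_comp_sub_right (fun t => β ^ 2 - t ^ 2) p.1]
    rw [intervalIntegral.integral_sub (by simp) (by simp)]
    simp
    ring
  unfold gain
  rw [hA0]
  linarith

/-- The expression vanishes at `0` and has derivative `-2 x² sin 2x`. It is, up to a positive
factor, the derivative in the next lemma. -/
theorem sq_cos_two_mul_sub_nonpos {x : ℝ} (h0 : 0 ≤ x) (h1 : x ≤ Real.pi / 2) :
    x ^ 2 * Real.cos (2 * x) - x * Real.sin (2 * x) + Real.sin x ^ 2 ≤ 0 := by
  have hd : ∀ y : ℝ, HasDerivAt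
      (fun x => x ^ 2 * Real.cos (2 * x) - x * Real.sin (2 * x) + Real.sin x ^ 2)
      (-2 * y ^ 2 * Real.sin (2 * y)) y := by
    intro y
    have e1 : HasDerivAt (fun x : ℝ => 2 * x) 2 y := by
      simpa using (hasDerivAt_id y).const_mul 2
    have := (((hasDerivAt_id y).pow 2).mul e1.cos).sub ((hasDerivAt_id y).mul e1.sin) |>.add
      ((Real.hasDerivAt_sin y).pow 2)
    refine this.congr_deriv ?_
    simp
    rw [Real.sin_two_mul]
    ring
  have hanti : AntitoneOn
      (fun x => x ^ 2 * Real.cos (2 * x) - x * Real.sin (2 * x) + Real.sin x ^ 2)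
      (Set.Icc 0 (Real.pi / 2)) := by
    refine antitoneOn_of_deriv_nonpos (convex_Icc _ _)
      (fun y _ => (hd y).continuousAt.continuousWithinAt)
      (fun y _ => (hd y).differentiableAt.differentiableWithinAt) fun y hy => ?_
    rw [interior_Icc] at hy
    rw [(hd y).deriv]
    have : 0 ≤ Real.sin (2 * y) :=
      Real.sin_nonneg_of_nonneg_of_le_pi (by linarith [hy.1]) (by linarith [hy.2])
    nlinarith [mul_nonneg (sq_nonneg y) this]
  have := hanti ⟨le_rfl, by linarith⟩ ⟨h0, h1⟩ h0
  simpa using this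

/-- The function equals `1 - arcPrice x`, so the price grows with the half-width of the arc. It is
also the derivative of `sin² x / x`. -/
theorem antitoneOn_sin_two_mul_div : AntitoneOn
    (fun x : ℝ => Real.sin (2 * x) / x - Real.sin x ^ 2 / x ^ 2) (Set.Ioc 0 (Real.pi / 2)) := by
  have hd : ∀ y : ℝ, 0 < y → HasDerivAt
      (fun x : ℝ => Real.sin (2 * x) / x - Real.sin x ^ 2 / x ^ 2)
      (2 * (y ^ 2 * Real.cos (2 * y) - y * Real.sin (2 * y) + Real.sin y ^ 2) / y ^ 3) y := by
    intro y hy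
    have e1 : HasDerivAt (fun x : ℝ => 2 * x) 2 y := by
      simpa using (hasDerivAt_id y).const_mul 2
    have := ((e1.sin).div (hasDerivAt_id y) hy.ne').sub
      (((Real.hasDerivAt_sin y).pow 2).div ((hasDerivAt_id y).pow 2) (pow_ne_zero 2 hy.ne'))
    refine this.congr_deriv ?_
    simp
    rw [Real.sin_two_mul]
    field_simp
    ring
  refine antitoneOn_of_deriv_nonpos (convex_Ioc _ _)
    (fun y hy => (hd y hy.1).continuousAt.continuousWithinAt)
    (fun y hy => ?_) fun y hy => ?_
  · rw [interior_Ioc] at hy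
    exact (hd y hy.1).differentiableAt.differentiableWithinAt
  · rw [interior_Ioc] at hy
    rw [(hd y hy.1).deriv]
    refine div_nonpos_of_nonpos_of_nonneg ?_ (pow_nonneg hy.1.le 3)
    have := sq_cos_two_mul_sub_nonpos hy.1.le hy.2.le
    linarith

/-- The squared distance from the centroid of an arc of half-width `h` to its endpoints. -/
noncomputable def arcPrice (h : ℝ) : ℝ :=
  1 + (Real.sin h / h) ^ 2 - 2 * (Real.sin h / h) * Real.cos h

/-- The gain of the centroid of an arc of half-width `h` at the price `arcPrice h`. -/
noncomputable def arcGain (h : ℝ) : ℝ :=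
  2 / Real.pi * (Real.sin h / h) * (Real.sin h - h * Real.cos h)

/-- As a function of `x` the left side has derivative `arcPrice h - arcPrice x`, which changes sign
from plus to minus at `h`; the right side is the value at `h`. It is half the best total saving on
an arc of half-width `x` at price `arcPrice h`. -/
theorem sin_sq_div_sub_le {x h : ℝ} (hx0 : 0 < x) (hx1 : x ≤ Real.pi / 2) (hh0 : 0 < h)
    (hh1 : h ≤ Real.pi / 2) :
    Real.sin x ^ 2 / x - x * (1 - arcPrice h) ≤
      2 * (Real.sin h / h) * (Real.sin h - h * Real.cos h) := by
  have hK : 1 - arcPrice h = Real.sin (2 * h) / h - Real.sin h ^ 2 / h ^ 2 := by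
    rw [arcPrice, Real.sin_two_mul]; field_simp; ring
  have hE : 2 * (Real.sin h / h) * (Real.sin h - h * Real.cos h) =
      Real.sin h ^ 2 / h - h * (1 - arcPrice h) := by
    rw [arcPrice]; field_simp; ring
  rw [hE]
  set K := 1 - arcPrice h
  have hd : ∀ y : ℝ, 0 < y → HasDerivAt (fun x : ℝ => Real.sin x ^ 2 / x - x * K)
      (Real.sin (2 * y) / y - Real.sin y ^ 2 / y ^ 2 - K) y := by
    intro y hy
    have := (((Real.hasDerivAt_sin y).pow 2).div (hasDerivAt_id y) hy.ne').sub
      ((hasDerivAt_id y).mul_const K)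
    refine this.congr_deriv ?_
    simp
    rw [Real.sin_two_mul]
    field_simp
  rcases le_total x h with hxh | hxh
  · have hmono : MonotoneOn (fun x : ℝ => Real.sin x ^ 2 / x - x * K) (Set.Icc x h) := by
      refine monotoneOn_of_deriv_nonneg (convex_Icc _ _)
        (fun y hy => (hd y (hx0.trans_le hy.1)).continuousAt.continuousWithinAt)
        (fun y hy => ?_) fun y hy => ?_
      · rw [interior_Icc] at hy
        exact (hd y (hx0.trans hy.1)).differentiableAt.differentiableWithinAt
      · rw [interior_Icc] at hy
        rw [(hd y (hx0.trans hy.1)).deriv, hK, sub_nonneg]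
        exact antitoneOn_sin_two_mul_div ⟨hx0.trans hy.1, by linarith [hy.2]⟩ ⟨hh0, hh1⟩ hy.2.le
    exact hmono ⟨le_rfl, hxh⟩ ⟨hxh, le_rfl⟩ hxh
  · have hanti : AntitoneOn (fun x : ℝ => Real.sin x ^ 2 / x - x * K) (Set.Icc h x) := by
      refine antitoneOn_of_deriv_nonpos (convex_Icc _ _)
        (fun y hy => (hd y (hh0.trans_le hy.1)).continuousAt.continuousWithinAt)
        (fun y hy => ?_) fun y hy => ?_
      · rw [interior_Icc] at hy
        exact (hd y (hh0.trans hy.1)).differentiableAt.differentiableWithinAt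
      · rw [interior_Icc] at hy
        rw [(hd y (hh0.trans hy.1)).deriv, hK, sub_nonpos]
        exact antitoneOn_sin_two_mul_div ⟨hh0, hh1⟩ ⟨hh0.trans hy.1, by linarith [hy.2]⟩ hy.1.le
    exact hanti ⟨le_rfl, hxh⟩ ⟨hxh, le_rfl⟩ hxh

theorem exists_polar {p : ℝ × ℝ} (hp : 0 ≤ p.2) : ∃ r α : ℝ, 0 ≤ r ∧ 0 ≤ α ∧ α ≤ Real.pi ∧
    p.1 = r * Real.cos α ∧ p.2 = r * Real.sin α := by
  refine ⟨‖(⟨p.1, p.2⟩ : ℂ)‖, Complex.arg ⟨p.1, p.2⟩, norm_nonneg _,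
    Complex.arg_nonneg_iff.2 hp, Complex.arg_le_pi _, ?_, ?_⟩
  · exact (Complex.norm_mul_cos_arg ⟨p.1, p.2⟩).symm
  · exact (Complex.norm_mul_sin_arg ⟨p.1, p.2⟩).symm

/-- For `p` with polar coordinates `(r, α)` the excess is `2 r cos (t - α) - (1 + r² - R)`, positive
for `|t - α| < ψ`. Its integral is maximised first over `r`, where the best value is `sin ψ / ψ`,
and then over `ψ` by `sin_sq_div_sub_le`. -/
theorem integral_max_arc_le {p : ℝ × ℝ} (hp : 0 ≤ p.2) {R h : ℝ} (hR1 : R ≤ 1) (hh0 : 0 < h)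
    (hh1 : h ≤ Real.pi / 2) (hR : R ≤ arcPrice h) :
    ∫ t in (0 : ℝ)..Real.pi, max 0 (R - sqArc p t) ≤
      4 * (Real.sin h / h) * (Real.sin h - h * Real.cos h) := by
  obtain ⟨r, α, hr, hα0, hα1, h1, h2⟩ := exists_polar hp
  have hpi := Real.pi_pos
  have hf : ∀ t, R - sqArc p t = 2 * r * Real.cos (t - α) - (1 + r ^ 2 - R) := by
    intro t
    rw [sqArc, h1, h2, Real.cos_sub]
    have e1 := Real.sin_sq_add_cos_sq t
    have e2 := Real.sin_sq_add_cos_sq α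
    linear_combination (-1) * e1 - r ^ 2 * e2
  simp_rw [hf]
  have hpos : 0 ≤ 4 * (Real.sin h / h) * (Real.sin h - h * Real.cos h) := by
    have hs : 0 ≤ Real.sin h := Real.sin_nonneg_of_nonneg_of_le_pi hh0.le (by linarith)
    have : h * Real.cos h ≤ Real.sin h := by
      rcases hh1.lt_or_eq with hlt | heq
      · have hc : 0 < Real.cos h := Real.cos_pos_of_mem_Ioo ⟨by linarith, hlt⟩
        have := Real.le_tan hh0.le hlt
        rw [Real.tan_eq_sin_div_cos, le_div_iff₀ hc] at this
        exact this
      · rw [heq, Real.cos_pi_div_two, Real.sin_pi_div_two]; norm_num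
    have h3 := div_nonneg hs hh0.le
    exact mul_nonneg (by linarith) (by linarith)
  by_cases hc : 2 * r ≤ 1 + r ^ 2 - R
  · have : ∫ t in (0 : ℝ)..Real.pi, max 0 (2 * r * Real.cos (t - α) - (1 + r ^ 2 - R)) = 0 := by
      rw [intervalIntegral.integral_congr (g := fun _ => (0 : ℝ)), intervalIntegral.integral_zero]
      intro t _
      refine max_eq_left ?_
      have := Real.cos_le_one (t - α)
      nlinarith
    rw [this]
    exact hpos
  · push Not at hc
    have hr0 : 0 < r := by
      rcases hr.lt_or_eq with h | h
      · exact h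
      · rw [← h] at hc; nlinarith
    set c := (1 + r ^ 2 - R) / (2 * r) with hcdef
    have hcr : 1 + r ^ 2 - R = 2 * r * c := by rw [hcdef]; field_simp
    -- Here `R ≤ 1` enters: it keeps `ψ` below `π / 2`, the range of `sin_sq_div_sub_le`.
    have hc0 : 0 ≤ c := div_nonneg (by nlinarith) (by linarith)
    have hc1 : c < 1 := by rw [hcdef, div_lt_one (by linarith)]; exact hc
    set ψ := Real.arccos c with hψ
    have hcos : Real.cos ψ = c := Real.cos_arccos (by linarith) hc1.le
    have hψ0 : 0 < ψ := Real.arccos_pos.2 hc1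
    have hψ1 : ψ ≤ Real.pi / 2 := Real.arccos_le_pi_div_two.2 hc0
    have hle : ∫ t in (0 : ℝ)..Real.pi, max 0 (2 * r * Real.cos (t - α) - (1 + r ^ 2 - R)) ≤
        ∫ t in (α - ψ)..(α + ψ), (2 * r * Real.cos (t - α) - (1 + r ^ 2 - R)) := by
      refine integral_max_le_of_nonpos_off hpi.le (by linarith) (by fun_prop) ?_ ?_
      · intro t ht hoff
        have habs : ψ ≤ |t - α| := by
          by_contra hcon
          push Not at hcon
          rw [abs_lt] at hcon
          exact hoff ⟨by linarith [hcon.1], by linarith [hcon.2]⟩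
        have hpi' : |t - α| ≤ Real.pi :=
          abs_le.2 ⟨by linarith [ht.1], by linarith [ht.2]⟩
        have := Real.cos_le_cos_of_nonneg_of_le_pi hψ0.le hpi' habs
        rw [Real.cos_abs, hcos] at this
        rw [hcr]
        nlinarith
      · intro t ht
        have habs : |t - α| ≤ ψ := abs_le.2 ⟨by linarith [ht.1], by linarith [ht.2]⟩
        have := Real.cos_le_cos_of_nonneg_of_le_pi (abs_nonneg _) (by linarith) habs
        rw [Real.cos_abs, hcos] at this
        rw [hcr]
        nlinarith
    refine hle.trans ?_
    rw [intervalIntegral.integral_comp_sub_right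
      (fun t => 2 * r * Real.cos t - (1 + r ^ 2 - R)) α]
    have hint : ∫ t in (α - ψ - α)..(α + ψ - α), (2 * r * Real.cos t - (1 + r ^ 2 - R)) =
        4 * r * Real.sin ψ - 2 * ψ * (1 + r ^ 2 - R) := by
      rw [intervalIntegral.integral_sub (Continuous.intervalIntegrable (by fun_prop) _ _)
        (Continuous.intervalIntegrable (by fun_prop) _ _), intervalIntegral.integral_const_mul,
        integral_cos, intervalIntegral.integral_const,
        show α - ψ - α = -ψ by ring, show α + ψ - α = ψ by ring, Real.sin_neg, smul_eq_mul]
      ring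
    rw [hint]
    have hF := sin_sq_div_sub_le hψ0 hψ1 hh0 hh1
    -- Completion of the square in `r`, with equality at the centroid `r = sin ψ / ψ`.
    have hsq : 4 * r * Real.sin ψ - 2 * ψ * r ^ 2 ≤ 2 * (Real.sin ψ ^ 2 / ψ) := by
      have : 2 * (Real.sin ψ ^ 2 / ψ) - (4 * r * Real.sin ψ - 2 * ψ * r ^ 2) =
          2 * (Real.sin ψ - r * ψ) ^ 2 / ψ := by field_simp; ring
      have h0 : 0 ≤ 2 * (Real.sin ψ - r * ψ) ^ 2 / ψ := by positivity
      linarith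
    have hRh : ψ * (1 - arcPrice h) ≤ ψ * (1 - R) :=
      mul_le_mul_of_nonneg_left (by linarith) hψ0.le
    linarith

/-- The largest possible gain of a point that serves arc points only. -/
theorem gain_le_of_far_from_base {gB gA : ℝ → ℝ} {p : ℝ × ℝ} {R h : ℝ} (hp : 0 ≤ p.2)
    (hcA : Continuous gA) (hR1 : R ≤ 1) (hh0 : 0 < h) (hh1 : h ≤ Real.pi / 2)
    (hR : R ≤ arcPrice h) (hB : ∀ t ∈ Set.Icc (-1 : ℝ) 1, gB t ≤ p.2 ^ 2)
    (hA : ∀ t ∈ Set.Icc (0 : ℝ) Real.pi, gA t ≤ R) :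
    gain gB gA p ≤ arcGain h := by
  have hpi := Real.pi_pos
  have hB0 : ∫ t in (-1 : ℝ)..1, max 0 (gB t - sqBase p t) = 0 := by
    rw [intervalIntegral.integral_congr (g := fun _ => (0 : ℝ)), intervalIntegral.integral_zero]
    intro t ht
    rw [Set.uIcc_of_le (by norm_num)] at ht
    refine max_eq_left ?_
    have := hB t ht
    unfold sqBase
    nlinarith [sq_nonneg (t - p.1)]
  have c1 := continuous_sqArc p
  have h1 : ∫ t in (0 : ℝ)..Real.pi, max 0 (gA t - sqArc p t) ≤
      ∫ t in (0 : ℝ)..Real.pi, max 0 (R - sqArc p t) := by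
    refine intervalIntegral.integral_mono_on hpi.le
      (Continuous.intervalIntegrable (by fun_prop) _ _)
      (Continuous.intervalIntegrable (by fun_prop) _ _) fun t ht => max_le_max le_rfl ?_
    linarith [hA t ht]
  have h2 := h1.trans (integral_max_arc_le hp hR1 hh0 hh1 hR)
  unfold gain arcGain
  rw [hB0, mul_zero, zero_add]
  calc _ ≤ 1 / (2 * Real.pi) * (4 * (Real.sin h / h) * (Real.sin h - h * Real.cos h)) :=
        mul_le_mul_of_nonneg_left h2 (by positivity)
    _ = _ := by field_simp; ring

/-- Triangle inequality: a point of norm at most `1 - ρ` has distance at least `ρ` from the unit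
circle. -/
theorem le_sqArc_of_norm_le {p : ℝ × ℝ} {ρ : ℝ} (h0 : 0 ≤ ρ) (h1 : ρ ≤ 1)
    (hp : p.1 ^ 2 + p.2 ^ 2 ≤ (1 - ρ) ^ 2) (t : ℝ) : ρ ^ 2 ≤ sqArc p t := by
  have e := Real.sin_sq_add_cos_sq t
  set n := Real.sqrt (p.1 ^ 2 + p.2 ^ 2) with hn
  have hn2 : n ^ 2 = p.1 ^ 2 + p.2 ^ 2 := Real.sq_sqrt (by positivity)
  have hn0 : 0 ≤ n := Real.sqrt_nonneg _
  have hn1 : n ≤ 1 - ρ := abs_le_of_sq_le_sq' (by rw [hn2]; exact hp) (by linarith) |>.2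
  have hcs : p.1 * Real.cos t + p.2 * Real.sin t ≤ n := by
    refine (abs_le_of_sq_le_sq' ?_ hn0).2
    rw [hn2]
    nlinarith [sq_nonneg (p.1 * Real.sin t - p.2 * Real.cos t)]
  have : sqArc p t = 1 + n ^ 2 - 2 * (p.1 * Real.cos t + p.2 * Real.sin t) := by
    rw [hn2, sqArc]; linear_combination e
  rw [this]
  nlinarith

end HalfDisc

/-! ### Discretisation: trapezoidal rule for the integrals, bilinear interpolation in the point -/

namespace HalfDisc

theorem integral_affine_interp (a Δ F0 F1 : ℝ) (hΔ : 0 < Δ) :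
    ∫ t in a..(a + Δ), (F0 + (t - a) / Δ * (F1 - F0)) = Δ / 2 * (F0 + F1) := by
  have h : ∀ t : ℝ, HasDerivAt (fun t => F0 * t + (t - a) ^ 2 / (2 * Δ) * (F1 - F0))
      (F0 + (t - a) / Δ * (F1 - F0)) t := by
    intro t
    have h1 := (((hasDerivAt_id t).sub_const a).pow 2).div_const (2 * Δ)
    have h2 := ((hasDerivAt_id t).const_mul F0).add (h1.mul_const (F1 - F0))
    refine h2.congr_deriv ?_
    simp only [id, Nat.cast_ofNat]
    field_simp
    ring
  rw [intervalIntegral.integral_eq_sub_of_hasDerivAt (fun t _ => h t)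
    (Continuous.intervalIntegrable (by fun_prop) _ _)]
  field_simp
  ring

/-- The trapezoidal rule bounds the integral of a function that lies below the chords of its
nodal values. -/
theorem integral_le_trapezoid {a Δ : ℝ} (hΔ : 0 < Δ) (N : ℕ) {f : ℝ → ℝ} (hf : Continuous f)
    (F : ℕ → ℝ)
    (h : ∀ j < N, ∀ s ∈ Set.Icc (0 : ℝ) 1, f (a + (j + s) * Δ) ≤ (1 - s) * F j + s * F (j + 1)) :
    ∫ t in a..(a + N * Δ), f t ≤ Δ / 2 * ∑ j ∈ Finset.range N, (F j + F (j + 1)) := by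
  have h1 := intervalIntegral.sum_integral_adjacent_intervals (f := f) (μ := volume)
    (a := fun j : ℕ => a + j * Δ) (n := N) fun j _ => hf.intervalIntegrable _ _
  simp only [Nat.cast_zero, zero_mul, add_zero] at h1
  rw [← h1, Finset.mul_sum]
  refine Finset.sum_le_sum fun j hj => ?_
  have e : a + ((j + 1 : ℕ) : ℝ) * Δ = (a + j * Δ) + Δ := by push_cast; ring
  rw [e, ← integral_affine_interp _ _ _ _ hΔ]
  refine intervalIntegral.integral_mono_on (by linarith) (hf.intervalIntegrable _ _)
    (Continuous.intervalIntegrable (by fun_prop) _ _) fun t ht => ?_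
  have h2 := h j (Finset.mem_range.1 hj) ((t - (a + j * Δ)) / Δ)
    ⟨div_nonneg (by linarith [ht.1]) hΔ.le, (div_le_one hΔ).2 (by linarith [ht.2])⟩
  have e2 : a + (j + (t - (a + j * Δ)) / Δ) * Δ = t := by field_simp; ring
  rw [e2] at h2
  linarith

/-- The positive part is monotone and convex, so an upper bound by a chord survives truncation. -/
theorem max_le_of_le_interp {s x A B : ℝ} (h0 : 0 ≤ s) (h1 : s ≤ 1)
    (h : x ≤ (1 - s) * A + s * B) : max 0 x ≤ (1 - s) * max 0 A + s * max 0 B := by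
  have h2 : 0 ≤ 1 - s := by linarith
  refine max_le (by positivity) (h.trans ?_)
  exact add_le_add (mul_le_mul_of_nonneg_left (le_max_right _ _) h2)
    (mul_le_mul_of_nonneg_left (le_max_right _ _) h0)

/-- A linear combination of sine and cosine with coefficient vector in the unit disc lies at most
`δ ^ 2 / 8` above its chords over intervals of length `δ`. -/
theorem trig_le_interp {p : ℝ × ℝ} (hp : p.1 ^ 2 + p.2 ^ 2 ≤ 1) (x δ s : ℝ) (h0 : 0 ≤ s)
    (h1 : s ≤ 1) :
    p.1 * Real.cos (x + s * δ) + p.2 * Real.sin (x + s * δ) ≤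
      (1 - s) * (p.1 * Real.cos x + p.2 * Real.sin x) +
        s * (p.1 * Real.cos (x + δ) + p.2 * Real.sin (x + δ)) + δ ^ 2 / 8 := by
  -- The second derivative of the trigonometric part is at least `-1` because the coefficients lie
  -- in the unit disc, so adding `t² / 2` makes it convex. The chord of `t² / 2` exceeds it by `s (1
  -- - s) δ² / 2`, at most `δ² / 8`.
  set f : ℝ → ℝ := fun t => p.1 * Real.cos t + p.2 * Real.sin t + t ^ 2 / 2 with hf
  have d1 : ∀ t, HasDerivAt f (-p.1 * Real.sin t + p.2 * Real.cos t + t) t := by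
    intro t
    have := (((Real.hasDerivAt_cos t).const_mul p.1).add
      ((Real.hasDerivAt_sin t).const_mul p.2)).add (((hasDerivAt_id t).pow 2).div_const 2)
    refine this.congr_deriv ?_
    simp
  have d2 : ∀ t, HasDerivAt (fun t => -p.1 * Real.sin t + p.2 * Real.cos t + t)
      (-p.1 * Real.cos t - p.2 * Real.sin t + 1) t := by
    intro t
    have := (((Real.hasDerivAt_sin t).const_mul (-p.1)).add
      ((Real.hasDerivAt_cos t).const_mul p.2)).add (hasDerivAt_id t)
    refine this.congr_deriv ?_
    ring
  have e1 : deriv f = fun t => -p.1 * Real.sin t + p.2 * Real.cos t + t :=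
    funext fun t => (d1 t).deriv
  have hconv : ConvexOn ℝ Set.univ f := by
    refine MonotoneOn.convexOn_of_deriv convex_univ
      (fun t _ => (d1 t).continuousAt.continuousWithinAt)
      (fun t _ => (d1 t).differentiableAt.differentiableWithinAt) ?_
    rw [e1]
    refine (monotone_of_deriv_nonneg (fun t => (d2 t).differentiableAt) fun t => ?_).monotoneOn _
    rw [(d2 t).deriv]
    have := Real.sin_sq_add_cos_sq t
    nlinarith [sq_nonneg (p.1 - Real.cos t), sq_nonneg (p.2 - Real.sin t)]
  have h2 := hconv.2 (Set.mem_univ x) (Set.mem_univ (x + δ)) (sub_nonneg.2 h1) h0 (by ring)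
  simp only [smul_eq_mul, hf] at h2
  have e2 : (1 - s) * x + s * (x + δ) = x + s * δ := by ring
  rw [e2] at h2
  nlinarith [mul_nonneg (sq_nonneg (s - 1 / 2)) (sq_nonneg δ)]

/-- Upper bound for the gain of a point of the unit disc by the trapezoidal rule with `N` pieces on
the base and on the arc, when the prices lie below the chords of nodal values. -/
theorem gain_le_trapezoid {gB gA : ℝ → ℝ} {a : ℝ × ℝ} (N : ℕ) (hN : 0 < N)
    (hcB : Continuous gB) (hcA : Continuous gA) (ha : a.1 ^ 2 + a.2 ^ 2 ≤ 1) (GB GA : ℕ → ℝ)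
    (hB : ∀ j < N, ∀ s ∈ Set.Icc (0 : ℝ) 1,
      gB (-1 + (j + s) * (2 / N)) ≤ (1 - s) * GB j + s * GB (j + 1))
    (hA : ∀ j < N, ∀ s ∈ Set.Icc (0 : ℝ) 1,
      gA (0 + (j + s) * (Real.pi / N)) ≤ (1 - s) * GA j + s * GA (j + 1)) :
    gain gB gA a ≤ 1 / (4 * N) * (
      ∑ j ∈ Finset.range N, (max 0 (GB j + 1 / N ^ 2 - sqBase a (-1 + j * (2 / N))) +
        max 0 (GB (j + 1) + 1 / N ^ 2 - sqBase a (-1 + (j + 1 : ℕ) * (2 / N)))) +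
      ∑ j ∈ Finset.range N, (max 0 (GA j + Real.pi ^ 2 / (4 * N ^ 2) -
          sqArc a (j * (Real.pi / N))) +
        max 0 (GA (j + 1) + Real.pi ^ 2 / (4 * N ^ 2) -
          sqArc a ((j + 1 : ℕ) * (Real.pi / N))))) := by
  have hN' : (0 : ℝ) < N := Nat.cast_pos.2 hN
  have c1 := continuous_sqBase a
  have c2 := continuous_sqArc a
  -- `-sqBase a` exceeds its chords by `s (1 - s) (2 / N)²`, at most `1 / N²`; this is the
  -- correction added to the nodal values on the base.
  have b1 := integral_le_trapezoid (a := -1) (Δ := 2 / N) (by positivity) N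
    (f := fun t => max 0 (gB t - sqBase a t)) (by fun_prop)
    (fun j => max 0 (GB j + 1 / N ^ 2 - sqBase a (-1 + j * (2 / N)))) (by
      intro j hj s hs
      refine max_le_of_le_interp hs.1 hs.2 ?_
      have h1 := hB j hj s hs
      have e : sqBase a (-1 + (j + s) * (2 / N)) = (1 - s) * sqBase a (-1 + j * (2 / N)) +
          s * sqBase a (-1 + (j + 1 : ℕ) * (2 / N)) - s * (1 - s) * (2 / N) ^ 2 := by
        simp only [sqBase]; push_cast; ring
      have e2 : (2 / (N : ℝ)) ^ 2 = 4 * (1 / N ^ 2) := by field_simp; norm_num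
      rw [e, e2]
      have : (0 : ℝ) ≤ 1 / N ^ 2 := by positivity
      nlinarith [mul_nonneg (sq_nonneg (s - 1 / 2)) this])
  have b2 := integral_le_trapezoid (a := 0) (Δ := Real.pi / N)
    (div_pos Real.pi_pos hN') N
    (f := fun t => max 0 (gA t - sqArc a t)) (by fun_prop)
    (fun j => max 0 (GA j + Real.pi ^ 2 / (4 * N ^ 2) - sqArc a (j * (Real.pi / N)))) (by
      intro j hj s hs
      refine max_le_of_le_interp hs.1 hs.2 ?_
      have h1 := hA j hj s hs
      have h2 := trig_le_interp ha (j * (Real.pi / N)) (Real.pi / N) s hs.1 hs.2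
      have e : ∀ t, sqArc a t =
          1 + (a.1 ^ 2 + a.2 ^ 2) - 2 * (a.1 * Real.cos t + a.2 * Real.sin t) := by
        intro t
        rw [sqArc]; linear_combination Real.sin_sq_add_cos_sq t
      have e1 : 0 + (j + s) * (Real.pi / N) = j * (Real.pi / N) + s * (Real.pi / N) := by ring
      have e2 : ((j + 1 : ℕ) : ℝ) * (Real.pi / N) = j * (Real.pi / N) + Real.pi / N := by
        push_cast; ring
      -- The trigonometric part of `-sqArc` carries the factor `2`, so twice the bound of
      -- `trig_le_interp` gives the correction `π² / (4 N²)` on the arc.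
      have e3 : (Real.pi / N) ^ 2 / 8 = Real.pi ^ 2 / (4 * N ^ 2) / 2 := by field_simp; norm_num
      rw [e3] at h2
      rw [e1] at h1 ⊢
      rw [e2, e, e, e]
      nlinarith)
  have e1 : (-1 : ℝ) + N * (2 / N) = 1 := by field_simp; norm_num
  have e2 : (0 : ℝ) + N * (Real.pi / N) = Real.pi := by field_simp; norm_num
  rw [e1] at b1
  rw [e2] at b2
  have hpi := Real.pi_pos
  unfold gain
  calc _ ≤ _ := add_le_add (mul_le_mul_of_nonneg_left b1 (by norm_num))
        (mul_le_mul_of_nonneg_left b2 (by positivity))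
    _ = _ := by
        rw [mul_add (1 / (4 * (N : ℝ)))]
        congr 1
        · rw [← mul_assoc]; congr 1; field_simp
        · rw [← mul_assoc]; congr 1; field_simp; try norm_num

/-- Bilinear interpolation from the corners of a square cell of side `1 / G`. -/
theorem max_le_bilinear {G s t x y X Y K : ℝ} (hG : 0 < G) (hs0 : 0 ≤ s) (hs1 : s ≤ 1)
    (ht0 : 0 ≤ t) (ht1 : t ≤ 1) :
    max 0 (K + 2 * (X * ((x + s) / G) + Y * ((y + t) / G)) - (((x + s) / G) ^ 2 + ((y + t) / G) ^ 2)) ≤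
      (1 - s) * ((1 - t) * max 0 (K + 1 / (2 * G ^ 2) + 2 * (X * (x / G) + Y * (y / G)) -
          ((x / G) ^ 2 + (y / G) ^ 2)) +
        t * max 0 (K + 1 / (2 * G ^ 2) + 2 * (X * (x / G) + Y * ((y + 1) / G)) -
          ((x / G) ^ 2 + ((y + 1) / G) ^ 2))) +
      s * ((1 - t) * max 0 (K + 1 / (2 * G ^ 2) + 2 * (X * ((x + 1) / G) + Y * (y / G)) -
          (((x + 1) / G) ^ 2 + (y / G) ^ 2)) +
        t * max 0 (K + 1 / (2 * G ^ 2) + 2 * (X * ((x + 1) / G) + Y * ((y + 1) / G)) -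
          (((x + 1) / G) ^ 2 + ((y + 1) / G) ^ 2))) := by
  -- The estimate in one coordinate costs `1 / (4 G²)`; applied to each coordinate in turn it costs
  -- `1 / (2 G²)`.
  have key : ∀ z r : ℝ, 0 ≤ r → r ≤ 1 → ∀ Z L : ℝ,
      max 0 (L + 2 * (Z * ((z + r) / G)) - ((z + r) / G) ^ 2) ≤
        (1 - r) * max 0 (L + 1 / (4 * G ^ 2) + 2 * (Z * (z / G)) - (z / G) ^ 2) +
          r * max 0 (L + 1 / (4 * G ^ 2) + 2 * (Z * ((z + 1) / G)) - ((z + 1) / G) ^ 2) := by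
    intro z r hr0 hr1 Z L
    refine max_le_of_le_interp hr0 hr1 ?_
    have : ((z + r) / G) ^ 2 = (1 - r) * (z / G) ^ 2 + r * ((z + 1) / G) ^ 2 -
        r * (1 - r) * (4 * (1 / (4 * G ^ 2))) := by field_simp; ring
    rw [this]
    have h4 : 0 ≤ 1 / (4 * G ^ 2) := by positivity
    have : 2 * (Z * ((z + r) / G)) = (1 - r) * (2 * (Z * (z / G))) +
      r * (2 * (Z * ((z + 1) / G))) := by field_simp; ring
    rw [this]
    nlinarith [mul_nonneg (sq_nonneg (r - 1 / 2)) h4]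
  have hs : 0 ≤ 1 - s := by linarith
  have h1 := key x s hs0 hs1 X (K + 2 * (Y * ((y + t) / G)) - ((y + t) / G) ^ 2)
  have h2 := key y t ht0 ht1 Y (K + 1 / (4 * G ^ 2) + 2 * (X * (x / G)) - (x / G) ^ 2)
  have h3 := key y t ht0 ht1 Y (K + 1 / (4 * G ^ 2) + 2 * (X * ((x + 1) / G)) - ((x + 1) / G) ^ 2)
  have e4 : 1 / (2 * G ^ 2) = 1 / (4 * G ^ 2) + 1 / (4 * G ^ 2) := by field_simp; norm_num
  rw [e4]
  have h4 := add_le_add (mul_le_mul_of_nonneg_left h2 hs) (mul_le_mul_of_nonneg_left h3 hs0)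
  calc _ = max 0 (K + 2 * (Y * ((y + t) / G)) - ((y + t) / G) ^ 2 + 2 * (X * ((x + s) / G)) -
        ((x + s) / G) ^ 2) := by congr 1; ring
    _ ≤ _ := h1
    _ = _ := by ring_nf
    _ ≤ _ := h4
    _ = _ := by ring_nf

end HalfDisc

/-! ### Integer certificates for gains on a grid, and their soundness -/

namespace HalfDisc

/-- A list of triples of natural numbers; the evaluation below is run by the kernel. -/
inductive Nodes : Type
  | nil : Nodes
  | cons (x y m : ℕ) (l : Nodes) : Nodes

namespace Nodes

/-- The list of the triples `(f j, g j, h j)`, `j < n`. -/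
noncomputable def ofFn (f g h : ℕ → ℕ) (n : ℕ) : Nodes :=
  Nat.rec nil (fun j l => cons (f j) (g j) (h j) l) n

/-- The sum of the truncated differences `m + i x + k y - q` over the triples of a list. -/
noncomputable def eval (i k q : ℕ) (l : Nodes) : ℕ :=
  Nodes.rec 0 (fun x y m _ s =>
    Nat.add (Nat.sub (Nat.add m (Nat.add (Nat.mul i x) (Nat.mul k y))) q) s) l

/-- Truncated subtraction of natural numbers plays the role of the positive part. -/
theorem eval_ofFn (i k q : ℕ) (f g h : ℕ → ℕ) (n : ℕ) :
    eval i k q (ofFn f g h n) = ∑ j ∈ Finset.range n, (h j + (i * f j + k * g j) - q) := by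
  induction n with
  | zero => rfl
  | succ n ih =>
    rw [Finset.sum_range_succ, ← ih]
    exact Nat.add_comm _ _

end Nodes

/-- Bounded universal quantifier, evaluated by the kernel. -/
noncomputable def allBelow (p : ℕ → Bool) (n : ℕ) : Bool :=
  Nat.rec true (fun d b => cond (p d) b false) n

theorem allBelow_iff (p : ℕ → Bool) (n : ℕ) : allBelow p n = true ↔ ∀ d < n, p d = true := by
  induction n with
  | zero => simp [allBelow]
  | succ n ih =>
    have : allBelow p (n + 1) = cond (p n) (allBelow p n) false := rfl
    rw [this]
    cases h : p n
    · simp only [cond_false, Bool.false_eq_true, false_iff]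
      intro h'
      simpa [h] using h' n (Nat.lt_succ_self n)
    · rw [cond_true, ih]
      constructor
      · intro h1 d hd
        rcases Nat.lt_succ_iff_lt_or_eq.1 hd with h2 | rfl
        · exact h1 d h2
        · exact h
      · intro h1 d hd
        exact h1 d (hd.trans (Nat.lt_succ_self n))

/-- Projection of the line to the unit interval. -/
noncomputable def clamp (x : ℝ) : ℝ := max 0 (min 1 x)

theorem clamp_nonneg (x : ℝ) : 0 ≤ clamp x := le_max_left _ _

theorem clamp_of_nonpos {x : ℝ} (h : x ≤ 0) : clamp x = 0 :=
  max_eq_left ((min_le_right _ _).trans h)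

theorem clamp_of_one_le {x : ℝ} (h : 1 ≤ x) : clamp x = 1 := by
  rw [clamp, min_eq_left h, max_eq_right zero_le_one]

theorem clamp_of_mem {x : ℝ} (h0 : 0 ≤ x) (h1 : x ≤ 1) : clamp x = x := by
  rw [clamp, min_eq_right h1, max_eq_right h0]

/-- The ramp on the base: `1` on the last `j` nodes next to the right corner, `0` farther away. -/
noncomputable def rampBase (N j : ℕ) (t : ℝ) : ℝ := clamp (j - N * (1 - t) / 2)

/-- The ramp on the arc: `1` on the first `i` nodes next to the right corner, `0` farther away. -/
noncomputable def rampArc (N i : ℕ) (t : ℝ) : ℝ := clamp (i - N * t / Real.pi)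

theorem continuous_rampBase (N j : ℕ) : Continuous (rampBase N j) := by
  unfold rampBase clamp; fun_prop

theorem continuous_rampArc (N i : ℕ) : Continuous (rampArc N i) := by
  unfold rampArc clamp; fun_prop

theorem rampBase_interp {N : ℕ} (hN : 0 < N) (j1 j : ℕ) {s : ℝ} (hs : s ∈ Set.Icc (0 : ℝ) 1) :
    rampBase N j1 (-1 + (j + s) * (2 / N)) =
      (1 - s) * (if N < j + j1 then 1 else 0) + s * (if N < j + 1 + j1 then 1 else 0) := by
  have hN' : (0 : ℝ) < N := Nat.cast_pos.2 hN
  have e : (j1 : ℝ) - N * (1 - (-1 + (j + s) * (2 / N))) / 2 = j1 + j - N + s := by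
    field_simp; ring
  rw [rampBase, e]
  rcases lt_trichotomy N (j + j1) with h | h | h
  · have h' : (N : ℝ) + 1 ≤ j + j1 := by exact_mod_cast h
    rw [if_pos h, if_pos (by omega), clamp_of_one_le (by linarith [hs.1])]; ring
  · have h' : (N : ℝ) = j + j1 := by exact_mod_cast h
    rw [if_neg (by omega), if_pos (by omega), clamp_of_mem (by linarith [hs.1]) (by linarith [hs.2])]
    linarith
  · have h' : (j : ℝ) + j1 + 1 ≤ N := by exact_mod_cast h
    rw [if_neg (by omega), if_neg (by omega), clamp_of_nonpos (by linarith [hs.2])]; ring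

theorem rampArc_interp {N : ℕ} (hN : 0 < N) (i1 j : ℕ) {s : ℝ} (hs : s ∈ Set.Icc (0 : ℝ) 1) :
    rampArc N i1 (0 + (j + s) * (Real.pi / N)) =
      (1 - s) * (if j < i1 then 1 else 0) + s * (if j + 1 < i1 then 1 else 0) := by
  have hN' : (0 : ℝ) < N := Nat.cast_pos.2 hN
  have hpi := Real.pi_pos
  have e : (i1 : ℝ) - N * (0 + (j + s) * (Real.pi / N)) / Real.pi = i1 - j - s := by
    field_simp; ring
  rw [rampArc, e]
  rcases lt_trichotomy i1 (j + 1) with h | h | h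
  · have h' : (i1 : ℝ) + 1 ≤ j + 1 := by exact_mod_cast h
    rw [if_neg (by omega), if_neg (by omega), clamp_of_nonpos (by linarith [hs.1])]; ring
  · have h' : (i1 : ℝ) = j + 1 := by exact_mod_cast h
    rw [if_pos (by omega), if_neg (by omega), clamp_of_mem (by linarith [hs.2]) (by linarith [hs.1])]
    linarith
  · have h' : (j : ℝ) + 1 + 1 ≤ i1 := by exact_mod_cast h
    rw [if_pos (by omega), if_pos h, clamp_of_one_le (by linarith [hs.2])]; ring

/-- Parameters of a grid certificate: the constant prices are `B / S` and `R / S`, they are lowered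
by `δB / S` and `δA / S` on `jB` nodes of the base and `jA` nodes of the arc next to the right
corner; the grid has mesh `1 / G`. The `N` pieces of base and arc and the scale `S = N ^ 2 * M` are
common to all certificates. -/
structure Cert where
  G : ℕ
  B : ℕ
  R : ℕ
  δB : ℕ
  δA : ℕ
  jB : ℕ
  jA : ℕ

/-- A rectangle of grid points. -/
structure Rect where
  x : ℕ
  w : ℕ
  y : ℕ
  h : ℕ

section

variable (N M : ℕ) (AX AY : ℕ → ℕ)

/-- With `S = N² M`, this is `S (X + 1)` for the abscissa `X = -1 + 2 j / N` of the node; the shift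
by `1` keeps all data in the natural numbers. -/
noncomputable def baseX (j : ℕ) : ℕ := 2 * j * N * M

/-- This is `S G² (K + 2) + S / 2`, where `K` is the nodal price plus `1 / N²` minus `X²`, and `1 -
X² = 4 j (N - j) / N²`. The `2` is a shift that is removed again in `checkPoint`; `S / 2` is the
interpolation correction `1 / (2 G²)` after scaling. -/
noncomputable def baseM (c : Cert) (j : ℕ) : ℕ :=
  c.G * c.G * (N * N * M + (c.B - cond (Nat.blt N (j + c.jB)) c.δB 0) + M + 4 * M * j * (N - j)) +
    N * N * M / 2

/-- The analogue for the arc, where `X² + Y² = 1`. The number `2.467425` is an upper bound of `π² /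
4`, and the added `1` makes up for the integer division. -/
noncomputable def arcM (c : Cert) (j : ℕ) : ℕ :=
  c.G * c.G * (N * N * M + (c.R - cond (Nat.blt j c.jA) c.δA 0) + (M * 2467425 / 1000000 + 1)) +
    N * N * M / 2

/-- The value of one node at a grid point. -/
noncomputable def nodeVal (i k q x y m : ℕ) : ℕ := m + (i * x + k * y) - q

/-- The bound of the gain at the grid point `(i, k)` is at most `C`. -/
noncomputable def checkPoint (c : Cert) (base arc : Nodes) (C i k : ℕ) : Bool :=
  -- `q` contains the squared norm of the grid point, the term that undoes the shift of the
  -- abscissae by `1`, and the one that undoes the shift of the constants by `2`.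
  let q := N * N * M * (i * i + k * k) + 2 * c.G * (N * N * M) * i + 2 * (N * N * M) * c.G * c.G
  -- The trapezoidal sum is twice the sum over all nodes minus the end values; these are moved to
  -- the other side so that nothing is subtracted.
  Nat.ble (2 * (base.eval (2 * c.G * i) (2 * c.G * k) q + arc.eval (2 * c.G * i) (2 * c.G * k) q))
    (C + (nodeVal (2 * c.G * i) (2 * c.G * k) q (baseX N M 0) 0 (baseM N M c 0) +
      nodeVal (2 * c.G * i) (2 * c.G * k) q (baseX N M N) 0 (baseM N M c N) +
      nodeVal (2 * c.G * i) (2 * c.G * k) q (AX 0) (AY 0) (arcM N M c 0) +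
      nodeVal (2 * c.G * i) (2 * c.G * k) q (AX N) (AY N) (arcM N M c N)))

noncomputable def baseNodes (c : Cert) : Nodes :=
  Nodes.ofFn (baseX N M) (fun _ => 0) (baseM N M c) (N + 1)

noncomputable def arcNodes (c : Cert) : Nodes := Nodes.ofFn AX AY (arcM N M c) (N + 1)

noncomputable def checkRect (c : Cert) (C : ℕ) (r : Rect) : Bool :=
  allBelow (fun d => allBelow (fun e =>
    checkPoint N M AX AY c (baseNodes N M c) (arcNodes N M AX AY c) C (r.x + d) (r.y + e))
      (r.h + 1)) (r.w + 1)

theorem sum_add_succ (n : ℕ) (u : ℕ → ℝ) :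
    ∑ j ∈ Finset.range n, (u j + u (j + 1)) = 2 * ∑ j ∈ Finset.range (n + 1), u j - u 0 - u n := by
  induction n with
  | zero => simp; ring
  | succ n ih => rw [Finset.sum_range_succ, ih, Finset.sum_range_succ _ (n + 1)]; ring

/-- The value of a node at a grid point bounds the truncated excess. -/
theorem max_le_nodeVal {S G X Y K : ℝ} {i k g s x y m : ℕ} (hG : G = g) (hS : S = s) (hG0 : 0 < g)
    (hS0 : 0 < s)
    (hx : S * (X + 1) ≤ x) (hy : S * Y ≤ y) (hm : S * G ^ 2 * (K + 2) + S / 2 ≤ m) :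
    S * G ^ 2 * max 0 (K + 1 / (2 * G ^ 2) + 2 * (X * (i / G) + Y * (k / G)) -
        ((i / G) ^ 2 + (k / G) ^ 2)) ≤
      (nodeVal (2 * g * i) (2 * g * k) (s * (i * i + k * k) + 2 * g * s * i + 2 * s * g * g)
        x y m : ℕ) := by
  have hG' : 0 < G := by rw [hG]; exact_mod_cast hG0
  have hS' : 0 < S := by rw [hS]; exact_mod_cast hS0
  rw [mul_max_of_nonneg _ _ (by positivity), mul_zero]
  refine max_le (Nat.cast_nonneg _) ?_
  unfold nodeVal
  have h2 : ((m + (2 * g * i * x + 2 * g * k * y) : ℕ) : ℝ) -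
      ((s * (i * i + k * k) + 2 * g * s * i + 2 * s * g * g : ℕ) : ℝ) ≤
      ((m + (2 * g * i * x + 2 * g * k * y) -
        (s * (i * i + k * k) + 2 * g * s * i + 2 * s * g * g) : ℕ) : ℝ) := by
    rw [sub_le_iff_le_add]
    exact_mod_cast (le_tsub_add : _ ≤ _ - _ + _)
  refine le_trans ?_ h2
  push_cast
  rw [← hG, ← hS]
  have hi : (0 : ℝ) ≤ i := Nat.cast_nonneg _
  have hk : (0 : ℝ) ≤ k := Nat.cast_nonneg _
  have e : S * G ^ 2 * (K + 1 / (2 * G ^ 2) + 2 * (X * (i / G) + Y * (k / G)) -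
        ((i / G) ^ 2 + (k / G) ^ 2)) = (S * G ^ 2 * (K + 2) + S / 2) + 2 * G * i * (S * (X + 1)) +
        2 * G * k * (S * Y) - (S * (i * i + k * k) + 2 * G * S * i + 2 * S * G * G) := by
    field_simp; ring
  rw [e]
  have h3 := mul_le_mul_of_nonneg_left hx (by positivity : 0 ≤ 2 * G * i)
  have h4 := mul_le_mul_of_nonneg_left hy (by positivity : 0 ≤ 2 * G * k)
  linarith

/-- Real coordinates of the nodes. -/
noncomputable def nodeBase (j : ℕ) : ℝ := -1 + j * (2 / N)

variable {N M AX AY}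

theorem baseX_eq (hN : 0 < N) (j : ℕ) :
    ((N * N * M : ℕ) : ℝ) * (nodeBase N j + 1) = baseX N M j := by
  have hN' : (0 : ℝ) < N := Nat.cast_pos.2 hN
  simp only [nodeBase, baseX]; push_cast; field_simp; ring

theorem half_scale (hM : 2 ∣ M) : (((N * N * M / 2 : ℕ) : ℝ)) = ((N * N * M : ℕ) : ℝ) / 2 := by
  rw [Nat.cast_div (Dvd.dvd.mul_left hM _) (by norm_num)]; norm_num

theorem cast_sub_cond (b : Bool) {p : Prop} [Decidable p] (h : b = true ↔ p) {B δ : ℕ}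
    (hδ : δ ≤ B) : ((B - cond b δ 0 : ℕ) : ℝ) = B - δ * (if p then 1 else 0) := by
  cases b
  · rw [if_neg (by simpa using h)]; simp
  · rw [if_pos (by simpa using h)]; simp [Nat.cast_sub hδ]

theorem baseM_eq (hN : 0 < N) (hM : 2 ∣ M) (hM0 : 0 < M) (c : Cert) (hδ : c.δB ≤ c.B) {j : ℕ}
    (hj : j ≤ N) :
    ((N * N * M : ℕ) : ℝ) * (c.G : ℝ) ^ 2 * (((c.B : ℝ) / (N * N * M : ℕ) -
        (c.δB : ℝ) / (N * N * M : ℕ) * (if N < j + c.jB then 1 else 0)) + 1 / N ^ 2 -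
          nodeBase N j ^ 2 + 2) + ((N * N * M : ℕ) : ℝ) / 2 = baseM N M c j := by
  have hN' : (0 : ℝ) < N := Nat.cast_pos.2 hN
  have hM' : (0 : ℝ) < M := Nat.cast_pos.2 hM0
  simp only [baseM]
  rw [Nat.cast_add, half_scale hM]
  simp only [Nat.cast_mul, Nat.cast_add]
  rw [cast_sub_cond (p := N < j + c.jB) _ (by simp [Nat.blt_eq]) hδ, Nat.cast_sub hj]
  simp only [nodeBase]
  push_cast
  field_simp
  ring

theorem arcM_ge (hN : 0 < N) (hM : 2 ∣ M) (hM0 : 0 < M) (c : Cert) (hδ : c.δA ≤ c.R) (j : ℕ) :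
    ((N * N * M : ℕ) : ℝ) * (c.G : ℝ) ^ 2 * (((c.R : ℝ) / (N * N * M : ℕ) -
        (c.δA : ℝ) / (N * N * M : ℕ) * (if j < c.jA then 1 else 0)) + Real.pi ^ 2 / (4 * N ^ 2) -
          1 + 2) + ((N * N * M : ℕ) : ℝ) / 2 ≤ arcM N M c j := by
  have hN' : (0 : ℝ) < N := Nat.cast_pos.2 hN
  have hM' : (0 : ℝ) < M := Nat.cast_pos.2 hM0
  simp only [arcM]
  rw [Nat.cast_add, half_scale hM]
  simp only [Nat.cast_mul, Nat.cast_add]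
  rw [cast_sub_cond (p := j < c.jA) _ (by simp [Nat.blt_eq]) hδ]
  have h1 : (M : ℝ) * (Real.pi ^ 2 / 4) ≤ ((M * 2467425 / 1000000 : ℕ) : ℝ) + 1 := by
    have h2 : M * 2467425 < (M * 2467425 / 1000000 + 1) * 1000000 :=
      Nat.lt_mul_of_div_lt (Nat.lt_succ_self _) (by norm_num)
    have h3 : (M : ℝ) * 2467425 < (((M * 2467425 / 1000000 : ℕ) : ℝ) + 1) * 1000000 := by
      exact_mod_cast h2
    have h4 : Real.pi ^ 2 / 4 ≤ 2467425 / 1000000 := by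
      have := Real.pi_lt_d4
      have := Real.pi_pos
      nlinarith
    nlinarith
  have e : ((N : ℝ) * N * M) * (c.G : ℝ) ^ 2 * (((c.R : ℝ) / (N * N * M) -
        (c.δA : ℝ) / (N * N * M) * (if j < c.jA then 1 else 0)) + Real.pi ^ 2 / (4 * N ^ 2) -
          1 + 2) = c.G * c.G * (N * N * M + (c.R - c.δA * (if j < c.jA then 1 else 0)) +
            M * (Real.pi ^ 2 / 4)) := by
    field_simp; ring
  rw [e]
  push_cast at *
  gcongr

/-- After multiplication by `S G²`, every truncated excess is at most its integer `nodeVal`, so the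
integer inequality for the trapezoidal sums gives the real one. -/
theorem sum_le_of_checkPoint (hN : 0 < N) (hM : 2 ∣ M) (hM0 : 0 < M)
    (hAX : ∀ j ≤ N, ((N * N * M : ℕ) : ℝ) * (Real.cos (j * (Real.pi / N)) + 1) ≤ AX j)
    (hAY : ∀ j ≤ N, ((N * N * M : ℕ) : ℝ) * Real.sin (j * (Real.pi / N)) ≤ AY j)
    (c : Cert) (hG : 0 < c.G) (hB : c.δB ≤ c.B) (hA : c.δA ≤ c.R) (C i k : ℕ)
    (h : checkPoint N M AX AY c (baseNodes N M c) (arcNodes N M AX AY c) C i k = true)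
    (U V : ℕ → ℝ)
    (hU : ∀ j, U j = max 0 (((c.B : ℝ) / (N * N * M : ℕ) -
        (c.δB : ℝ) / (N * N * M : ℕ) * (if N < j + c.jB then 1 else 0)) + 1 / N ^ 2 -
          nodeBase N j ^ 2 + 1 / (2 * (c.G : ℝ) ^ 2) + 2 * (nodeBase N j * (i / c.G) + 0 * (k / c.G)) -
        ((i / c.G) ^ 2 + (k / c.G) ^ 2)))
    (hV : ∀ j, V j = max 0 (((c.R : ℝ) / (N * N * M : ℕ) -
        (c.δA : ℝ) / (N * N * M : ℕ) * (if j < c.jA then 1 else 0)) + Real.pi ^ 2 / (4 * N ^ 2) -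
          1 + 1 / (2 * (c.G : ℝ) ^ 2) + 2 * (Real.cos (j * (Real.pi / N)) * (i / c.G) +
            Real.sin (j * (Real.pi / N)) * (k / c.G)) - ((i / c.G) ^ 2 + (k / c.G) ^ 2))) :
    ((N * N * M : ℕ) : ℝ) * (c.G : ℝ) ^ 2 *
      (∑ j ∈ Finset.range N, (U j + U (j + 1)) + ∑ j ∈ Finset.range N, (V j + V (j + 1))) ≤ C := by
  have hS0 : 0 < N * N * M := by positivity
  set q := N * N * M * (i * i + k * k) + 2 * c.G * (N * N * M) * i + 2 * (N * N * M) * c.G * c.G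
    with hq
  set u : ℕ → ℕ := fun j => nodeVal (2 * c.G * i) (2 * c.G * k) q (baseX N M j) 0 (baseM N M c j)
  set v : ℕ → ℕ := fun j => nodeVal (2 * c.G * i) (2 * c.G * k) q (AX j) (AY j) (arcM N M c j)
  have h1 : ∀ j ≤ N, ((N * N * M : ℕ) : ℝ) * (c.G : ℝ) ^ 2 * U j ≤ u j := by
    intro j hj
    rw [hU j]
    exact max_le_nodeVal rfl rfl hG hS0 (baseX_eq hN j).le (by simp)
      (baseM_eq hN hM hM0 c hB hj).le
  have h2 : ∀ j ≤ N, ((N * N * M : ℕ) : ℝ) * (c.G : ℝ) ^ 2 * V j ≤ v j := by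
    intro j hj
    rw [hV j]
    exact max_le_nodeVal rfl rfl hG hS0 (hAX j hj) (hAY j hj) (arcM_ge hN hM hM0 c hA j)
  have h3 : 2 * (∑ j ∈ Finset.range (N + 1), u j + ∑ j ∈ Finset.range (N + 1), v j) ≤
      C + (u 0 + u N + v 0 + v N) := by
    have := Nat.le_of_ble_eq_true h
    simp only [baseNodes, arcNodes, Nodes.eval_ofFn] at this
    exact this
  have h4 : (2 * (∑ j ∈ Finset.range (N + 1), (u j : ℝ) + ∑ j ∈ Finset.range (N + 1), (v j : ℝ)))
      ≤ C + (u 0 + u N + v 0 + v N) := by exact_mod_cast h3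
  have h5 : ∀ (F : ℕ → ℝ) (f : ℕ → ℕ), (∀ j ≤ N, ((N * N * M : ℕ) : ℝ) * (c.G : ℝ) ^ 2 * F j ≤ f j) →
      ((N * N * M : ℕ) : ℝ) * (c.G : ℝ) ^ 2 * ∑ j ∈ Finset.range N, (F j + F (j + 1)) ≤
        2 * ∑ j ∈ Finset.range (N + 1), (f j : ℝ) - f 0 - f N := by
    intro F f hF
    rw [← sum_add_succ N fun j => (f j : ℝ), Finset.mul_sum]
    refine Finset.sum_le_sum fun j hj => ?_
    have := Finset.mem_range.1 hj
    rw [mul_add]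
    exact add_le_add (hF j (by omega)) (hF (j + 1) (by omega))
  have h6 := h5 U u h1
  have h7 := h5 V v h2
  rw [mul_add]
  linarith

/-- Bilinear interpolation of the trapezoidal bound over a cell of the grid. -/
theorem sum_max_le_of_corners {ι : Type*} (J : Finset ι) (X Y K : ι → ℝ) {G s t x y C : ℝ}
    (hG : 0 < G) (hs0 : 0 ≤ s) (hs1 : s ≤ 1) (ht0 : 0 ≤ t) (ht1 : t ≤ 1)
    (h : ∀ x' ∈ ({x, x + 1} : Set ℝ), ∀ y' ∈ ({y, y + 1} : Set ℝ),
      ∑ j ∈ J, max 0 (K j + 1 / (2 * G ^ 2) + 2 * (X j * (x' / G) + Y j * (y' / G)) -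
        ((x' / G) ^ 2 + (y' / G) ^ 2)) ≤ C) :
    ∑ j ∈ J, max 0 (K j + 2 * (X j * ((x + s) / G) + Y j * ((y + t) / G)) -
      (((x + s) / G) ^ 2 + ((y + t) / G) ^ 2)) ≤ C := by
  refine (Finset.sum_le_sum fun j _ => max_le_bilinear hG hs0 hs1 ht0 ht1).trans ?_
  simp only [Finset.sum_add_distrib, ← Finset.mul_sum]
  have h1 := h x (by simp) y (by simp)
  have h2 := h x (by simp) (y + 1) (by simp)
  have h3 := h (x + 1) (by simp) y (by simp)
  have h4 := h (x + 1) (by simp) (y + 1) (by simp)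
  have hs : 0 ≤ 1 - s := by linarith
  have ht : 0 ≤ 1 - t := by linarith
  calc _ ≤ (1 - s) * ((1 - t) * C + t * C) + s * ((1 - t) * C + t * C) := by gcongr
    _ = C := by ring

/-- Lowered constant prices on the base. -/
noncomputable def Cert.gB (N M : ℕ) (c : Cert) (t : ℝ) : ℝ :=
  (c.B : ℝ) / (N * N * M : ℕ) - (c.δB : ℝ) / (N * N * M : ℕ) * rampBase N c.jB t

/-- Lowered constant prices on the arc. -/
noncomputable def Cert.gA (N M : ℕ) (c : Cert) (t : ℝ) : ℝ :=
  (c.R : ℝ) / (N * N * M : ℕ) - (c.δA : ℝ) / (N * N * M : ℕ) * rampArc N c.jA t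

theorem Cert.continuous_gB (c : Cert) : Continuous (c.gB N M) := by
  have := continuous_rampBase N c.jB
  unfold Cert.gB; fun_prop

theorem Cert.continuous_gA (c : Cert) : Continuous (c.gA N M) := by
  have := continuous_rampArc N c.jA
  unfold Cert.gA; fun_prop

/-- A rectangle contains a point. -/
def Rect.Mem (r : Rect) (G : ℕ) (a : ℝ × ℝ) : Prop :=
  (r.x : ℝ) ≤ G * a.1 ∧ G * a.1 ≤ r.x + r.w ∧ (r.y : ℝ) ≤ G * a.2 ∧ G * a.2 ≤ r.y + r.h

theorem exists_cell {x : ℕ} {w : ℕ} {z : ℝ} (hw : 0 < w) (h0 : (x : ℝ) ≤ z) (h1 : z ≤ x + w) :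
    ∃ d < w, ∃ s : ℝ, 0 ≤ s ∧ s ≤ 1 ∧ z = ((x + d : ℕ) : ℝ) + s := by
  -- The right end point lies in no half-open cell; it is assigned to the last cell with `s = 1`.
  rcases eq_or_lt_of_le h1 with h | h
  · refine ⟨w - 1, by omega, 1, zero_le_one, le_rfl, ?_⟩
    push_cast [Nat.cast_sub (show 1 ≤ w from hw)]
    linarith
  · refine ⟨⌊z - x⌋₊, ?_, z - x - ⌊z - x⌋₊, ?_, ?_, by push_cast; ring⟩
    · exact (Nat.floor_lt (by linarith)).2 (by linarith)
    · exact sub_nonneg.2 (Nat.floor_le (by linarith))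
    · linarith [Nat.lt_floor_add_one (z - x)]

/-- Soundness of the grid certificates. -/
theorem gain_le_of_checkRect (hN : 0 < N) (hM : 2 ∣ M) (hM0 : 0 < M)
    (hAX : ∀ j ≤ N, ((N * N * M : ℕ) : ℝ) * (Real.cos (j * (Real.pi / N)) + 1) ≤ AX j)
    (hAY : ∀ j ≤ N, ((N * N * M : ℕ) : ℝ) * Real.sin (j * (Real.pi / N)) ≤ AY j)
    (c : Cert) (hG : 0 < c.G) (hB : c.δB ≤ c.B) (hA : c.δA ≤ c.R) (C : ℕ) (r : Rect)
    (hw : 0 < r.w) (hh : 0 < r.h) (h : checkRect N M AX AY c C r = true) {a : ℝ × ℝ}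
    (ha : a.1 ^ 2 + a.2 ^ 2 ≤ 1) (hr : r.Mem c.G a) :
    gain (c.gB N M) (c.gA N M) a ≤ C / (4 * N * (N * N * M : ℕ) * (c.G : ℝ) ^ 2) := by
  have hN' : (0 : ℝ) < N := Nat.cast_pos.2 hN
  have hG' : (0 : ℝ) < c.G := Nat.cast_pos.2 hG
  have hS' : (0 : ℝ) < (N * N * M : ℕ) := Nat.cast_pos.2 (by positivity)
  obtain ⟨d, hd, s, hs0, hs1, hs⟩ := exists_cell hw hr.1 hr.2.1
  obtain ⟨e, he, t, ht0, ht1, ht⟩ := exists_cell hh hr.2.2.1 hr.2.2.2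
  have ea1 : a.1 = (((r.x + d : ℕ) : ℝ) + s) / c.G := by rw [← hs]; field_simp
  have ea2 : a.2 = (((r.y + e : ℕ) : ℝ) + t) / c.G := by rw [← ht]; field_simp
  have hc : ∀ d' ≤ r.w, ∀ e' ≤ r.h, checkPoint N M AX AY c (baseNodes N M c)
      (arcNodes N M AX AY c) C (r.x + d') (r.y + e') = true := by
    intro d' hd' e' he'
    exact (allBelow_iff _ _).1 ((allBelow_iff _ _).1 h d' (by omega)) e' (by omega)
  have h1 := gain_le_trapezoid N hN (c.continuous_gB (N := N) (M := M)) c.continuous_gA ha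
    (fun j => (c.B : ℝ) / (N * N * M : ℕ) -
        (c.δB : ℝ) / (N * N * M : ℕ) * (if N < j + c.jB then 1 else 0))
    (fun j => (c.R : ℝ) / (N * N * M : ℕ) -
        (c.δA : ℝ) / (N * N * M : ℕ) * (if j < c.jA then 1 else 0))
    (fun j _ s hs => by rw [Cert.gB, rampBase_interp hN _ _ hs]; apply le_of_eq; ring)
    (fun j _ s hs => by rw [Cert.gA, rampArc_interp hN _ _ hs]; apply le_of_eq; ring)
  refine h1.trans ?_
  set D : ℝ := C / ((N * N * M : ℕ) * (c.G : ℝ) ^ 2) with hD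
  have hfin : (C : ℝ) / (4 * N * (N * N * M : ℕ) * (c.G : ℝ) ^ 2) = 1 / (4 * N) * D := by
    rw [hD]; field_simp
  rw [hfin]
  refine mul_le_mul_of_nonneg_left ?_ (by positivity)
  -- Left and right ends of the pieces, on the base and on the arc, are gathered in one index type:
  -- the interpolation must be applied to the whole sum, because only the whole sum is bounded at
  -- the grid points.
  have h2 := sum_max_le_of_corners (ι := (ℕ ⊕ ℕ) ⊕ (ℕ ⊕ ℕ))
    (((Finset.range N).disjSum (Finset.range N)).disjSum
      ((Finset.range N).disjSum (Finset.range N)))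
    (Sum.elim (Sum.elim (fun j => nodeBase N j) (fun j => nodeBase N (j + 1)))
      (Sum.elim (fun j => Real.cos (j * (Real.pi / N)))
        (fun j => Real.cos ((j + 1 : ℕ) * (Real.pi / N)))))
    (Sum.elim (Sum.elim (fun _ => 0) (fun _ => 0))
      (Sum.elim (fun j => Real.sin (j * (Real.pi / N)))
        (fun j => Real.sin ((j + 1 : ℕ) * (Real.pi / N)))))
    (Sum.elim
      (Sum.elim
        (fun j => ((c.B : ℝ) / (N * N * M : ℕ) -
          (c.δB : ℝ) / (N * N * M : ℕ) * (if N < j + c.jB then 1 else 0)) + 1 / N ^ 2 -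
            nodeBase N j ^ 2)
        (fun j => ((c.B : ℝ) / (N * N * M : ℕ) -
          (c.δB : ℝ) / (N * N * M : ℕ) * (if N < (j + 1) + c.jB then 1 else 0)) + 1 / N ^ 2 -
            nodeBase N (j + 1) ^ 2))
      (Sum.elim
        (fun j => ((c.R : ℝ) / (N * N * M : ℕ) -
          (c.δA : ℝ) / (N * N * M : ℕ) * (if j < c.jA then 1 else 0)) +
            Real.pi ^ 2 / (4 * N ^ 2) - 1)
        (fun j => ((c.R : ℝ) / (N * N * M : ℕ) -
          (c.δA : ℝ) / (N * N * M : ℕ) * (if (j + 1) < c.jA then 1 else 0)) +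
            Real.pi ^ 2 / (4 * N ^ 2) - 1)))
    (x := (r.x + d : ℕ)) (y := (r.y + e : ℕ)) (C := D) hG' hs0 hs1 ht0 ht1 ?_
  · simp only [Finset.sum_disjSum, Sum.elim_inl, Sum.elim_inr] at h2
    rw [← ea1, ← ea2] at h2
    simp only [Finset.sum_add_distrib]
    refine le_trans (le_of_eq ?_) h2
    congr 1
    · congr 1 <;> refine Finset.sum_congr rfl fun j _ => ?_ <;> congr 1 <;>
        simp only [sqBase, nodeBase] <;> push_cast <;> ring
    · congr 1 <;> refine Finset.sum_congr rfl fun j _ => ?_ <;> congr 1 <;> rw [sqArc]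
      · linear_combination -Real.sin_sq_add_cos_sq (j * (Real.pi / N))
      · linear_combination -Real.sin_sq_add_cos_sq (((j + 1 : ℕ) : ℝ) * (Real.pi / N))
  · have key : ∀ d' ≤ r.w, ∀ e' ≤ r.h, ∀ x' y' : ℝ, x' = (r.x + d' : ℕ) → y' = (r.y + e' : ℕ) → _ :=
      fun d' hd' e' he' x' y' hx' hy' => by
        have := sum_le_of_checkPoint hN hM hM0 hAX hAY c hG hB hA C _ _ (hc d' hd' e' he') _ _
          (fun _ => rfl) (fun _ => rfl)
        rw [← hx', ← hy', mul_comm] at this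
        exact (le_div_iff₀ (by positivity)).2 this
    intro x' hx' y' hy'
    simp only [Finset.sum_disjSum, Sum.elim_inl, Sum.elim_inr]
    simp only [Finset.sum_add_distrib] at key
    simp only [Set.mem_insert_iff, Set.mem_singleton_iff] at hx' hy'
    rcases hx' with hx' | hx' <;> rcases hy' with hy' | hy'
    · exact key d hd.le e he.le x' y' hx' hy'
    · exact key d hd.le (e + 1) he x' y' hx' (by rw [hy']; push_cast; ring)
    · exact key (d + 1) hd e he.le x' y' (by rw [hx']; push_cast; ring) hy'
    · exact key (d + 1) hd (e + 1) he x' y' (by rw [hx']; push_cast; ring)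
        (by rw [hy']; push_cast; ring)

end

end HalfDisc

/-! ### Interval arithmetic with sine and cosine -/

namespace HalfDisc

/-- Horner form of the Taylor polynomials of cosine (`k = 0`) and sine (`k = 1`). -/
noncomputable def trigPoly : ℕ → ℕ → ℝ → ℝ
  | 0, _, _ => 0
  | n + 1, k, y => 1 - y / ((k + 1) * (k + 2) : ℕ) * trigPoly n (k + 2) y

/-- For `k = 0` and `k = 1` the coefficients are `±1 / (2 m)!` and `±1 / (2 m + 1)!`, so that
`trigPoly n 0 (x²)` and `x * trigPoly n 1 (x²)` are the Taylor polynomials with `n` terms. -/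
theorem trigPoly_eq (n k : ℕ) (y : ℝ) :
    trigPoly n k y = ∑ m ∈ Finset.range n, (-1) ^ m * y ^ m * (k.factorial / (k + 2 * m).factorial) := by
  induction n generalizing k with
  | zero => simp [trigPoly]
  | succ n ih =>
    rw [trigPoly, ih, Finset.sum_range_succ', Finset.mul_sum, sub_eq_neg_add, ← Finset.sum_neg_distrib]
    have h0 : ∀ m : ℕ, (m.factorial : ℝ) ≠ 0 := fun m => by exact_mod_cast m.factorial_ne_zero
    congr 1
    · refine Finset.sum_congr rfl fun m _ => ?_
      have e : k + 2 * (m + 1) = k + 2 + 2 * m := by ring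
      rw [e]
      have e2 : ((k + 2).factorial : ℝ) = ((k + 1) * (k + 2) : ℕ) * k.factorial := by
        rw [Nat.factorial_succ, Nat.factorial_succ]; push_cast; ring
      have h1 : (((k + 1) * (k + 2) : ℕ) : ℝ) ≠ 0 := by positivity
      rw [e2]
      field_simp
      ring
    · simp [h0]

theorem hasDerivAt_sin_trigPoly (n : ℕ) (x : ℝ) :
    HasDerivAt (fun x => x * trigPoly n 1 (x ^ 2)) (trigPoly n 0 (x ^ 2)) x := by
  have h0 : ∀ m : ℕ, (m.factorial : ℝ) ≠ 0 := fun m => by exact_mod_cast m.factorial_ne_zero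
  have e : (fun x : ℝ => x * trigPoly n 1 (x ^ 2)) = fun x =>
      ∑ m ∈ Finset.range n, (-1) ^ m * x ^ (2 * m + 1) * (1 / ((1 + 2 * m).factorial : ℝ)) := by
    funext x
    rw [trigPoly_eq, Finset.mul_sum]
    refine Finset.sum_congr rfl fun m _ => ?_
    simp; ring
  rw [e, trigPoly_eq]
  refine HasDerivAt.fun_sum fun m _ => ?_
  have h1 := ((hasDerivAt_pow (2 * m + 1) x).const_mul ((-1) ^ m)).mul_const
    (1 / ((1 + 2 * m).factorial : ℝ))
  refine h1.congr_deriv ?_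
  rw [add_comm 1 (2 * m), Nat.factorial_succ]
  have h2 := h0 (2 * m)
  have h3 : (((2 * m + 1 : ℕ)) : ℝ) ≠ 0 := by positivity
  simp only [Nat.add_sub_cancel, Nat.cast_mul, Nat.factorial_zero, Nat.cast_one, zero_add]
  field_simp
  ring

theorem hasDerivAt_cos_trigPoly (n : ℕ) (x : ℝ) :
    HasDerivAt (fun x => trigPoly (n + 1) 0 (x ^ 2)) (-(x * trigPoly n 1 (x ^ 2))) x := by
  have h0 : ∀ m : ℕ, (m.factorial : ℝ) ≠ 0 := fun m => by exact_mod_cast m.factorial_ne_zero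
  have e : (fun x : ℝ => trigPoly (n + 1) 0 (x ^ 2)) = fun x =>
      ∑ m ∈ Finset.range n, (-1) ^ (m + 1) * x ^ (2 * m + 1 + 1) *
        (1 / ((2 * m + 1 + 1).factorial : ℝ)) + 1 := by
    funext x
    rw [trigPoly_eq, Finset.sum_range_succ']
    congr 1
    · refine Finset.sum_congr rfl fun m _ => ?_
      simp; ring_nf
    · simp
  rw [e, trigPoly_eq, Finset.mul_sum, ← Finset.sum_neg_distrib]
  refine HasDerivAt.add_const _ (HasDerivAt.fun_sum fun m _ => ?_)
  have h1 := ((hasDerivAt_pow (2 * m + 1 + 1) x).const_mul ((-1) ^ (m + 1))).mul_const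
    (1 / ((2 * m + 1 + 1).factorial : ℝ))
  refine h1.congr_deriv ?_
  rw [add_comm 1 (2 * m), Nat.factorial_succ (2 * m + 1)]
  have h2 := h0 (2 * m + 1)
  have h3 : (((2 * m + 1 + 1 : ℕ)) : ℝ) ≠ 0 := by positivity
  simp only [Nat.add_sub_cancel, Nat.cast_mul, Nat.factorial_one, Nat.cast_one]
  field_simp
  ring

theorem nonneg_of_deriv_nonneg {f f' : ℝ → ℝ} (h : ∀ x, HasDerivAt f (f' x) x) (h0 : f 0 = 0)
    (hf : ∀ x, 0 ≤ x → 0 ≤ f' x) {x : ℝ} (hx : 0 ≤ x) : 0 ≤ f x := by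
  have hm : MonotoneOn f (Set.Ici 0) := by
    refine monotoneOn_of_deriv_nonneg (convex_Ici 0)
      (fun t _ => (h t).continuousAt.continuousWithinAt)
      (fun t _ => (h t).differentiableAt.differentiableWithinAt) fun t ht => ?_
    rw [interior_Ici] at ht
    rw [(h t).deriv]
    exact hf t (le_of_lt ht)
  rw [← h0]
  exact hm Set.self_mem_Ici hx hx

/-- The Taylor polynomials of sine and cosine alternately bound these functions. -/
theorem alternating_taylor (n : ℕ) :
    (∀ x : ℝ, 0 ≤ x → 0 ≤ (-1) ^ (n + 1) * (Real.sin x - x * trigPoly (n + 1) 1 (x ^ 2))) ∧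
      ∀ x : ℝ, 0 ≤ x → 0 ≤ (-1) ^ (n + 1) * (Real.cos x - trigPoly (n + 1) 0 (x ^ 2)) := by
  -- Integration from `0` turns a sine bound with `n` terms into a cosine bound with `n + 1` terms
  -- of the opposite sign; a further integration leads back to sine.
  have step : ∀ n : ℕ, (∀ x : ℝ, 0 ≤ x → 0 ≤ (-1) ^ n * (Real.sin x - x * trigPoly n 1 (x ^ 2))) →
      ∀ x : ℝ, 0 ≤ x → 0 ≤ (-1) ^ (n + 1) * (Real.cos x - trigPoly (n + 1) 0 (x ^ 2)) := by
    intro n hn x hx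
    refine nonneg_of_deriv_nonneg (f := fun x => (-1) ^ (n + 1) *
      (Real.cos x - trigPoly (n + 1) 0 (x ^ 2))) (fun t => ((Real.hasDerivAt_cos t).sub
        (hasDerivAt_cos_trigPoly n t)).const_mul _) ?_ (fun t ht => ?_) hx
    · simp [trigPoly]
    · have := hn t ht
      rw [pow_succ]
      linarith
  induction n with
  | zero =>
    refine ⟨fun x hx => ?_, fun x _ => ?_⟩
    · have := Real.sin_le hx
      simp [trigPoly]; linarith
    · simp [trigPoly]; exact Real.cos_le_one x
  | succ n ih =>
    refine ⟨fun x hx => ?_, step _ ih.1⟩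
    refine nonneg_of_deriv_nonneg (f := fun x => (-1) ^ (n + 1 + 1) *
      (Real.sin x - x * trigPoly (n + 1 + 1) 1 (x ^ 2))) (fun t => ((Real.hasDerivAt_sin t).sub
        (hasDerivAt_sin_trigPoly (n + 1 + 1) t)).const_mul _) (by simp) (fun t ht => ?_) hx
    exact step (n + 1) ih.1 t ht

/-- The common denominator of the end points of the intervals below. -/
def prec : ℕ := 10 ^ 20

theorem prec_pos : (0 : ℝ) < prec := by norm_num [prec]

/-- A closed interval with end points `lo / prec` and `hi / prec`. -/
structure Itv where
  lo : ℤ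
  hi : ℤ

/-- Division with rounding up. -/
def divUp (a b : ℤ) : ℤ := -((-a) / b)

theorem cast_ediv_mul_le (a : ℤ) {b : ℤ} (hb : 0 < b) : ((a / b : ℤ) : ℝ) * b ≤ a := by
  exact_mod_cast Int.ediv_mul_le a hb.ne'

theorem le_cast_divUp_mul (a : ℤ) {b : ℤ} (hb : 0 < b) : (a : ℝ) ≤ (divUp a b : ℤ) * b := by
  have := Int.ediv_mul_le (-a) hb.ne'
  have h : a ≤ divUp a b * b := by unfold divUp; linarith
  exact_mod_cast h

namespace Itv

/-- The number `x` lies in the interval `I`. -/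
def Mem (x : ℝ) (I : Itv) : Prop := (I.lo : ℝ) ≤ x * prec ∧ x * prec ≤ I.hi

def add (I J : Itv) : Itv := ⟨I.lo + J.lo, I.hi + J.hi⟩

def neg (I : Itv) : Itv := ⟨-I.hi, -I.lo⟩

def mul (I J : Itv) : Itv :=
  ⟨min (min (I.lo * J.lo) (I.lo * J.hi)) (min (I.hi * J.lo) (I.hi * J.hi)) / prec,
    divUp (max (max (I.lo * J.lo) (I.lo * J.hi)) (max (I.hi * J.lo) (I.hi * J.hi))) prec⟩

/-- `max 0 (max lo (-hi))` is the distance of the interval from `0`, so squaring loses nothing when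
the interval contains `0`. -/
def sq (I : Itv) : Itv :=
  ⟨max 0 (max I.lo (-I.hi)) ^ 2 / prec, divUp (max (I.lo ^ 2) (I.hi ^ 2)) prec⟩

def const (a : ℤ) (b : ℕ) : Itv := ⟨a * prec / b, divUp (a * prec) b⟩

def inv (I : Itv) : Itv := ⟨prec * prec / I.hi, divUp (prec * prec) I.lo⟩

def point (a : ℤ) : Itv := ⟨a, a⟩

def trig : ℕ → ℕ → Itv → Itv
  | 0, _, _ => ⟨0, 0⟩
  | n + 1, k, y => add ⟨prec, prec⟩
      (neg (mul (mul y (const 1 ((k + 1) * (k + 2)))) (trig n (k + 2) y)))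

/-- An even number of Taylor terms bounds from below, an odd number from above. Cosine decreases on
`[0, 3]`, so the end points change places; sine increases on `[0, 3/2]`, so they do not. -/
def cos (I : Itv) : Itv := ⟨(trig 12 0 (sq (point I.hi))).lo, (trig 13 0 (sq (point I.lo))).hi⟩

def sin (I : Itv) : Itv := ⟨(mul (point I.lo) (trig 12 1 (sq (point I.lo)))).lo,
  (mul (point I.hi) (trig 13 1 (sq (point I.hi)))).hi⟩

variable {x y : ℝ} {I J : Itv}

theorem Mem.add (hx : Mem x I) (hy : Mem y J) : Mem (x + y) (I.add J) := by
  simp only [Mem, Itv.add, Int.cast_add, add_mul] at *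
  exact ⟨add_le_add hx.1 hy.1, add_le_add hx.2 hy.2⟩

theorem Mem.neg (hx : Mem x I) : Mem (-x) I.neg := by
  simp only [Mem, Itv.neg, Int.cast_neg] at *
  constructor <;> linarith [hx.1, hx.2]

/-- The product is affine in each variable separately, so its extremes on a rectangle are attained
at the corners. -/
theorem mul_mem_corners {a b c d u v : ℝ} (hu : a ≤ u) (hu' : u ≤ b) (hv : c ≤ v) (hv' : v ≤ d) :
    min (min (a * c) (a * d)) (min (b * c) (b * d)) ≤ u * v ∧
      u * v ≤ max (max (a * c) (a * d)) (max (b * c) (b * d)) := by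
  have h1 : ∀ w : ℝ, c ≤ w → w ≤ d → min (u * c) (u * d) ≤ u * w ∧ u * w ≤ max (u * c) (u * d) := by
    intro w h h'
    rcases le_total 0 u with h0 | h0
    · exact ⟨min_le_of_left_le (mul_le_mul_of_nonneg_left h h0),
        le_max_of_le_right (mul_le_mul_of_nonneg_left h' h0)⟩
    · exact ⟨min_le_of_right_le (mul_le_mul_of_nonpos_left h' h0),
        le_max_of_le_left (mul_le_mul_of_nonpos_left h h0)⟩
  have h2 : ∀ w : ℝ, min (a * w) (b * w) ≤ u * w ∧ u * w ≤ max (a * w) (b * w) := by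
    intro w
    rcases le_total 0 w with h0 | h0
    · exact ⟨min_le_of_left_le (mul_le_mul_of_nonneg_right hu h0),
        le_max_of_le_right (mul_le_mul_of_nonneg_right hu' h0)⟩
    · exact ⟨min_le_of_right_le (mul_le_mul_of_nonpos_right hu' h0),
        le_max_of_le_left (mul_le_mul_of_nonpos_right hu h0)⟩
  have e : min (min (a * c) (a * d)) (min (b * c) (b * d)) =
      min (min (a * c) (b * c)) (min (a * d) (b * d)) := by
    rw [min_min_min_comm]
  have e' : max (max (a * c) (a * d)) (max (b * c) (b * d)) =
      max (max (a * c) (b * c)) (max (a * d) (b * d)) := by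
    rw [max_max_max_comm]
  rw [e, e']
  exact ⟨(min_le_min (h2 c).1 (h2 d).1).trans (h1 v hv hv').1,
    (h1 v hv hv').2.trans (max_le_max (h2 c).2 (h2 d).2)⟩

theorem prec_pos' : (0 : ℤ) < (prec : ℤ) := by norm_num [prec]

theorem mem_of_scaled {a b : ℤ} (h1 : (a : ℝ) ≤ x * prec * prec) (h2 : x * prec * prec ≤ b) :
    Mem x ⟨a / prec, divUp b prec⟩ := by
  have h3 := cast_ediv_mul_le a prec_pos'
  have h4 := le_cast_divUp_mul b prec_pos'
  rw [Int.cast_natCast] at h3 h4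
  exact ⟨le_of_mul_le_mul_right (h3.trans h1) prec_pos,
    le_of_mul_le_mul_right (h2.trans h4) prec_pos⟩

theorem Mem.mul (hx : Mem x I) (hy : Mem y J) : Mem (x * y) (I.mul J) := by
  have h := mul_mem_corners hx.1 hx.2 hy.1 hy.2
  have e : x * y * prec * prec = x * prec * (y * prec) := by ring
  refine mem_of_scaled ?_ ?_
  · rw [e]; push_cast; exact h.1
  · rw [e]; push_cast; exact h.2

theorem Mem.sq (hx : Mem x I) : Mem (x ^ 2) I.sq := by
  have e : x ^ 2 * prec * prec = (x * prec) ^ 2 := by ring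
  refine mem_of_scaled ?_ ?_
  · rw [e]
    push_cast
    rw [← sq_abs (x * prec)]
    refine pow_le_pow_left₀ (le_max_left _ _) (max_le (abs_nonneg _) (max_le ?_ ?_)) 2
    · exact hx.1.trans (le_abs_self _)
    · exact (neg_le_neg hx.2).trans (neg_le_abs _)
  · rw [e]
    push_cast
    rcases le_total 0 (x * prec) with h | h
    · exact le_max_of_le_right (pow_le_pow_left₀ h hx.2 2)
    · refine le_max_of_le_left ?_
      nlinarith [hx.1]

theorem mem_const (a : ℤ) {b : ℕ} (hb : 0 < b) : Mem (a / b) (const a b) := by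
  have hb' : (0 : ℤ) < b := by exact_mod_cast hb
  have hb2 : (0 : ℝ) < b := by exact_mod_cast hb
  have h3 := cast_ediv_mul_le (a * prec) hb'
  have h4 := le_cast_divUp_mul (a * prec) hb'
  push_cast at h3 h4
  have e : (a : ℝ) / b * prec = a * prec / b := by ring
  constructor
  · rw [e]; exact (le_div_iff₀ hb2).2 h3
  · rw [e]; exact (div_le_iff₀ hb2).2 h4

theorem Mem.inv (hx : Mem x I) (h0 : 0 < I.lo) : Mem x⁻¹ I.inv := by
  have hlo : (0 : ℝ) < I.lo := by exact_mod_cast h0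
  have hP := prec_pos
  have hxp : 0 < x * prec := hlo.trans_le hx.1
  have hx0 : 0 < x := pos_of_mul_pos_left hxp hP.le
  have hhi : (0 : ℝ) < I.hi := hxp.trans_le hx.2
  have h3 := cast_ediv_mul_le (prec * prec) (b := I.hi) (by exact_mod_cast hhi)
  have h4 := le_cast_divUp_mul (prec * prec) h0
  push_cast at h3 h4
  have e : x⁻¹ * prec = prec * prec / (x * prec) := by field_simp
  constructor
  · rw [e]
    exact ((le_div_iff₀ hhi).2 h3).trans (div_le_div_of_nonneg_left (by positivity) hxp hx.2)
  · rw [e]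
    exact (div_le_div_of_nonneg_left (by positivity) hlo hx.1).trans ((div_le_iff₀ hlo).2 h4)

theorem mem_point (a : ℤ) : Mem (a / prec) (point a) := by
  have := prec_pos
  simp only [Mem, point]
  rw [div_mul_cancel₀ _ this.ne']
  exact ⟨le_rfl, le_rfl⟩

theorem Mem.trig (hy : Mem y J) (n k : ℕ) : Mem (trigPoly n k y) (Itv.trig n k J) := by
  induction n generalizing k with
  | zero => simp [trigPoly, Itv.trig, Mem]
  | succ n ih =>
    have h1 : Mem 1 ⟨prec, prec⟩ := by simp [Mem]
    have h2 := mem_const 1 (b := (k + 1) * (k + 2)) (by positivity)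
    have h3 := h1.add ((hy.mul h2).mul (ih (k + 2))).neg
    have e : trigPoly (n + 1) k y =
        1 + -(y * (((1 : ℤ) : ℝ) / ((k + 1) * (k + 2) : ℕ)) * trigPoly n (k + 2) y) := by
      rw [trigPoly]; push_cast; ring
    rw [e]
    exact h3

theorem lo_le_of_le {z : ℝ} (hz : Mem z J) (h : z ≤ x) : (J.lo : ℝ) ≤ x * prec :=
  hz.1.trans (mul_le_mul_of_nonneg_right h prec_pos.le)

theorem le_hi_of_le {z : ℝ} (hz : Mem z J) (h : x ≤ z) : x * prec ≤ J.hi :=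
  (mul_le_mul_of_nonneg_right h prec_pos.le).trans hz.2

theorem Mem.cos (hx : Mem x I) (h0 : 0 ≤ I.lo) (h1 : I.hi ≤ 3 * prec) : Mem (Real.cos x) I.cos := by
  have hP := prec_pos
  have hl : (0 : ℝ) ≤ I.lo / prec := div_nonneg (by exact_mod_cast h0) hP.le
  have hlx : (I.lo : ℝ) / prec ≤ x := (div_le_iff₀ hP).2 hx.1
  have hxh : x ≤ (I.hi : ℝ) / prec := (le_div_iff₀ hP).2 hx.2
  have hh : (I.hi : ℝ) / prec ≤ 3 := (div_le_iff₀ hP).2 (by exact_mod_cast h1)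
  have hpi := Real.pi_gt_three
  have hm := (mem_point I.hi).sq.trig 12 0
  have hm' := (mem_point I.lo).sq.trig 13 0
  refine ⟨?_, ?_⟩
  · refine (fun h => lo_le_of_le hm h : _ → _) ?_
    have := (alternating_taylor 11).2 (I.hi / prec) (hl.trans (hlx.trans hxh))
    norm_num at this
    exact this.trans (Real.cos_le_cos_of_nonneg_of_le_pi (hl.trans hlx) (by linarith) hxh)
  · refine (fun h => le_hi_of_le hm' h : _ → _) ?_
    have := (alternating_taylor 12).2 (I.lo / prec) hl
    norm_num at this
    exact (Real.cos_le_cos_of_nonneg_of_le_pi hl (by linarith) hlx).trans this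

theorem Mem.sin (hx : Mem x I) (h0 : 0 ≤ I.lo) (h1 : 2 * I.hi ≤ 3 * prec) :
    Mem (Real.sin x) I.sin := by
  have hP := prec_pos
  have hl : (0 : ℝ) ≤ I.lo / prec := div_nonneg (by exact_mod_cast h0) hP.le
  have hlx : (I.lo : ℝ) / prec ≤ x := (div_le_iff₀ hP).2 hx.1
  have hxh : x ≤ (I.hi : ℝ) / prec := (le_div_iff₀ hP).2 hx.2
  have hh : (I.hi : ℝ) / prec ≤ 3 / 2 := by
    rw [div_le_iff₀ hP]
    have : (2 * I.hi : ℝ) ≤ 3 * prec := by exact_mod_cast h1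
    linarith
  have hpi := Real.pi_gt_three
  have hm := (mem_point I.lo).mul ((mem_point I.lo).sq.trig 12 1)
  have hm' := (mem_point I.hi).mul ((mem_point I.hi).sq.trig 13 1)
  refine ⟨?_, ?_⟩
  · refine (fun h => lo_le_of_le hm h : _ → _) ?_
    have := (alternating_taylor 11).1 (I.lo / prec) hl
    norm_num at this
    exact this.trans (Real.sin_le_sin_of_le_of_le_pi_div_two (by linarith) (by linarith) hlx)
  · refine (fun h => le_hi_of_le hm' h : _ → _) ?_
    have := (alternating_taylor 12).1 (I.hi / prec) (hl.trans (hlx.trans hxh))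
    norm_num at this
    exact (Real.sin_le_sin_of_le_of_le_pi_div_two (by linarith) (by linarith) hxh).trans this

end Itv

/-- Real expressions in variables `0, 1, …`. -/
inductive Ex : Type
  | const (a : ℤ) (b : ℕ) : Ex
  | var (i : ℕ) : Ex
  | add (e f : Ex) : Ex
  | neg (e : Ex) : Ex
  | mul (e f : Ex) : Ex
  | sq (e : Ex) : Ex
  | inv (e : Ex) : Ex
  | cos (e : Ex) : Ex
  | sin (e : Ex) : Ex

namespace Ex

noncomputable def eval (ρ : ℕ → ℝ) : Ex → ℝ
  | const a b => a / b
  | var i => ρ i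
  | add e f => e.eval ρ + f.eval ρ
  | neg e => -e.eval ρ
  | mul e f => e.eval ρ * f.eval ρ
  | sq e => e.eval ρ ^ 2
  | inv e => (e.eval ρ)⁻¹
  | cos e => Real.cos (e.eval ρ)
  | sin e => Real.sin (e.eval ρ)

/-- Interval enclosure of the value of an expression. -/
def itv (ι : ℕ → Itv) : Ex → Itv
  | const a b => Itv.const a b
  | var i => ι i
  | add e f => (e.itv ι).add (f.itv ι)
  | neg e => (e.itv ι).neg
  | mul e f => (e.itv ι).mul (f.itv ι)
  | sq e => (e.itv ι).sq
  | inv e => (e.itv ι).inv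
  | cos e => (e.itv ι).cos
  | sin e => (e.itv ι).sin

/-- The side conditions for the enclosure. -/
def ok (ι : ℕ → Itv) : Ex → Bool
  | const _ b => Nat.blt 0 b
  | var _ => true
  | add e f => e.ok ι && f.ok ι
  | neg e => e.ok ι
  | mul e f => e.ok ι && f.ok ι
  | sq e => e.ok ι
  | inv e => e.ok ι && decide (0 < (e.itv ι).lo)
  | cos e => e.ok ι && (decide (0 ≤ (e.itv ι).lo) && decide ((e.itv ι).hi ≤ 3 * prec))
  | sin e => e.ok ι && (decide (0 ≤ (e.itv ι).lo) && decide (2 * (e.itv ι).hi ≤ 3 * prec))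

theorem mem_itv {ρ : ℕ → ℝ} {ι : ℕ → Itv} (h : ∀ i, (ι i).Mem (ρ i)) (e : Ex)
    (hok : e.ok ι = true) : (e.itv ι).Mem (e.eval ρ) := by
  induction e with
  | const a b => exact Itv.mem_const a (by simpa [ok, Nat.blt_eq] using hok)
  | var i => exact h i
  | add e f he hf =>
    simp only [ok, Bool.and_eq_true] at hok
    exact (he hok.1).add (hf hok.2)
  | neg e he => exact (he hok).neg
  | mul e f he hf =>
    simp only [ok, Bool.and_eq_true] at hok
    exact (he hok.1).mul (hf hok.2)
  | sq e he => exact (he hok).sq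
  | inv e he =>
    simp only [ok, Bool.and_eq_true, decide_eq_true_eq] at hok
    exact (he hok.1).inv hok.2
  | cos e he =>
    simp only [ok, Bool.and_eq_true, decide_eq_true_eq] at hok
    exact (he hok.1).cos hok.2.1 hok.2.2
  | sin e he =>
    simp only [ok, Bool.and_eq_true, decide_eq_true_eq] at hok
    exact (he hok.1).sin hok.2.1 hok.2.2

/-- The value of the expression is verified to be positive. -/
def pos (ι : ℕ → Itv) (e : Ex) : Bool := e.ok ι && decide (0 < (e.itv ι).lo)

theorem eval_pos {ρ : ℕ → ℝ} {ι : ℕ → Itv} (h : ∀ i, (ι i).Mem (ρ i)) {e : Ex}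
    (hp : e.pos ι = true) : 0 < e.eval ρ := by
  simp only [pos, Bool.and_eq_true, decide_eq_true_eq] at hp
  have h1 := (mem_itv h e hp.1).1
  have h2 : (0 : ℝ) < (e.itv ι).lo := by exact_mod_cast hp.2
  exact pos_of_mul_pos_left (h2.trans_le h1) prec_pos.le

end Ex

end HalfDisc

/-! ### The table of the nodes on the arc -/

namespace HalfDisc

/-- Error propagation for repeated rotation by an approximately known angle. -/
theorem rotation_error {S φ cw sw : ℝ} (hS : 0 < S) (hcw : |cw - S * Real.cos φ| ≤ 1)
    (hsw : |sw - S * Real.sin φ| ≤ 1) (hw : cw ^ 2 + sw ^ 2 ≤ S ^ 2) (c s : ℕ → ℝ) (h0 : c 0 = S)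
    (h0' : s 0 = 0) (n : ℕ)
    (hstep : ∀ j < n, |S * c (j + 1) - (c j * cw - s j * sw)| ≤ 2 * S ∧
      |S * s (j + 1) - (c j * sw + s j * cw)| ≤ 2 * S) :
    ∀ j ≤ n, ‖(⟨c j - S * Real.cos (j * φ), s j - S * Real.sin (j * φ)⟩ : ℂ)‖ ≤ 6 * j := by
  have hnorm : ∀ z : ℂ, ‖z‖ ≤ |z.re| + |z.im| := Complex.norm_le_abs_re_add_abs_im
  intro j
  induction j with
  | zero => intro _; simp [h0, h0']; rfl
  | succ j ih =>
    intro hj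
    have h1 := ih (by omega)
    obtain ⟨h2, h3⟩ := hstep j (by omega)
    -- The new error is the sum of the rounding of this step (norm at most `4 S`), the old error
    -- turned by a vector of norm at most `S`, and the error of the rotation vector (at most `2 S`).
    -- Hence it grows by at most `6` per step.
    have e : (S : ℂ) * (⟨c (j + 1) - S * Real.cos ((j + 1 : ℕ) * φ),
        s (j + 1) - S * Real.sin ((j + 1 : ℕ) * φ)⟩ : ℂ) =
        (⟨S * c (j + 1) - (c j * cw - s j * sw), S * s (j + 1) - (c j * sw + s j * cw)⟩ : ℂ) +
        (⟨c j - S * Real.cos (j * φ), s j - S * Real.sin (j * φ)⟩ : ℂ) * (⟨cw, sw⟩ : ℂ) +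
        S * ((⟨Real.cos (j * φ), Real.sin (j * φ)⟩ : ℂ) *
          (⟨cw - S * Real.cos φ, sw - S * Real.sin φ⟩ : ℂ)) := by
      have : ((j + 1 : ℕ) : ℝ) * φ = j * φ + φ := by push_cast; ring
      rw [this, Real.cos_add, Real.sin_add]
      apply Complex.ext <;> simp <;> ring
    have n1 : ‖(⟨cw, sw⟩ : ℂ)‖ ≤ S := by
      rw [Complex.norm_eq_sqrt_sq_add_sq]
      exact Real.sqrt_le_iff.2 ⟨hS.le, hw⟩
    have n2 : ‖(⟨Real.cos (j * φ), Real.sin (j * φ)⟩ : ℂ)‖ = 1 := by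
      rw [Complex.norm_eq_sqrt_sq_add_sq]
      simp
    have n3 := hnorm (⟨cw - S * Real.cos φ, sw - S * Real.sin φ⟩ : ℂ)
    have n4 := hnorm (⟨S * c (j + 1) - (c j * cw - s j * sw),
      S * s (j + 1) - (c j * sw + s j * cw)⟩ : ℂ)
    simp only at n3 n4
    have h5 := congrArg norm e
    rw [norm_mul, Complex.norm_real, Real.norm_of_nonneg hS.le] at h5
    have h6 := norm_add₃_le (a :=
      (⟨S * c (j + 1) - (c j * cw - s j * sw), S * s (j + 1) - (c j * sw + s j * cw)⟩ : ℂ))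
      (b := (⟨c j - S * Real.cos (j * φ), s j - S * Real.sin (j * φ)⟩ : ℂ) * (⟨cw, sw⟩ : ℂ))
      (c := S * ((⟨Real.cos (j * φ), Real.sin (j * φ)⟩ : ℂ) *
          (⟨cw - S * Real.cos φ, sw - S * Real.sin φ⟩ : ℂ)))
    rw [← h5, norm_mul, norm_mul, norm_mul, n2, Complex.norm_real, Real.norm_of_nonneg hS.le] at h6
    have h7 := mul_le_mul h1 n1 (norm_nonneg _) (by positivity)
    refine le_of_mul_le_mul_left (h6.trans ?_) hS
    push_cast
    nlinarith

/-- The number of pieces in the trapezoidal rules. -/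
def pieces : ℕ := 96

def unit : ℕ := 65536

/-- `pieces ^ 2 * unit * (1 + cos (j π / pieces))`, rounded, as digits in base `2 ^ 32`. -/
def cosDigits : ℕ :=
  0x4ef320013bb6f002c60a8004ed81b007b185500b1153600f0bff0013a0710018cd67e01e91788024eb0e402bd86b703357a9f03b66bba044036b004d2b5bb056dc0b106112d1206bcce12077074a3082bef8808ef0b5909b9929d0a8b4dcd0b64036b0c43780e0d296e760e15a7980f07e2b30fffdd5f10fd53a21200000013079b901413de1015247df5163930821751a9df186d9d28198cbc861aaeb9431bd343e21cfa0c2f1e22c15c1f4d12142078ac8e21a53ea922d2760024000000252d8a00265ac1572787537228b2edec29dd3ea42b05f3d12c2cbc1e2d5146bd2e73437a2f9262d830ae562131c6cf7e32db820b33ec21f034f86470360000003702ac5e380022a138f81d4d39ea58683ad6918a3bbc87f23c9bfc953d74b2333e466d633f10f4a73fd41078408f8b5d414331ee41eed2ee42923f4f432d4a4543bfc9504449944644ca85614542794945b14f1c4616e8784673298246c5f8f0470f4010474eeaca4784e7ab47b127e547d39f5847ec449147fb10ce48000000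

/-- `pieces ^ 2 * unit * sin (j π / pieces)`, rounded, as digits in base `2 ^ 32`. -/
def sinDigits : ℕ :=
  0x12d8a00025ac1570387537204b2edec05dd3ea40705f3d1082cbc1e095146bd0a73437a0b9262d80cae56210dc6cf7e0edb820b0fec21f010f86470120000001302ac5e140022a114f81d4d15ea586816d6918a17bc87f2189bfc951974b2331a466d631b10f4a71bd410781c8f8b5d1d4331ee1deed2ee1e923f4f1f2d4a451fbfc9502049944620ca85612142794921b14f1c2216e8782273298222c5f8f0230f4010234eeaca2384e7ab23b127e523d39f5823ec449123fb10ce2400000023fb10ce23ec449123d39f5823b127e52384e7ab234eeaca230f401022c5f8f0227329822216e87821b14f1c2142794920ca8561204994461fbfc9501f2d4a451e923f4f1deed2ee1d4331ee1c8f8b5d1bd410781b10f4a71a466d631974b233189bfc9517bc87f216d6918a15ea586814f81d4d140022a11302ac5e1200000010f864700fec21f00edb820b0dc6cf7e0cae56210b9262d80a73437a095146bd082cbc1e0705f3d105dd3ea404b2edec03875372025ac157012d8a0000000000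

def cosEntry (j : ℕ) : ℕ := cosDigits / 2 ^ (32 * j) % 2 ^ 32

def sinEntry (j : ℕ) : ℕ := sinDigits / 2 ^ (32 * j) % 2 ^ 32

/-- Upper bounds of the scaled coordinates of the nodes on the arc. -/
def arcX (j : ℕ) : ℕ := cosEntry j + 600

/-- The margin `600` exceeds the accumulated rotation error `6 * 96 = 576`. -/
def arcY (j : ℕ) : ℕ := sinEntry j + 600

theorem pi_mem : Itv.Mem Real.pi ⟨314159265358979323846, 314159265358979323847⟩ := by
  have h1 := Real.pi_gt_d20
  have h2 := Real.pi_lt_d20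
  simp only [Itv.Mem, prec]
  constructor <;> push_cast <;> linarith

/-- Consecutive table entries differ by one rotation through `π / 96` up to rounding: `603656397`
and `19761664` are the integer parts of `603979776 * cos (π / 96)` and `603979776 * sin (π / 96)`.
Only this angle then needs an analytic enclosure. -/
theorem digits_step : ∀ j < 96,
    |(603979776 : ℤ) * (cosEntry (j + 1) - 603979776) -
      ((cosEntry j - 603979776) * 603656397 - sinEntry j * 19761664)| ≤ 2 * 603979776 ∧
    |(603979776 : ℤ) * sinEntry (j + 1) -
      ((cosEntry j - 603979776) * 19761664 + sinEntry j * 603656397)| ≤ 2 * 603979776 := by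
  decide +kernel

theorem digits_error (j : ℕ) (hj : j ≤ 96) :
    |((cosEntry j : ℝ) - 603979776) - 603979776 * Real.cos (j * (Real.pi / 96))| ≤ 576 ∧
      |(sinEntry j : ℝ) - 603979776 * Real.sin (j * (Real.pi / 96))| ≤ 576 := by
  have hm : ∀ i, ((fun _ => ⟨314159265358979323846, 314159265358979323847⟩ : ℕ → Itv) i).Mem
      ((fun _ => Real.pi : ℕ → ℝ) i) := fun _ => pi_mem
  have a1 := Ex.eval_pos hm (e := .add (.mul (.const 603979776 1) (.cos (.mul (.var 0) (.const 1 96))))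
    (.const (-603656397) 1)) (by decide +kernel)
  have a2 := Ex.eval_pos hm (e := .add (.const (603656397 + 1) 1) (.neg (.mul (.const 603979776 1)
    (.cos (.mul (.var 0) (.const 1 96)))))) (by decide +kernel)
  have a3 := Ex.eval_pos hm (e := .add (.mul (.const 603979776 1) (.sin (.mul (.var 0) (.const 1 96))))
    (.const (-19761664) 1)) (by decide +kernel)
  have a4 := Ex.eval_pos hm (e := .add (.const (19761664 + 1) 1) (.neg (.mul (.const 603979776 1)
    (.sin (.mul (.var 0) (.const 1 96)))))) (by decide +kernel)
  have e : Real.pi * (1 / 96) = Real.pi / 96 := by ring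
  simp only [Ex.eval] at a1 a2 a3 a4
  push_cast at a1 a2 a3 a4
  rw [e] at a1 a2 a3 a4
  have h := rotation_error (S := 603979776) (φ := Real.pi / 96) (cw := 603656397) (sw := 19761664)
    (by norm_num) (abs_le.2 ⟨by linarith, by linarith⟩) (abs_le.2 ⟨by linarith, by linarith⟩)
    (by norm_num) (fun j => (cosEntry j : ℝ) - 603979776) (fun j => sinEntry j)
    (by have : cosEntry 0 = 2 * 603979776 := by decide +kernel
        simp only [this]; norm_num)
    (by have : sinEntry 0 = 0 := by decide +kernel
        simp only [this]; norm_num) 96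
    (fun j hj => by
      have := digits_step j hj
      constructor
      · exact_mod_cast this.1
      · exact_mod_cast this.2) j hj
  have h6 : (6 : ℝ) * j ≤ 576 := by
    have : (j : ℝ) ≤ 96 := by exact_mod_cast hj
    linarith
  exact ⟨(Complex.abs_re_le_norm _).trans (h.trans h6), (Complex.abs_im_le_norm _).trans (h.trans h6)⟩

theorem cos_le_arcX (j : ℕ) (hj : j ≤ pieces) : ((pieces * pieces * unit : ℕ) : ℝ) *
    (Real.cos (j * (Real.pi / (pieces : ℕ))) + 1) ≤ arcX j := by
  have := (abs_le.1 (digits_error j hj).1).1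
  simp only [pieces, unit, arcX]
  push_cast
  linarith

theorem sin_le_arcY (j : ℕ) (hj : j ≤ pieces) : ((pieces * pieces * unit : ℕ) : ℝ) *
    Real.sin (j * (Real.pi / (pieces : ℕ))) ≤ arcY j := by
  have := (abs_le.1 (digits_error j hj).2).1
  simp only [pieces, unit, arcY]
  push_cast
  linarith

/-- The common denominator of prices in the certificates. -/
def scale : ℕ := 603979776

/-- The gain is at most `C / (4 pieces scale G ^ 2)` on the rectangle. -/
noncomputable def Cert.bounds (c : Cert) (C : ℕ) (r : Rect) : Bool :=
  Nat.ble c.δB c.B && (Nat.ble c.δA c.R && (Nat.blt 0 c.G && (Nat.blt 0 r.w && (Nat.blt 0 r.h &&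
    checkRect pieces unit arcX arcY c C r))))

theorem Cert.gain_le (c : Cert) (C : ℕ) (r : Rect) (h : c.bounds C r = true) {a : ℝ × ℝ}
    (ha : a.1 ^ 2 + a.2 ^ 2 ≤ 1) (hr : r.Mem c.G a) :
    gain (c.gB pieces unit) (c.gA pieces unit) a ≤ C / (384 * scale * (c.G : ℝ) ^ 2) := by
  simp only [Cert.bounds, Bool.and_eq_true, Nat.ble_eq, Nat.blt_eq] at h
  obtain ⟨h1, h2, h3, h4, h5, h6⟩ := h
  have := gain_le_of_checkRect (by norm_num [pieces]) (by norm_num [unit]) (by norm_num [unit])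
    cos_le_arcX sin_le_arcY c h3 h1 h2 C r h4 h5 h6 ha hr
  refine this.trans (le_of_eq ?_)
  have e : (4 * (pieces : ℝ) * ((pieces * pieces * unit : ℕ) : ℝ)) = 384 * scale := by
    norm_num [pieces, unit, scale]
  rw [e]

end HalfDisc

/-! ### Zones of the half disc and bounds that depend on the number of points in each -/

namespace HalfDisc

/-- Each node is counted twice except the two ends, so `j` nodes that include an end contribute at
most `2 j - 1`. For `j = 0` truncated subtraction gives the correct value `0`. -/
theorem sum_indicator_le {N : ℕ} (p : ℕ → Prop) [DecidablePred p] (j : ℕ)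
    (hc : ((Finset.range (N + 1)).filter p).card ≤ j) (hend : 0 < j → p 0 ∨ p N) :
    ∑ i ∈ Finset.range N, ((if p i then (1 : ℝ) else 0) + (if p (i + 1) then 1 else 0)) ≤
      (2 * j - 1 : ℕ) := by
  rw [sum_add_succ N fun i => if p i then (1 : ℝ) else 0]
  rw [Finset.sum_boole]
  have h1 : (((Finset.range (N + 1)).filter p).card : ℝ) ≤ j := by exact_mod_cast hc
  rcases Nat.eq_zero_or_pos j with rfl | hj
  · have h2 : (0 : ℝ) ≤ if p 0 then 1 else 0 := by split_ifs <;> norm_num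
    have h3 : (0 : ℝ) ≤ if p N then 1 else 0 := by split_ifs <;> norm_num
    rw [Nat.cast_zero] at h1
    refine le_trans ?_ (Nat.cast_nonneg _)
    linarith
  · have h2 : (1 : ℝ) ≤ (if p 0 then 1 else 0) + if p N then 1 else 0 := by
      rcases hend hj with h | h
      · rw [if_pos h]; split_ifs <;> norm_num
      · rw [if_pos h]; split_ifs <;> norm_num
    have h3 : ((2 * j - 1 : ℕ) : ℝ) = 2 * j - 1 := by
      rw [Nat.cast_sub (by omega)]; push_cast; ring
    rw [h3]
    linarith

theorem integral_rampBase_le {N : ℕ} (hN : 0 < N) (j : ℕ) (hj : j ≤ N) :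
    1 / 4 * ∫ t in (-1 : ℝ)..1, rampBase N j t ≤ (2 * j - 1 : ℕ) / (4 * N) := by
  have hN' : (0 : ℝ) < N := Nat.cast_pos.2 hN
  have h := integral_le_trapezoid (a := -1) (Δ := 2 / N) (by positivity) N
    (continuous_rampBase N j) (fun i => if N < i + j then 1 else 0)
    (fun i _ s hs => (rampBase_interp hN j i hs).le)
  have h2 := sum_indicator_le (N := N) (fun i => N < i + j) j (by
    calc _ ≤ (Finset.Ico (N + 1 - j) (N + 1)).card := Finset.card_le_card fun i hi => by
          simp only [Finset.mem_filter, Finset.mem_range, Finset.mem_Ico] at hi ⊢; omega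
      _ ≤ j := by rw [Nat.card_Ico]; omega) (fun h => Or.inr (by omega))
  have e1 : (-1 : ℝ) + N * (2 / N) = 1 := by field_simp; norm_num
  rw [e1] at h
  have h3 := h.trans (mul_le_mul_of_nonneg_left h2 (by positivity))
  calc _ ≤ _ := mul_le_mul_of_nonneg_left h3 (by norm_num)
    _ = _ := by field_simp

theorem integral_rampArc_le {N : ℕ} (hN : 0 < N) (j : ℕ) :
    1 / (2 * Real.pi) * ∫ t in (0 : ℝ)..Real.pi, rampArc N j t ≤ (2 * j - 1 : ℕ) / (4 * N) := by
  have hN' : (0 : ℝ) < N := Nat.cast_pos.2 hN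
  have hpi := Real.pi_pos
  have h := integral_le_trapezoid (a := 0) (Δ := Real.pi / N) (by positivity) N
    (continuous_rampArc N j) (fun i => if i < j then 1 else 0)
    (fun i _ s hs => (rampArc_interp hN j i hs).le)
  have h2 := sum_indicator_le (N := N) (fun i => i < j) j (by
    calc _ ≤ (Finset.range j).card := Finset.card_le_card fun i hi => by
          simp only [Finset.mem_filter, Finset.mem_range] at hi ⊢; exact hi.2
      _ ≤ j := by rw [Finset.card_range]) (fun h => Or.inl h)
  have e1 : (0 : ℝ) + N * (Real.pi / N) = Real.pi := by field_simp; norm_num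
  rw [e1] at h
  have h3 := h.trans (mul_le_mul_of_nonneg_left h2 (by positivity))
  calc _ ≤ _ := mul_le_mul_of_nonneg_left h3 (by positivity)
    _ = _ := by field_simp; ring

/-- The parts of the half disc: points near the top, near the middle of the base, and near the two
corners. -/
inductive Zone : Type
  | top | base | right | left
  deriving DecidableEq

instance : Fintype Zone :=
  ⟨{Zone.top, Zone.base, Zone.right, Zone.left}, fun z => by cases z <;> simp⟩

theorem sum_zone (f : Zone → ℝ) :
    ∑ z, f z = f .top + f .base + f .right + f .left := by
  change ∑ z ∈ ({Zone.top, Zone.base, Zone.right, Zone.left} : Finset Zone), f z = _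
  rw [Finset.sum_insert (by simp), Finset.sum_insert (by simp), Finset.sum_insert (by simp),
    Finset.sum_singleton]
  ring

/-- Parameters of the decomposition of the half disc into zones. -/
structure Zones where
  X : ℝ
  Y : ℝ
  T : ℝ

open Classical in
/-- The zone of a point. -/
noncomputable def Zones.of (Z : Zones) (p : ℝ × ℝ) : Zone :=
  if Z.T ≤ p.2 then .top else if |p.1| ≤ Z.X ∧ p.2 ≤ Z.Y then .base
    else if 0 ≤ p.1 then .right else .left

/-- The number of points in a zone. -/
noncomputable def Zones.count (Z : Zones) {n : ℕ} (P : Fin n → ℝ × ℝ) (z : Zone) : ℕ :=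
  (Finset.univ.filter fun i => Z.of (P i) = z).card

theorem Zones.sum_count (Z : Zones) {n : ℕ} (P : Fin n → ℝ × ℝ) :
    Z.count P .top + Z.count P .base + Z.count P .right + Z.count P .left = n := by
  have h := Finset.card_eq_sum_card_fiberwise (f := fun i => Z.of (P i)) (s := Finset.univ)
    (t := Finset.univ) (by simp)
  simp only [Finset.card_univ, Fintype.card_fin] at h
  have h2 := sum_zone fun z => (Z.count P z : ℝ)
  rw [← Nat.cast_sum] at h2
  have h3 : n = ∑ z, Z.count P z := h
  rw [← h3] at h2
  exact_mod_cast h2.symm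

theorem Zones.sum_of (Z : Zones) {n : ℕ} (P : Fin n → ℝ × ℝ) (v : Zone → ℝ) :
    ∑ i, v (Z.of (P i)) = Z.count P .top * v .top + Z.count P .base * v .base +
      Z.count P .right * v .right + Z.count P .left * v .left := by
  rw [← Finset.sum_fiberwise (s := Finset.univ) (g := fun i => Z.of (P i)), ← sum_zone fun z =>
    Z.count P z * v z]
  refine Finset.sum_congr rfl fun z _ => ?_
  rw [Finset.sum_congr rfl fun i hi => by rw [(Finset.mem_filter.1 hi).2], Finset.sum_const,
    nsmul_eq_mul]
  rfl

theorem Zones.of_mirror (Z : Zones) {p : ℝ × ℝ} (h : Z.of p = .left) :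
    Z.of (-p.1, p.2) = .right := by
  unfold Zones.of at *
  split_ifs at h with h1 h2 h3
  rw [if_neg h1, abs_neg, if_neg h2, if_pos]
  simp only
  linarith

/-- The lower bound of the cost for prices that are constant except for lowerings `DB`, `DA` near
the corners; the lowering near a corner is used if there are points in its zone. -/
theorem cost_ge_of_zone_bounds {n : ℕ} [NeZero n] (Z : Zones) (P : Fin n → ℝ × ℝ)
    (hP : ∀ i, InHalfDisc (P i)) {B R γ α C A : ℝ} {DB DA : ℝ → ℝ} (hDB : Continuous DB)
    (hDA : Continuous DA) (hDB0 : ∀ t, 0 ≤ DB t) (hDA0 : ∀ t, 0 ≤ DA t)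
    (htop : ∀ p, InHalfDisc p → Z.of p = .top → gain (fun _ => B) (fun _ => R) p ≤ α)
    (hbase : ∀ p, InHalfDisc p → Z.of p = .base → gain (fun _ => B) (fun _ => R) p ≤ γ)
    (hright : ∀ p, InHalfDisc p → Z.of p = .right →
      gain (fun t => B - DB t) (fun t => R - DA t) p ≤ C)
    (hA : 1 / 4 * (∫ t in (-1 : ℝ)..1, DB t) +
      1 / (2 * Real.pi) * (∫ t in (0 : ℝ)..Real.pi, DA t) ≤ A) :
    1 / 2 * B + 1 / 2 * R - (Z.count P .top * α + Z.count P .base * γ +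
      (if Z.count P .right = 0 then 0 else A + Z.count P .right * C) +
      (if Z.count P .left = 0 then 0 else A + Z.count P .left * C)) ≤ cost P := by
  -- The switches `r` and `l` turn a lowering off when its zone is empty: it would cost `A` without
  -- reducing any gain.
  set r : ℝ := if Z.count P .right = 0 then 0 else 1 with hr
  set l : ℝ := if Z.count P .left = 0 then 0 else 1 with hl
  have hr0 : 0 ≤ r := by rw [hr]; split_ifs <;> norm_num
  have hl0 : 0 ≤ l := by rw [hl]; split_ifs <;> norm_num
  set gB : ℝ → ℝ := fun t => B - r * DB t - l * DB (-t) with hgB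
  set gA : ℝ → ℝ := fun t => R - r * DA t - l * DA (Real.pi - t) with hgA
  have hpi := Real.pi_pos
  have cB : Continuous gB := by rw [hgB]; fun_prop
  have cA : Continuous gA := by rw [hgA]; fun_prop
  have hone : ∀ i, Z.of (P i) = .right → r = 1 := by
    intro i hi
    rw [hr, if_neg]
    exact Finset.card_ne_zero_of_mem (Finset.mem_filter.2 ⟨Finset.mem_univ i, hi⟩)
  have hone' : ∀ i, Z.of (P i) = .left → l = 1 := by
    intro i hi
    rw [hl, if_neg]
    exact Finset.card_ne_zero_of_mem (Finset.mem_filter.2 ⟨Finset.mem_univ i, hi⟩)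
  -- Lowered prices only decrease gains, so the bounds for the top and base zones under constant
  -- prices remain valid.
  have hle : ∀ i, gain gB gA (P i) ≤ gain (fun _ => B) (fun _ => R) (P i) := by
    intro i
    refine gain_mono cB cA continuous_const continuous_const (fun t _ => ?_) fun t _ => ?_
    · have := mul_nonneg hr0 (hDB0 t)
      have := mul_nonneg hl0 (hDB0 (-t))
      simp only [hgB]; linarith
    · have := mul_nonneg hr0 (hDA0 t)
      have := mul_nonneg hl0 (hDA0 (Real.pi - t))
      simp only [hgA]; linarith
  set v : Zone → ℝ := fun z => match z with
    | Zone.top => α | Zone.base => γ | Zone.right => C | Zone.left => C with hv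
  have hsum : ∑ i, gain gB gA (P i) ≤ ∑ i, v (Z.of (P i)) := by
    refine Finset.sum_le_sum fun i _ => ?_
    rcases hz : Z.of (P i) with _ | _ | _ | _
    · exact (hle i).trans (htop _ (hP i) hz)
    · exact (hle i).trans (hbase _ (hP i) hz)
    · refine le_trans ?_ (hright _ (hP i) hz)
      refine gain_mono cB cA (by fun_prop) (by fun_prop) (fun t _ => ?_) fun t _ => ?_
      · have := mul_nonneg hl0 (hDB0 (-t))
        simp only [hgB, hone i hz]; linarith
      · have := mul_nonneg hl0 (hDA0 (Real.pi - t))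
        simp only [hgA, hone i hz]; linarith
    -- After reflection a point of the left zone sees the lowering of its own corner at the right;
    -- the lowering of the other corner may be dropped, since that only increases the gain.
    · have hd : InHalfDisc (-(P i).1, (P i).2) := by
        have := hP i
        simpa [InHalfDisc] using this
      refine le_trans ?_ (hright _ hd (Z.of_mirror hz))
      rw [gain_mirror]
      refine gain_mono cB cA (by fun_prop) (by fun_prop) (fun t _ => ?_) fun t _ => ?_
      · have := mul_nonneg hr0 (hDB0 t)
        simp only [hgB, hone' i hz]; linarith
      · have := mul_nonneg hr0 (hDA0 t)
        simp only [hgA, hone' i hz]; linarith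
  rw [Z.sum_of P] at hsum
  simp only [hv] at hsum
  have hd := dual_bound P gB gA cB cA
  have i1 : ∫ t in (-1 : ℝ)..1, gB t = 2 * B - (r + l) * ∫ t in (-1 : ℝ)..1, DB t := by
    have h1 : ∫ t in (-1 : ℝ)..1, DB (-t) = ∫ t in (-1 : ℝ)..1, DB t := by
      rw [intervalIntegral.integral_comp_neg, neg_neg]
    simp only [hgB]
    rw [intervalIntegral.integral_sub, intervalIntegral.integral_sub,
      intervalIntegral.integral_const, intervalIntegral.integral_const_mul,
      intervalIntegral.integral_const_mul, h1]
    · simp; ring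
    all_goals exact Continuous.intervalIntegrable (by fun_prop) _ _
  have i2 : ∫ t in (0 : ℝ)..Real.pi, gA t =
      Real.pi * R - (r + l) * ∫ t in (0 : ℝ)..Real.pi, DA t := by
    have h1 : ∫ t in (0 : ℝ)..Real.pi, DA (Real.pi - t) = ∫ t in (0 : ℝ)..Real.pi, DA t := by
      rw [intervalIntegral.integral_comp_sub_left]; simp
    simp only [hgA]
    rw [intervalIntegral.integral_sub, intervalIntegral.integral_sub,
      intervalIntegral.integral_const, intervalIntegral.integral_const_mul,
      intervalIntegral.integral_const_mul, h1]
    · simp; ring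
    all_goals exact Continuous.intervalIntegrable (by fun_prop) _ _
  rw [i1, i2] at hd
  have e2 : 1 / (2 * Real.pi) * (Real.pi * R - (r + l) * ∫ t in (0 : ℝ)..Real.pi, DA t) =
      1 / 2 * R - (r + l) * (1 / (2 * Real.pi) * ∫ t in (0 : ℝ)..Real.pi, DA t) := by
    field_simp
  rw [e2] at hd
  have h1 : (if Z.count P .right = 0 then 0 else A + Z.count P .right * C) =
      r * A + Z.count P .right * C := by
    rw [hr]; split_ifs with h <;> simp [h]
  have h2 : (if Z.count P .left = 0 then 0 else A + Z.count P .left * C) =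
      l * A + Z.count P .left * C := by
    rw [hl]; split_ifs with h <;> simp [h]
  rw [h1, h2]
  have h3 := mul_le_mul_of_nonneg_left hA (add_nonneg hr0 hl0)
  linarith

/-- Bounds, in multiples of `10⁻⁹`, that a system of prices provides: the value `L` of the prices,
the largest gains of points in the base, top and corner zones, and the cost `A` of the lowering
near a corner. -/
structure Bounds where
  L : ℤ
  base : ℤ
  top : ℤ
  A : ℤ
  C : ℤ

def Bounds.corner (b : Bounds) (j : ℕ) : ℤ := if j = 0 then 0 else b.A + j * b.C

def Bounds.lower (b : Bounds) (t s r l : ℕ) : ℤ :=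
  b.L - (t * b.top + s * b.base + b.corner r + b.corner l)

def Bounds.Valid (b : Bounds) (Z : Zones) (n : ℕ) [NeZero n] : Prop :=
  ∀ P : Fin n → ℝ × ℝ, (∀ i, InHalfDisc (P i)) →
    (b.lower (Z.count P .top) (Z.count P .base) (Z.count P .right) (Z.count P .left) : ℝ) ≤
      10 ^ 9 * cost P

/-- Every distribution of `n` points over the zones other than `(m, k, 1, 1)` is excluded by one of
the bounds. -/
noncomputable def excludes (bs : List Bounds) (n m k : ℕ) (V : ℤ) : Bool :=
  allBelow (fun t => allBelow (fun s => allBelow (fun r => !Nat.ble (t + s + r) n ||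
    (decide (t = m ∧ s = k ∧ r = 1 ∧ n - t - s - r = 1) ||
      bs.any fun b => decide (V < b.lower t s r (n - t - s - r)))) (n + 1)) (n + 1)) (n + 1)

theorem counts_eq_of_excludes {bs : List Bounds} {n m k : ℕ} [NeZero n] {V : ℤ} {Z : Zones}
    (h : excludes bs n m k V = true) (hb : ∀ b ∈ bs, b.Valid Z n) (P : Fin n → ℝ × ℝ)
    (hP : ∀ i, InHalfDisc (P i)) (hV : 10 ^ 9 * cost P ≤ V) :
    Z.count P .top = m ∧ Z.count P .base = k ∧ Z.count P .right = 1 ∧ Z.count P .left = 1 := by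
  have hs := Z.sum_count P
  have h1 := (allBelow_iff _ _).1 ((allBelow_iff _ _).1 ((allBelow_iff _ _).1 h
    (Z.count P .top) (by omega)) (Z.count P .base) (by omega)) (Z.count P .right) (by omega)
  -- The four counts add up to `n`, so the truncated difference used in `excludes` is the true
  -- number of points on the left.
  have e : n - Z.count P .top - Z.count P .base - Z.count P .right = Z.count P .left := by omega
  have e2 : Nat.ble (Z.count P .top + Z.count P .base + Z.count P .right) n = true :=
    Nat.ble_eq_true_of_le (by omega)
  rw [e, e2, Bool.not_true, Bool.false_or, Bool.or_eq_true] at h1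
  rcases h1 with h1 | h1
  · exact of_decide_eq_true h1
  · obtain ⟨b, hbm, hlt⟩ := List.any_eq_true.1 h1
    have h2 := (hb b hbm P hP).trans hV
    have h3 := of_decide_eq_true hlt
    have h4 : b.lower (Z.count P .top) (Z.count P .base) (Z.count P .right) (Z.count P .left) ≤ V := by
      exact_mod_cast h2
    omega

end HalfDisc

/-! ### From numerical price systems to valid bounds -/

namespace HalfDisc

/-- Zones with parameters that are multiples of `1 / 32`. -/
noncomputable def zones (x : ℕ) (y : ℤ) (t : ℕ) : Zones := ⟨x / 32, y / 32, t / 32⟩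

theorem mem_bounds_of_inHalfDisc {p : ℝ × ℝ} (h : InHalfDisc p) :
    -1 ≤ p.1 ∧ p.1 ≤ 1 ∧ 0 ≤ p.2 ∧ p.2 ≤ 1 := by
  obtain ⟨h1, h2⟩ := h
  refine ⟨?_, ?_, h1, ?_⟩ <;> nlinarith

/-- The arc price as an expression in the angle. -/
def arcPriceEx (e : Ex) : Ex :=
  .add (.add (.const 1 1) (.sq (.mul (.sin e) (.inv e))))
    (.neg (.mul (.mul (.const 2 1) (.mul (.sin e) (.inv e))) (.cos e)))

/-- The arc gain as an expression in the angle `e` and the value `p` of `π`. -/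
def arcGainEx (p e : Ex) : Ex :=
  .mul (.mul (.mul (.const 2 1) (.inv p)) (.mul (.sin e) (.inv e)))
    (.add (.sin e) (.neg (.mul e (.cos e))))

theorem eval_arcPriceEx (ρ : ℕ → ℝ) (e : Ex) : (arcPriceEx e).eval ρ = arcPrice (e.eval ρ) := by
  simp only [arcPriceEx, Ex.eval, arcPrice]; push_cast; ring

theorem eval_arcGainEx (ρ : ℕ → ℝ) (p e : Ex) (hp : p.eval ρ = Real.pi) :
    (arcGainEx p e).eval ρ = arcGain (e.eval ρ) := by
  simp only [arcGainEx, Ex.eval, arcGain, hp]; push_cast; ring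

/-- A system of prices: the certificate, the bound `C` of the gain on the grid, and the numbers
`β`, `ρ` in multiples of `10⁻⁹` and `h` in multiples of `10⁻⁴`. -/
structure Price where
  c : Cert
  C : ℕ
  β : ℕ
  ρ : ℕ
  h : ℕ

def piItv (_ : ℕ) : Itv := ⟨314159265358979323846, 314159265358979323847⟩

theorem pi_mem_piItv (i : ℕ) : (piItv i).Mem ((fun _ => Real.pi : ℕ → ℝ) i) := pi_mem

/-- The numerical conditions for the validity of bounds. -/
noncomputable def Price.check (p : Price) (x : ℕ) (y : ℤ) (t : ℕ) (b : Bounds) : Bool :=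
  (decide (2 * scale * b.L ≤ 10 ^ 9 * (p.c.B + p.c.R)) &&
  decide (10 ^ 9 * (p.c.δB * (2 * p.c.jB - 1 : ℕ) + p.c.δA * (2 * p.c.jA - 1 : ℕ)) ≤
    384 * scale * b.A) &&
  decide (10 ^ 9 * p.C ≤ 384 * scale * p.c.G ^ 2 * b.C) &&
  decide (p.c.jB ≤ 96) && decide (p.c.R ≤ scale) && decide (p.c.G = 32)) &&
  (decide (y < 0) || decide (10 ^ 18 * p.c.B ≤ scale * p.β ^ 2 ∧
    (p.β : ℤ) ^ 3 ≤ 3 * 10 ^ 18 * b.base ∧ 10 ^ 18 * p.c.R ≤ scale * p.ρ ^ 2 ∧ p.ρ ≤ 10 ^ 9 ∧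
    (x ^ 2 + y ^ 2) * 10 ^ 18 ≤ 1024 * (10 ^ 9 - (p.ρ : ℤ)) ^ 2)) &&
  (decide (32 < t) || (decide (1024 * p.c.B ≤ scale * t ^ 2 ∧ 0 < p.h ∧ p.h ≤ 15000) &&
    (Ex.pos piItv (.add (arcPriceEx (.const p.h 10000)) (.neg (.const p.c.R scale))) &&
    Ex.pos piItv (.add (.const b.top (10 ^ 9))
      (.neg (arcGainEx (.var 0) (.const p.h 10000))))))) &&
  (p.c.bounds p.C ⟨x, 32 - x, 0, min t 32⟩ &&
    (decide (x = 0) || p.c.bounds p.C ⟨0, x, y.toNat, t - y.toNat⟩))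

-- Points of the top zone are too high to save anything on the base at price `B`, and points of the
-- base zone stay inside the disc of radius `1 - ρ` and save nothing on the arc; the two closed gain
-- formulas apply to them. Only the right zone needs the grid certificate.
set_option maxHeartbeats 1000000 in
theorem Price.valid (p : Price) {x : ℕ} {y : ℤ} {t : ℕ} {b : Bounds} {n : ℕ} [NeZero n]
    (h : p.check x y t b = true) (hxt : x ≤ 32 ∧ y ≤ t ∧ (x = 0 ∨ t ≤ 32)) :
    b.Valid (zones x y t) n := by
  intro P hP
  simp only [Price.check, Bool.and_eq_true, Bool.or_eq_true, decide_eq_true_eq] at h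
  obtain ⟨⟨⟨⟨⟨⟨⟨⟨hL, hA⟩, hC⟩, hj⟩, hR1⟩, hG⟩, hy⟩, ht⟩, hb1, hb2⟩ := h
  have hS : (0 : ℝ) < scale := by norm_num [scale]
  have hScale : ((pieces * pieces * unit : ℕ) : ℝ) = scale := by norm_num [pieces, unit, scale]
  have hP0 : (pieces : ℝ) = 96 := by norm_num [pieces]
  have hL' : 2 * (scale : ℝ) * b.L ≤ 10 ^ 9 * (p.c.B + p.c.R) := by exact_mod_cast hL
  have hA' : 10 ^ 9 * (p.c.δB * ((2 * p.c.jB - 1 : ℕ) : ℝ) + p.c.δA * ((2 * p.c.jA - 1 : ℕ) : ℝ)) ≤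
    384 * scale * b.A := by exact_mod_cast hA
  have hC' : 10 ^ 9 * (p.C : ℝ) ≤ 384 * scale * p.c.G ^ 2 * b.C := by exact_mod_cast hC
  have hR1' : (p.c.R : ℝ) ≤ scale := by exact_mod_cast hR1
  have cRB := continuous_rampBase pieces p.c.jB
  have cRA := continuous_rampArc pieces p.c.jA
  have hnnB : 0 ≤ (p.c.δB : ℝ) / scale := by positivity
  have hnnA : 0 ≤ (p.c.δA : ℝ) / scale := by positivity
  have hmain := cost_ge_of_zone_bounds (zones x y t) P hP (B := p.c.B / scale) (R := p.c.R / scale)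
    (γ := b.base / 10 ^ 9) (α := b.top / 10 ^ 9) (C := b.C / 10 ^ 9) (A := b.A / 10 ^ 9)
    (DB := fun t => (p.c.δB : ℝ) / scale * rampBase pieces p.c.jB t)
    (DA := fun t => (p.c.δA : ℝ) / scale * rampArc pieces p.c.jA t)
    (by fun_prop) (by fun_prop) (fun t => mul_nonneg hnnB (clamp_nonneg _))
    (fun t => mul_nonneg hnnA (clamp_nonneg _)) ?_ ?_ ?_ ?_
  · have e : ∀ j : ℕ, (if j = 0 then (0 : ℝ) else b.A / 10 ^ 9 + j * (b.C / 10 ^ 9)) =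
        (b.corner j : ℤ) / 10 ^ 9 := by
      intro j
      unfold Bounds.corner
      split_ifs <;> push_cast <;> ring
    rw [e, e] at hmain
    simp only [Bounds.lower]
    push_cast
    have e2 : (b.L : ℝ) ≤ 10 ^ 9 * (1 / 2 * (p.c.B / scale) + 1 / 2 * (p.c.R / scale)) := by
      have : 10 ^ 9 * (1 / 2 * ((p.c.B : ℝ) / scale) + 1 / 2 * (p.c.R / scale)) =
        10 ^ 9 * (p.c.B + p.c.R) / (2 * scale) := by field_simp
      rw [this, le_div_iff₀ (by positivity)]
      linarith
    linarith
  · intro q hq hz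
    have hqb := mem_bounds_of_inHalfDisc hq
    have hT : (t : ℝ) / 32 ≤ q.2 := by
      unfold Zones.of at hz
      split_ifs at hz with h1
      exact h1
    -- Ordinates in the half disc are at most `1`, so `t > 32` makes the top zone empty. In the same
    -- way a negative `y` makes the base zone empty.
    rcases ht with ht | ⟨⟨ht1, ht2, ht3⟩, ht4, ht5⟩
    · have : (32 : ℝ) < t := by exact_mod_cast ht
      linarith
    · have ht1' : 1024 * (p.c.B : ℝ) ≤ scale * t ^ 2 := by exact_mod_cast ht1
      have ht2' : (0 : ℝ) < p.h := by exact_mod_cast ht2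
      have ht3' : (p.h : ℝ) ≤ 15000 := by exact_mod_cast ht3
      have h4 := Ex.eval_pos pi_mem_piItv ht4
      have h5 := Ex.eval_pos pi_mem_piItv ht5
      simp only [Ex.eval, eval_arcPriceEx, eval_arcGainEx (fun _ => Real.pi) (.var 0) _ rfl] at h4 h5
      push_cast at h4 h5
      have hpi := Real.pi_gt_three
      have := gain_le_of_far_from_base (gB := fun _ => (p.c.B : ℝ) / scale)
        (gA := fun _ => (p.c.R : ℝ) / scale) (p := q) (R := p.c.R / scale) (h := p.h / 10000)
        hq.1 continuous_const ((div_le_one hS).2 hR1') (by positivity)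
        (by linarith) (by linarith) (fun s _ => by
          rw [div_le_iff₀ hS]
          have : ((t : ℝ) / 32) ^ 2 ≤ q.2 ^ 2 := pow_le_pow_left₀ (by positivity) hT 2
          nlinarith) (fun s _ => le_rfl)
      linarith
  · intro q hq hz
    have hB : |q.1| ≤ x / 32 ∧ q.2 ≤ y / 32 := by
      unfold Zones.of at hz
      split_ifs at hz with h1 h2
      exact h2
    rcases hy with hy | ⟨hβ, hbase, h1, h2, h3⟩
    · have : (y : ℝ) < 0 := by exact_mod_cast hy
      linarith [hq.1]
    · have hβ' : 10 ^ 18 * (p.c.B : ℝ) ≤ scale * p.β ^ 2 := by exact_mod_cast hβ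
      have hbase' : (p.β : ℝ) ^ 3 ≤ 3 * 10 ^ 18 * b.base := by exact_mod_cast hbase
      have hβ2 : (p.c.B : ℝ) / scale ≤ (p.β / 10 ^ 9) ^ 2 := by
        rw [div_le_iff₀ hS, div_pow, div_mul_eq_mul_div, le_div_iff₀ (by positivity)]
        linarith
      have h1' : 10 ^ 18 * (p.c.R : ℝ) ≤ scale * p.ρ ^ 2 := by exact_mod_cast h1
      have h2' : (p.ρ : ℝ) ≤ 10 ^ 9 := by exact_mod_cast h2
      have h3' : ((x : ℝ) ^ 2 + y ^ 2) * 10 ^ 18 ≤ 1024 * (10 ^ 9 - p.ρ) ^ 2 := by exact_mod_cast h3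
      have h4 : q.1 ^ 2 + q.2 ^ 2 ≤ (1 - p.ρ / 10 ^ 9 : ℝ) ^ 2 := by
        have a1 : q.1 ^ 2 ≤ (x / 32 : ℝ) ^ 2 := by
          rw [← sq_abs]; exact pow_le_pow_left₀ (abs_nonneg _) hB.1 2
        have a2 : q.2 ^ 2 ≤ (y / 32 : ℝ) ^ 2 := pow_le_pow_left₀ hq.1 hB.2 2
        have : (1 - p.ρ / 10 ^ 9 : ℝ) ^ 2 = (10 ^ 9 - p.ρ) ^ 2 / 10 ^ 18 := by field_simp
        rw [this, le_div_iff₀ (by positivity)]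
        nlinarith
      have := gain_le_of_far_from_arc (gB := fun _ => (p.c.B : ℝ) / scale)
        (gA := fun _ => (p.c.R : ℝ) / scale) (p := q) (β := p.β / 10 ^ 9) (by positivity)
        continuous_const (fun t _ => hβ2) (fun s _ => by
          refine le_trans ?_ (le_sqArc_of_norm_le (by positivity)
            ((div_le_one (by norm_num)).2 h2') h4 s)
          rw [div_le_iff₀ hS, div_pow, div_mul_eq_mul_div, le_div_iff₀ (by positivity)]
          linarith)
      refine this.trans ?_
      rw [div_pow]
      linarith
  · intro q hq hz
    have hqb := mem_bounds_of_inHalfDisc hq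
    have hz' : q.2 < t / 32 ∧ ¬ (|q.1| ≤ x / 32 ∧ q.2 ≤ y / 32) ∧ 0 ≤ q.1 := by
      unfold Zones.of at hz
      split_ifs at hz with h1 h2 h3
      exact ⟨not_le.1 h1, h2, h3⟩
    obtain ⟨hz1, hz2, hz3⟩ := hz'
    rw [abs_of_nonneg hz3] at hz2
    have hgain : gain (p.c.gB pieces unit) (p.c.gA pieces unit) q ≤
        p.C / (384 * scale * (p.c.G : ℝ) ^ 2) := by
      -- The right zone is covered by two rectangles, one beyond the abscissa `x / 32` and one above
      -- the base zone.
      rcases le_or_gt ((x : ℝ) / 32) q.1 with h1 | h1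
      · refine p.c.gain_le p.C _ hb1 hq.2 ?_
        have hx32 : ((32 - x : ℕ) : ℝ) = 32 - x := by rw [Nat.cast_sub hxt.1]; norm_num
        simp only [Rect.Mem, hG, hx32]
        push_cast
        refine ⟨by linarith, by linarith, by linarith, ?_⟩
        rw [zero_add]
        exact le_min (by linarith) (by linarith)
      · have hx0 : x ≠ 0 := by
          rintro rfl
          simp at h1
          linarith
        have h2 : (y : ℝ) / 32 < q.2 := by
          by_contra h
          exact hz2 ⟨h1.le, not_lt.1 h⟩
        have ht32 : t ≤ 32 := hxt.2.2.resolve_left hx0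
        refine p.c.gain_le p.C _ (hb2.resolve_left hx0) hq.2 ?_
        have e1 : ((y.toNat : ℕ) : ℝ) = max (y : ℝ) 0 := by
          have := Int.toNat_eq_max y
          exact_mod_cast this
        have e2 : ((t - y.toNat : ℕ) : ℝ) = t - y.toNat := Nat.cast_sub (by omega)
        simp only [Rect.Mem, hG, e2, e1]
        push_cast
        refine ⟨by linarith, by linarith, max_le (by linarith) (by linarith), by linarith⟩
    have e : gain (fun t => (p.c.B : ℝ) / scale - (p.c.δB : ℝ) / scale * rampBase pieces p.c.jB t)
        (fun t => (p.c.R : ℝ) / scale - (p.c.δA : ℝ) / scale * rampArc pieces p.c.jA t) q =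
        gain (p.c.gB pieces unit) (p.c.gA pieces unit) q := by
      unfold Cert.gB Cert.gA
      rw [hScale]
    rw [e]
    refine hgain.trans ?_
    have hG0 : (0 : ℝ) < p.c.G := by rw [hG]; norm_num
    rw [div_le_div_iff₀ (by positivity) (by positivity)]
    linarith
  · have i1 := integral_rampBase_le (N := pieces) (by norm_num [pieces]) p.c.jB hj
    have i2 := integral_rampArc_le (N := pieces) (by norm_num [pieces]) p.c.jA
    rw [intervalIntegral.integral_const_mul, intervalIntegral.integral_const_mul]
    rw [hP0] at i1 i2
    have j1 := mul_le_mul_of_nonneg_left i1 hnnB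
    have j2 := mul_le_mul_of_nonneg_left i2 hnnA
    have e : (p.c.δB : ℝ) / scale * ((2 * p.c.jB - 1 : ℕ) / (4 * 96)) +
        (p.c.δA : ℝ) / scale * ((2 * p.c.jA - 1 : ℕ) / (4 * 96)) ≤ b.A / 10 ^ 9 := by
      rw [le_div_iff₀ (by positivity)]
      have : ((p.c.δB : ℝ) / scale * ((2 * p.c.jB - 1 : ℕ) / (4 * 96)) +
        (p.c.δA : ℝ) / scale * ((2 * p.c.jA - 1 : ℕ) / (4 * 96))) * 10 ^ 9 =
        10 ^ 9 * (p.c.δB * ((2 * p.c.jB - 1 : ℕ) : ℝ) + p.c.δA * ((2 * p.c.jA - 1 : ℕ) : ℝ)) /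
          (384 * scale) := by field_simp; ring
      rw [this, div_le_iff₀ (by positivity)]
      linarith
    linarith

theorem counts_eq_of_prices {n m k : ℕ} [NeZero n] {x : ℕ} {y : ℤ} {t : ℕ} {V : ℤ}
    (ps : List (Price × Bounds)) (h : (ps.all fun p => p.1.check x y t p.2) = true)
    (hxt : x ≤ 32 ∧ y ≤ t ∧ (x = 0 ∨ t ≤ 32))
    (hex : excludes (ps.map Prod.snd) n m k V = true) {P : Fin n → ℝ × ℝ}
    (hP : ∀ i, InHalfDisc (P i)) (hV : 10 ^ 9 * cost P ≤ V) :
    (zones x y t).count P .top = m ∧ (zones x y t).count P .base = k ∧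
      (zones x y t).count P .right = 1 ∧ (zones x y t).count P .left = 1 := by
  refine counts_eq_of_excludes hex (fun b hb => ?_) P hP hV
  obtain ⟨p, hp, rfl⟩ := List.mem_map.1 hb
  exact p.1.valid (List.all_eq_true.1 h p hp) hxt

end HalfDisc

/-! ### Price systems that exclude the wrong distributions -/

namespace HalfDisc

/-- No property of these numbers is used beyond the check. Each entry bounds the cost for every
distribution, and it suffices that every wrong distribution is beaten by one entry. The threshold in
`counts_two` and its analogues, in units of `10⁻⁹`, lies above the cost of the candidate. For two
points the base and top zones are empty. -/
def prices_two : List (Price × Bounds) := [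
  (⟨⟨32, 329578288, 510068641, 60639569, 209520584, 61, 49⟩, 29830412631445, 0, 0, 10371⟩,
    ⟨695095235, 0, 0, 119264844, 125604640⟩)]

theorem prices_two_check : (prices_two.all fun p => p.1.check 0 (-1) 64 p.2) = true := by
  decide +kernel

theorem counts_two {P : Fin 2 → ℝ × ℝ} (hP : ∀ i, InHalfDisc (P i))
    (hV : 10 ^ 9 * cost P ≤ (242369420 : ℤ)) :
    (zones 0 (-1) 64).count P .top = 0 ∧ (zones 0 (-1) 64).count P .base = 0 ∧
      (zones 0 (-1) 64).count P .right = 1 ∧ (zones 0 (-1) 64).count P .left = 1 :=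
  counts_eq_of_prices prices_two prices_two_check (by decide) (by decide +kernel) hP hV

def prices_three : List (Price × Bounds) := [
  (⟨⟨32, 260072749, 155881182, 0, 0, 0, 0⟩, 22418038165867, 0, 0, 5238⟩,
    ⟨344344254, 0, 28330128, 0, 94393921⟩),
  (⟨⟨32, 220195588, 308128768, 52002658, 100260642, 38, 30⟩, 15741268275770, 0, 0, 7622⟩,
    ⟨437369243, 0, 80283473, 42321615, 66280556⟩)]

theorem prices_three_check : (prices_three.all fun p => p.1.check 0 (-1) 21 p.2) = true := by
  decide +kernel

theorem counts_three {P : Fin 3 → ℝ × ℝ} (hP : ∀ i, InHalfDisc (P i))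
    (hV : 10 ^ 9 * cost P ≤ (147821100 : ℤ)) :
    (zones 0 (-1) 21).count P .top = 1 ∧ (zones 0 (-1) 21).count P .base = 0 ∧
      (zones 0 (-1) 21).count P .right = 1 ∧ (zones 0 (-1) 21).count P .left = 1 :=
  counts_eq_of_prices prices_three prices_three_check (by decide) (by decide +kernel) hP hV

def prices_four : List (Price × Bounds) := [
  (⟨⟨32, 150572454, 89865832, 0, 0, 0, 0⟩, 9891653295464, 499300000, 385732384, 3924⟩,
    ⟨199044980, 41491912, 12303847, 0, 41650029⟩),
  (⟨⟨32, 137595827, 240996171, 28809835, 118138444, 32, 24⟩, 7534026516749, 477299999, 631675268, 6635⟩,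
    ⟨313414466, 36245413, 55042049, 31766407, 31722950⟩),
  (⟨⟨32, 150572454, 135872294, 0, 0, 0, 0⟩, 10711110533145, 499300000, 474301236, 4870⟩,
    ⟨237131075, 41491912, 22998836, 0, 45100455⟩),
  (⟨⟨32, 141135312, 214151996, 36903164, 74953890, 32, 24⟩, 7777109274206, 483400000, 595456260, 6217⟩,
    ⟨294121858, 37652922, 45948954, 25213542, 32746480⟩)]

theorem prices_four_check : (prices_four.all fun p => p.1.check 11 (4) 16 p.2) = true := by
  decide +kernel

theorem counts_four {P : Fin 4 → ℝ × ℝ} (hP : ∀ i, InHalfDisc (P i))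
    (hV : 10 ^ 9 * cost P ≤ (98412010 : ℤ)) :
    (zones 11 (4) 16).count P .top = 1 ∧ (zones 11 (4) 16).count P .base = 1 ∧
      (zones 11 (4) 16).count P .right = 1 ∧ (zones 11 (4) 16).count P .left = 1 :=
  counts_eq_of_prices prices_four prices_four_check (by decide) (by decide +kernel) hP hV

def prices_five : List (Price × Bounds) := [
  (⟨⟨32, 115605504, 58221739, 0, 0, 0, 0⟩, 6662165402600, 437500001, 310478398, 3139⟩,
    ⟨143901542, 27913412, 6392813, 0, 28051871⟩),
  (⟨⟨32, 86664719, 154654006, 31286152, 69578470, 19, 22⟩, 3722736206598, 378799999, 506021989, 5216⟩,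
    ⟨199773845, 18117934, 27992073, 17891146, 15675041⟩),
  (⟨⟨32, 109145191, 129178301, 20776904, 44392513, 25, 14⟩, 5341684993359, 425100000, 462470022, 4742⟩,
    ⟨197294265, 25606609, 21303261, 9557552, 22491825⟩)]

theorem prices_five_check : (prices_five.all fun p => p.1.check 15 (4) 14 p.2) = true := by
  decide +kernel

theorem counts_five {P : Fin 5 → ℝ × ℝ} (hP : ∀ i, InHalfDisc (P i))
    (hV : 10 ^ 9 * cost P ≤ (65435830 : ℤ)) :
    (zones 15 (4) 14).count P .top = 2 ∧ (zones 15 (4) 14).count P .base = 1 ∧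
      (zones 15 (4) 14).count P .right = 1 ∧ (zones 15 (4) 14).count P .left = 1 :=
  counts_eq_of_prices prices_five prices_five_check (by decide) (by decide +kernel) hP hV

def prices_six : List (Price × Bounds) := [
  (⟨⟨32, 99655720, 40678149, 0, 0, 0, 0⟩, 5336349204166, 406199999, 259519140, 2615⟩,
    ⟨116174311, 22340789, 3725979, 0, 22469358⟩),
  (⟨⟨32, 60425573, 101503179, 19931332, 40587440, 19, 20⟩, 2068738217311, 316299999, 409947861, 4180⟩,
    ⟨134051468, 10548151, 14789692, 10004688, 8710678⟩),
  (⟨⟨32, 93616678, 84456135, 18723373, 36419980, 25, 2⟩, 4147217509510, 393700000, 373942135, 3800⟩,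
    ⟨147416205, 20341126, 11202700, 4426823, 17462372⟩),
  (⟨⟨32, 56998682, 108224799, 14012330, 12683575, 8, 10⟩, 3663606960551, 307199998, 423303828, 4322⟩,
    ⟨136778984, 9663677, 16295697, 1945313, 15426070⟩),
  (⟨⟨32, 71431003, 104131554, 17334219, 50130321, 21, 12⟩, 2712806233164, 343900000, 415221638, 4236⟩,
    ⟨145338108, 13557365, 15372595, 8035677, 11422606⟩)]

theorem prices_six_check : (prices_six.all fun p => p.1.check 18 (4) 13 p.2) = true := by
  decide +kernel

theorem counts_six {P : Fin 6 → ℝ × ℝ} (hP : ∀ i, InHalfDisc (P i))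
    (hV : 10 ^ 9 * cost P ≤ (49956540 : ℤ)) :
    (zones 18 (4) 13).count P .top = 3 ∧ (zones 18 (4) 13).count P .base = 1 ∧
      (zones 18 (4) 13).count P .right = 1 ∧ (zones 18 (4) 13).count P .left = 1 :=
  counts_eq_of_prices prices_six prices_six_check (by decide) (by decide +kernel) hP hV

def prices_seven : List (Price × Bounds) := [
  (⟨⟨32, 71264932, 29969067, 0, 0, 0, 0⟩, 3234412104067, 343499999, 222753950, 2240⟩,
    ⟨83805785, 13510113, 2353339, 0, 13618892⟩),
  (⟨⟨32, 67458283, 95742770, 36299184, 34668439, 25, 22⟩, 1703644316981, 334199999, 398145486, 4055⟩,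
    ⟨135104733, 12442226, 13539597, 14096615, 7173405⟩),
  (⟨⟨32, 46108836, 99968085, 0, 14072728, 0, 11⟩, 3110570353499, 276299998, 406836106, 4147⟩,
    ⟨120928652, 7031070, 14452852, 1274219, 13097441⟩),
  (⟨⟨32, 71140506, 78114483, 33641673, 13649942, 21, 5⟩, 2268088735403, 343199998, 359628899, 3650⟩,
    ⟨123559591, 13474746, 9957590, 6476823, 9550068⟩),
  (⟨⟨32, 57668592, 94382359, 11536013, 52848230, 18, 11⟩, 2113066330407, 308999998, 395306737, 4025⟩,
    ⟨125874207, 9834543, 13249942, 6526042, 8897327⟩)]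

theorem prices_seven_check : (prices_seven.all fun p => p.1.check 18 (6) 11 p.2) = true := by
  decide +kernel

theorem counts_seven {P : Fin 7 → ℝ × ℝ} (hP : ∀ i, InHalfDisc (P i))
    (hV : 10 ^ 9 * cost P ≤ (36666810 : ℤ)) :
    (zones 18 (6) 11).count P .top = 3 ∧ (zones 18 (6) 11).count P .base = 2 ∧
      (zones 18 (6) 11).count P .right = 1 ∧ (zones 18 (6) 11).count P .left = 1 :=
  counts_eq_of_prices prices_seven prices_seven_check (by decide) (by decide +kernel) hP hV

def prices_eight : List (Price × Bounds) := [
  (⟨⟨32, 58982400, 23121681, 0, 0, 0, 0⟩, 2439407301301, 312500001, 195658403, 1965⟩,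
    ⟨67969230, 10172527, 1593568, 0, 10271426⟩),
  (⟨⟨32, 49437683, 74295462, 23615609, 47291616, 30, 16⟩, 818067419798, 286099999, 350727602, 3557⟩,
    ⟨102431529, 7806068, 9232277, 12328646, 3444574⟩),
  (⟨⟨32, 34702316, 73525955, 0, 0, 0, 0⟩, 2165183076010, 239699999, 348906564, 3538⟩,
    ⟨89595939, 4590742, 9088409, 0, 9116771⟩),
  (⟨⟨32, 58982400, 51279809, 23977997, 8334920, 26, 5⟩, 1486084857190, 312500001, 291381518, 2942⟩,
    ⟨91279719, 10172527, 5280077, 5596094, 6257344⟩),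
  (⟨⟨32, 44981037, 65572343, 12683575, 19689740, 17, 12⟩, 1393618744044, 272899999, 329495246, 3336⟩,
    ⟨91520763, 6774689, 7647345, 3757292, 5868004⟩)]

theorem prices_eight_check : (prices_eight.all fun p => p.1.check 19 (6) 10 p.2) = true := by
  decide +kernel

theorem counts_eight {P : Fin 8 → ℝ × ℝ} (hP : ∀ i, InHalfDisc (P i))
    (hV : 10 ^ 9 * cost P ≤ (29057310 : ℤ)) :
    (zones 19 (6) 10).count P .top = 4 ∧ (zones 19 (6) 10).count P .base = 2 ∧
      (zones 19 (6) 10).count P .right = 1 ∧ (zones 19 (6) 10).count P .left = 1 :=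
  counts_eq_of_prices prices_eight prices_eight_check (by decide) (by decide +kernel) hP hV

def prices_nine : List (Price × Bounds) := [
  (⟨⟨32, 47758758, 18288063, 0, 0, 0, 0⟩, 1781405244958, 281199999, 174009379, 1746⟩,
    ⟨54676351, 7411818, 1120363, 0, 7500827⟩),
  (⟨⟨32, 34905295, 62351114, 16488647, 23374017, 15, 19⟩, 841903556455, 240399998, 321300137, 3251⟩,
    ⟨80512968, 4631079, 7088195, 5790625, 3544939⟩),
  (⟨⟨32, 46242437, 45914927, 16911433, 6039797, 19, 5⟩, 1210088685348, 276700000, 275718401, 2781⟩,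
    ⟨76291763, 7061651, 4470817, 2932292, 5095228⟩),
  (⟨⟨32, 30143156, 64160946, 0, 0, 0, 0⟩, 1754635338599, 223399997, 325929884, 3299⟩,
    ⟨78068923, 3716450, 7400575, 0, 7388109⟩),
  (⟨⟨32, 39861221, 51725167, 14133126, 15522280, 16, 8⟩, 1064515474485, 256899998, 292644087, 2955⟩,
    ⟨75819085, 5651596, 5349282, 2892969, 4482274⟩),
  (⟨⟨32, 34731277, 62351114, 5013032, 44392513, 5, 8⟩, 1111819631306, 239800000, 321300137, 3251⟩,
    ⟨80368908, 4596490, 7088195, 3065625, 4681454⟩),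
  (⟨⟨32, 47758758, 40006778, 0, 0, 0, 0⟩, 1827522166715, 281199999, 257368618, 2593⟩,
    ⟨72656022, 7411818, 3633842, 0, 7695008⟩)]

theorem prices_nine_check : (prices_nine.all fun p => p.1.check 21 (4) 9 p.2) = true := by
  decide +kernel

theorem counts_nine {P : Fin 9 → ℝ × ℝ} (hP : ∀ i, InHalfDisc (P i))
    (hV : 10 ^ 9 * cost P ≤ (23398320 : ℤ)) :
    (zones 21 (4) 9).count P .top = 4 ∧ (zones 21 (4) 9).count P .base = 3 ∧
      (zones 21 (4) 9).count P .right = 1 ∧ (zones 21 (4) 9).count P .left = 1 :=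
  counts_eq_of_prices prices_nine prices_nine_check (by decide) (by decide +kernel) hP hV

end HalfDisc

/-! ### Gain of a point whose serving region is slightly displaced -/

namespace HalfDisc

/-- The graph is a triangle of height `ε` and slope `-c`, possibly cut off at `x`; the full triangle
has area `ε² / (2 c)`. -/
theorem integral_ramp_right {z x c ε : ℝ} (hzx : z ≤ x) (hc : 0 < c) :
    ∫ t in z..x, max 0 (ε - c * (t - z)) ≤ max 0 ε ^ 2 / (2 * c) := by
  rcases le_or_gt ε 0 with hε | hε
  · rw [max_eq_left hε, intervalIntegral.integral_congr (g := fun _ => (0 : ℝ))]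
    · simp
    · intro t ht
      rw [Set.uIcc_of_le hzx] at ht
      have := mul_nonneg hc.le (sub_nonneg.2 ht.1)
      exact max_eq_left (by linarith)
  · rw [max_eq_right hε.le]
    have hd : z ≤ z + ε / c := by have := div_pos hε hc; linarith
    refine (integral_max_le_of_nonpos_off (f := fun t => ε - c * (t - z)) hzx hd (by fun_prop)
      (fun t ht hn => ?_) fun t ht => ?_).trans (le_of_eq ?_)
    · have h : z + ε / c < t := by
        by_contra h
        exact hn ⟨ht.1, not_lt.1 h⟩
      have : ε / c < t - z := by linarith
      rw [div_lt_iff₀ hc] at this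
      linarith
    · have : t - z ≤ ε / c := by linarith [ht.2]
      rw [le_div_iff₀ hc] at this
      linarith
    · have h : ∀ t : ℝ, HasDerivAt (fun t => ε * t - c * ((t - z) ^ 2 / 2)) (ε - c * (t - z)) t := by
        intro t
        have := ((hasDerivAt_id t).const_mul ε).sub
          (((((hasDerivAt_id t).sub_const z).pow 2).div_const 2).const_mul c)
        refine this.congr_deriv ?_
        simp
      rw [intervalIntegral.integral_eq_sub_of_hasDerivAt (fun t _ => h t)
        (Continuous.intervalIntegrable (by fun_prop) _ _)]
      field_simp
      ring

theorem integral_ramp_left {z x c ε : ℝ} (hxz : x ≤ z) (hc : 0 < c) :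
    ∫ t in x..z, max 0 (ε - c * (z - t)) ≤ max 0 ε ^ 2 / (2 * c) := by
  have h := integral_ramp_right (z := -z) (x := -x) (ε := ε) (neg_le_neg hxz) hc
  rw [← intervalIntegral.integral_comp_neg] at h
  refine le_trans (le_of_eq ?_) h
  refine intervalIntegral.integral_congr fun t _ => ?_
  congr 1
  ring

/-- According to the sign of `ε`, the zero has moved outwards or inwards, and only one of the two
error triangles is present; this identity treats both cases with one quadratic term. -/
theorem max_sq_add_max_sq (ε : ℝ) : max 0 ε ^ 2 + max 0 (-ε) ^ 2 = ε ^ 2 := by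
  rcases le_total 0 ε with h | h
  · rw [max_eq_right h, max_eq_left (neg_nonpos.2 h)]; ring
  · rw [max_eq_left h, max_eq_right (neg_nonneg.2 h)]; ring

theorem integral_max_eq {x y : ℝ} {f : ℝ → ℝ} (hf : Continuous f) :
    ∫ t in x..y, max 0 (f t) = (∫ t in x..y, f t) + ∫ t in x..y, max 0 (-f t) := by
  rw [← intervalIntegral.integral_add (hf.intervalIntegrable _ _)
    (Continuous.intervalIntegrable (by fun_prop) _ _)]
  refine intervalIntegral.integral_congr fun t _ => ?_
  rcases le_total 0 (f t) with h | h
  · rw [max_eq_right h, max_eq_left (neg_nonpos.2 h)]; ring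
  · rw [max_eq_left h, max_eq_right (neg_nonneg.2 h)]; ring

/-- A function that crosses zero near `z` with slope at least `c`, positive on the right. -/
theorem integral_max_le_right {x z y c ε : ℝ} (hxz : x ≤ z) (hzy : z ≤ y) (hc : 0 < c)
    {f : ℝ → ℝ} (hf : Continuous f)
    (hout : ∀ t ∈ Set.Icc x z, max 0 (f t) ≤ max 0 (ε - c * (z - t)))
    (hin : ∀ t ∈ Set.Icc z y, max 0 (-f t) ≤ max 0 (-ε - c * (t - z))) :
    ∫ t in x..y, max 0 (f t) ≤ (∫ t in z..y, f t) + ε ^ 2 / (2 * c) := by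
  have hi : ∀ u v : ℝ, IntervalIntegrable (fun t => max 0 (f t)) volume u v :=
    fun u v => Continuous.intervalIntegrable (by fun_prop) _ _
  -- Left of `z` the positive part lies below a ramp. Right of `z` it equals `f` plus the negative
  -- part of `f`, and the latter lies below the opposite ramp.
  rw [← intervalIntegral.integral_add_adjacent_intervals (hi x z) (hi z y),
    integral_max_eq (x := z) (y := y) hf]
  have h1 : ∫ t in x..z, max 0 (f t) ≤ max 0 ε ^ 2 / (2 * c) :=
    (intervalIntegral.integral_mono_on hxz (hi _ _)
      (Continuous.intervalIntegrable (by fun_prop) _ _) hout).trans (integral_ramp_left hxz hc)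
  have h2 : ∫ t in z..y, max 0 (-f t) ≤ max 0 (-ε) ^ 2 / (2 * c) :=
    (intervalIntegral.integral_mono_on hzy (Continuous.intervalIntegrable (by fun_prop) _ _)
      (Continuous.intervalIntegrable (by fun_prop) _ _) hin).trans (integral_ramp_right hzy hc)
  have h3 : ε ^ 2 / (2 * c) = max 0 ε ^ 2 / (2 * c) + max 0 (-ε) ^ 2 / (2 * c) := by
    rw [← add_div, max_sq_add_max_sq]
  linarith

/-- A function that crosses zero near `z` with slope at least `c`, positive on the left. -/
theorem integral_max_le_left {x z y c ε : ℝ} (hxz : x ≤ z) (hzy : z ≤ y) (hc : 0 < c)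
    {f : ℝ → ℝ} (hf : Continuous f)
    (hin : ∀ t ∈ Set.Icc x z, max 0 (-f t) ≤ max 0 (-ε - c * (z - t)))
    (hout : ∀ t ∈ Set.Icc z y, max 0 (f t) ≤ max 0 (ε - c * (t - z))) :
    ∫ t in x..y, max 0 (f t) ≤ (∫ t in x..z, f t) + ε ^ 2 / (2 * c) := by
  have hi : ∀ u v : ℝ, IntervalIntegrable (fun t => max 0 (f t)) volume u v :=
    fun u v => Continuous.intervalIntegrable (by fun_prop) _ _
  rw [← intervalIntegral.integral_add_adjacent_intervals (hi x z) (hi z y),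
    integral_max_eq (x := x) (y := z) hf]
  have h1 : ∫ t in z..y, max 0 (f t) ≤ max 0 ε ^ 2 / (2 * c) :=
    (intervalIntegral.integral_mono_on hzy (hi _ _)
      (Continuous.intervalIntegrable (by fun_prop) _ _) hout).trans (integral_ramp_right hzy hc)
  have h2 : ∫ t in x..z, max 0 (-f t) ≤ max 0 (-ε) ^ 2 / (2 * c) :=
    (intervalIntegral.integral_mono_on hxz (Continuous.intervalIntegrable (by fun_prop) _ _)
      (Continuous.intervalIntegrable (by fun_prop) _ _) hin).trans (integral_ramp_left hxz hc)
  have h3 : ε ^ 2 / (2 * c) = max 0 ε ^ 2 / (2 * c) + max 0 (-ε) ^ 2 / (2 * c) := by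
    rw [← add_div, max_sq_add_max_sq]
  linarith

/-- Inside criterion: a concave function that grows with slope at least `c` initially and is
nonnegative at the end of the interval. -/
theorem max_neg_le_of_concave {ℓ c ε s1 : ℝ} {f : ℝ → ℝ} (hf : ConcaveOn ℝ (Set.Icc 0 ℓ) f)
    (hs1 : -ε ≤ c * s1) (hs0 : 0 ≤ s1) (hend : 0 ≤ f ℓ)
    (hslope : ∀ s, 0 ≤ s → s ≤ s1 → s ≤ ℓ → ε + c * s ≤ f s) {s : ℝ} (hs : s ∈ Set.Icc 0 ℓ) :
    max 0 (-f s) ≤ max 0 (-ε - c * s) := by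
  rcases le_or_gt s s1 with h | h
  · exact max_le_max le_rfl (by linarith [hslope s hs.1 h hs.2])
  · have h1 : 0 ≤ f s1 := by linarith [hslope s1 hs0 le_rfl (h.le.trans hs.2)]
    have h2 := hf.min_le_of_mem_Icc ⟨hs0, h.le.trans hs.2⟩
      ⟨hs0.trans (h.le.trans hs.2), le_rfl⟩ (⟨h.le, hs.2⟩ : s ∈ Set.Icc s1 ℓ)
    have h3 : 0 ≤ f s := (le_min h1 hend).trans h2
    rw [max_eq_left (by linarith)]
    exact le_max_left _ _

/-- Outside criterion: a function that decreases, with slope at least `c` initially. -/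
theorem max_le_of_antitone {ℓ c ε s1 : ℝ} {f : ℝ → ℝ} (hf : AntitoneOn f (Set.Icc 0 ℓ))
    (hs1 : ε ≤ c * s1) (hs0 : 0 ≤ s1)
    (hslope : ∀ s, 0 ≤ s → s ≤ s1 → s ≤ ℓ → f s ≤ ε - c * s) {s : ℝ} (hs : s ∈ Set.Icc 0 ℓ) :
    max 0 (f s) ≤ max 0 (ε - c * s) := by
  rcases le_or_gt s s1 with h | h
  · exact max_le_max le_rfl (hslope s hs.1 h hs.2)
  · have h1 := hf ⟨hs0, h.le.trans hs.2⟩ hs h.le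
    have h2 := hslope s1 hs0 le_rfl (h.le.trans hs.2)
    rw [max_eq_left (by linarith)]
    exact le_max_left _ _

/-- The gain on the base of a point near the corner. -/
theorem base_gain_le {B b c ε : ℝ} {a : ℝ × ℝ} (hb0 : -1 ≤ b) (hb1 : b ≤ 1) (hc : 0 < c)
    (hε : ε = B - sqBase a b) (hc2 : c ≤ 2 * (a.1 - b)) (hc3 : 0 ≤ c * (2 * (a.1 - b) - c) + ε)
    (hend : sqBase a 1 ≤ B) :
    ∫ t in (-1 : ℝ)..1, max 0 (B - sqBase a t) ≤
      (∫ t in b..1, (B - sqBase a t)) + ε ^ 2 / (2 * c) := by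
  have cB := continuous_sqBase a
  have e : ∀ s : ℝ, B - sqBase a (b + s) = ε + 2 * (a.1 - b) * s - s ^ 2 := by
    intro s; rw [hε]; simp only [sqBase]; ring
  refine integral_max_le_right hb0 hb1 hc (by fun_prop) (fun t ht => ?_) fun t ht => ?_
  · refine max_le_max le_rfl ?_
    have := e (t - b)
    rw [add_sub_cancel] at this
    rw [this]
    nlinarith [ht.2]
  · have h := max_neg_le_of_concave (ℓ := 1 - b) (c := c) (ε := ε) (s1 := 2 * (a.1 - b) - c)
      (f := fun s => B - sqBase a (b + s)) ?_ (by linarith) (by linarith) (by simpa using hend)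
      (fun s hs0 hs1 _ => by rw [e]; nlinarith) (s := t - b) ⟨by linarith [ht.1], by linarith [ht.2]⟩
    · simpa using h
    · have : (fun s => B - sqBase a (b + s)) = fun s => (ε + 2 * (a.1 - b) * s) + -s ^ 2 := by
        funext s; rw [e]; ring
      rw [this]
      refine ConcaveOn.add ?_ ?_
      · refine ⟨convex_Icc _ _, fun x _ y _ u v _ _ huv => ?_⟩
        simp only [smul_eq_mul]
        have : v = 1 - u := by linarith
        subst this
        apply le_of_eq; ring
      · exact ((even_two.convexOn_pow (𝕜 := ℝ)).neg).subset (Set.subset_univ _) (convex_Icc _ _)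

theorem sin_ge_sub_cube {x : ℝ} (hx : 0 ≤ x) : x - x ^ 3 / 6 ≤ Real.sin x := by
  have := (alternating_taylor 1).1 x hx
  norm_num [trigPoly] at this
  linarith

/-- The gain on the arc of a point near the corner. -/
theorem arc_gain_le {R θ c ε s1 : ℝ} {a : ℝ × ℝ} (hθ0 : 0 ≤ θ) (hθ1 : θ ≤ Real.pi / 2) (hc : 0 < c)
    (ha1 : 0 ≤ a.1) (ha2 : 0 ≤ a.2) (hε : ε = R - sqArc a θ) (hs1 : 0 ≤ s1) (h1 : ε ≤ c * s1)
    (h2 : -ε ≤ c * s1) (hsig : 0 ≤ a.1 * Real.sin θ - a.2 * Real.cos θ)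
    (hslope : c / 2 ≤ (a.1 * Real.sin θ - a.2 * Real.cos θ) * (1 - s1 ^ 2 / 6) -
      (a.1 * Real.cos θ + a.2 * Real.sin θ) * s1 / 2) (hend : sqArc a 0 ≤ R) :
    ∫ t in (0 : ℝ)..Real.pi, max 0 (R - sqArc a t) ≤
      (∫ t in (0 : ℝ)..θ, (R - sqArc a t)) + ε ^ 2 / (2 * c) := by
  have cA := continuous_sqArc a
  have hpi := Real.pi_pos
  set sg := a.1 * Real.sin θ - a.2 * Real.cos θ with hS
  set T := a.1 * Real.cos θ + a.2 * Real.sin θ with hT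
  have hcos : 0 ≤ Real.cos θ := Real.cos_nonneg_of_mem_Icc ⟨by linarith, hθ1⟩
  have hsin : 0 ≤ Real.sin θ := Real.sin_nonneg_of_nonneg_of_le_pi hθ0 (by linarith)
  have hT0 : 0 ≤ T := by rw [hT]; positivity
  have e0 : ∀ t, R - sqArc a t = R - 1 - a.1 ^ 2 - a.2 ^ 2 +
      2 * (a.1 * Real.cos t + a.2 * Real.sin t) := by
    intro t
    rw [sqArc]; linear_combination -Real.sin_sq_add_cos_sq t
  -- `sg` and `T` are the components of `a` normal and parallel to the direction of `θ`, so `2 sg`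
  -- is the slope of the excess at `θ`.
  have e : ∀ s : ℝ, R - sqArc a (θ - s) = ε + 2 * sg * Real.sin s - 2 * T * (1 - Real.cos s) := by
    intro s
    rw [hε, e0, e0, Real.cos_sub, Real.sin_sub, hS, hT]; ring
  have hcosge : ∀ s : ℝ, 1 - Real.cos s ≤ s ^ 2 / 2 := fun s => by
    linarith [Real.one_sub_sq_div_two_le_cos (x := s)]
  -- The bounds `sin s ≥ s - s³ / 6` and `1 - cos s ≤ s² / 2` turn `hslope` into a linear bound on
  -- all of `[0, s1]`.
  have hsl : ∀ s, 0 ≤ s → s ≤ s1 → c / 2 * s ≤ sg * Real.sin s - T * (s ^ 2 / 2) := by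
    intro s hs hs'
    have h3 := mul_le_mul_of_nonneg_left (sin_ge_sub_cube hs) hsig
    have h4 : c / 2 ≤ sg * (1 - s ^ 2 / 6) - T * s / 2 := by
      have : s ^ 2 ≤ s1 ^ 2 := pow_le_pow_left₀ hs hs' 2
      nlinarith
    have := mul_le_mul_of_nonneg_right h4 hs
    nlinarith
  refine integral_max_le_left hθ0 (by linarith) hc (by fun_prop) (fun t ht => ?_) fun t ht => ?_
  · have h := max_neg_le_of_concave (ℓ := θ) (c := c) (ε := ε) (s1 := s1)
      (f := fun s => R - sqArc a (θ - s)) ?_ h2 hs1 (by simpa using hend)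
      (fun s hs0 hs1 _ => by
        rw [e]
        have := hsl s hs0 hs1
        have := mul_le_mul_of_nonneg_left (hcosge s) hT0
        linarith) (s := θ - t) ⟨by linarith [ht.2], by linarith [ht.1]⟩
    · simpa using h
    · have : (fun s => R - sqArc a (θ - s)) = fun s => (R - 1 - a.1 ^ 2 - a.2 ^ 2) +
          2 * (a.1 * Real.cos (θ - s) + a.2 * Real.sin (θ - s)) := by
        funext s; rw [e0]
      rw [this]
      have d1 : ∀ s, HasDerivAt (fun s => (R - 1 - a.1 ^ 2 - a.2 ^ 2) +
          2 * (a.1 * Real.cos (θ - s) + a.2 * Real.sin (θ - s)))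
          (2 * (a.1 * Real.sin (θ - s) - a.2 * Real.cos (θ - s))) s := by
        intro s
        have h0 := (hasDerivAt_id s).const_sub θ
        have := ((((h0.cos).const_mul a.1).add ((h0.sin).const_mul a.2)).const_mul 2).const_add
          (R - 1 - a.1 ^ 2 - a.2 ^ 2)
        refine this.congr_deriv ?_
        simp; ring
      have d2 : ∀ s, HasDerivAt (fun s => 2 * (a.1 * Real.sin (θ - s) - a.2 * Real.cos (θ - s)))
          (-(2 * (a.1 * Real.cos (θ - s) + a.2 * Real.sin (θ - s)))) s := by
        intro s
        have h0 := (hasDerivAt_id s).const_sub θ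
        have := (((h0.sin).const_mul a.1).sub ((h0.cos).const_mul a.2)).const_mul 2
        refine this.congr_deriv ?_
        simp; ring
      refine AntitoneOn.concaveOn_of_deriv (convex_Icc _ _)
        (fun t _ => (d1 t).continuousAt.continuousWithinAt)
        (fun t _ => (d1 t).differentiableAt.differentiableWithinAt) ?_
      rw [funext fun s => (d1 s).deriv]
      refine antitoneOn_of_deriv_nonpos (convex_Icc _ _ |>.interior)
        (fun t _ => (d2 t).continuousAt.continuousWithinAt)
        (fun t _ => (d2 t).differentiableAt.differentiableWithinAt) fun s hs => ?_
      rw [interior_interior, interior_Icc] at hs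
      rw [(d2 s).deriv]
      have hc' : 0 ≤ Real.cos (θ - s) :=
        Real.cos_nonneg_of_mem_Icc ⟨by linarith [hs.2], by linarith [hs.1]⟩
      have hs' : 0 ≤ Real.sin (θ - s) :=
        Real.sin_nonneg_of_nonneg_of_le_pi (by linarith [hs.2]) (by linarith [hs.1])
      have : 0 ≤ a.1 * Real.cos (θ - s) + a.2 * Real.sin (θ - s) := by positivity
      linarith
  -- Beyond `θ` the excess decreases up to `π`. Below `π / 2` this follows by expanding around `θ`,
  -- and above it from the signs of sine and cosine.
  · have h := max_le_of_antitone (ℓ := Real.pi - θ) (c := c) (ε := ε) (s1 := s1)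
      (f := fun s => R - sqArc a (θ + s)) ?_ h1 hs1
      (fun s hs0 hs1 _ => by
        have := e (-s)
        rw [sub_neg_eq_add] at this
        rw [this, Real.sin_neg, Real.cos_neg]
        have := hsl s hs0 hs1
        have := mul_nonneg hT0 (sub_nonneg.2 (Real.cos_le_one s))
        have := mul_nonneg hT0 (sq_nonneg s)
        linarith) (s := t - θ) ⟨by linarith [ht.1], by linarith [ht.2]⟩
    · simpa using h
    · have : (fun s => R - sqArc a (θ + s)) = fun s => (R - 1 - a.1 ^ 2 - a.2 ^ 2) +
          2 * (a.1 * Real.cos (θ + s) + a.2 * Real.sin (θ + s)) := by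
        funext s; rw [e0]
      rw [this]
      have d1 : ∀ s, HasDerivAt (fun s => (R - 1 - a.1 ^ 2 - a.2 ^ 2) +
          2 * (a.1 * Real.cos (θ + s) + a.2 * Real.sin (θ + s)))
          (-(2 * (a.1 * Real.sin (θ + s) - a.2 * Real.cos (θ + s)))) s := by
        intro s
        have h0 := (hasDerivAt_id s).const_add θ
        have := ((((h0.cos).const_mul a.1).add ((h0.sin).const_mul a.2)).const_mul 2).const_add
          (R - 1 - a.1 ^ 2 - a.2 ^ 2)
        refine this.congr_deriv ?_
        simp; ring
      refine antitoneOn_of_deriv_nonpos (convex_Icc _ _)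
        (fun t _ => (d1 t).continuousAt.continuousWithinAt)
        (fun t _ => (d1 t).differentiableAt.differentiableWithinAt) fun s hs => ?_
      rw [interior_Icc] at hs
      rw [(d1 s).deriv]
      have h3 : 0 ≤ a.1 * Real.sin (θ + s) - a.2 * Real.cos (θ + s) := by
        rcases le_total (θ + s) (Real.pi / 2) with h | h
        · have e3 : a.1 * Real.sin (θ + s) - a.2 * Real.cos (θ + s) =
              sg * Real.cos s + T * Real.sin s := by
            rw [Real.sin_add, Real.cos_add, hS, hT]; ring
          rw [e3]
          have hc' : 0 ≤ Real.cos s :=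
            Real.cos_nonneg_of_mem_Icc ⟨by linarith [hs.1], by linarith⟩
          have hs' : 0 ≤ Real.sin s :=
            Real.sin_nonneg_of_nonneg_of_le_pi hs.1.le (by linarith)
          positivity
        · have hc' : Real.cos (θ + s) ≤ 0 :=
            Real.cos_nonpos_of_pi_div_two_le_of_le h (by linarith [hs.2])
          have hs' : 0 ≤ Real.sin (θ + s) :=
            Real.sin_nonneg_of_nonneg_of_le_pi (by linarith) (by linarith [hs.2])
          nlinarith [mul_nonneg ha1 hs', mul_nonneg ha2 (neg_nonneg.2 hc')]
      linarith

end HalfDisc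

/-! ### The centroid of a corner cell maximises the gain locally -/

namespace HalfDisc

/-- The saving of the point `p` that serves the part `[b, 1]` of the base and the arc up to the
angle `θ` when the prices there are `B` and `R`. -/
noncomputable def cornerGain (b θ B R : ℝ) (p : ℝ × ℝ) : ℝ :=
  (1 - b) / 4 * B + θ / (2 * Real.pi) * R - ((1 - b ^ 3) / 12 + θ / (2 * Real.pi) -
    ((1 - b) / 4 + θ / (2 * Real.pi)) * (p.1 ^ 2 + p.2 ^ 2))

/-- The point `p` is the centroid of the part `[b, 1]` of the base and the arc up to `θ`. -/
def IsCentroid (b θ : ℝ) (p : ℝ × ℝ) : Prop :=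
  ((1 - b) / 4 + θ / (2 * Real.pi)) * p.1 = (1 - b ^ 2) / 8 + Real.sin θ / (2 * Real.pi) ∧
    ((1 - b) / 4 + θ / (2 * Real.pi)) * p.2 = (1 - Real.cos θ) / (2 * Real.pi)

theorem integral_sqBase (a : ℝ × ℝ) (x y : ℝ) :
    ∫ t in x..y, sqBase a t = (y ^ 3 - x ^ 3) / 3 - a.1 * (y ^ 2 - x ^ 2) +
      (a.1 ^ 2 + a.2 ^ 2) * (y - x) := by
  have h : ∀ t ∈ Set.uIcc x y, HasDerivAt (fun t => t ^ 3 / 3 - a.1 * t ^ 2 +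
      (a.1 ^ 2 + a.2 ^ 2) * t) (sqBase a t) t := by
    intro t _
    have := (((hasDerivAt_pow 3 t).div_const 3).sub ((hasDerivAt_pow 2 t).const_mul a.1)).add
      ((hasDerivAt_id t).const_mul (a.1 ^ 2 + a.2 ^ 2))
    refine this.congr_deriv ?_
    simp [sqBase]; ring
  rw [intervalIntegral.integral_eq_sub_of_hasDerivAt h
    ((continuous_sqBase a).intervalIntegrable _ _)]
  ring

theorem integral_sqArc (a : ℝ × ℝ) (x y : ℝ) :
    ∫ t in x..y, sqArc a t = (1 + a.1 ^ 2 + a.2 ^ 2) * (y - x) -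
      2 * a.1 * (Real.sin y - Real.sin x) + 2 * a.2 * (Real.cos y - Real.cos x) := by
  have h : ∀ t ∈ Set.uIcc x y, HasDerivAt (fun t => (1 + a.1 ^ 2 + a.2 ^ 2) * t -
      2 * a.1 * Real.sin t + 2 * a.2 * Real.cos t) (sqArc a t) t := by
    intro t _
    have := (((hasDerivAt_id t).const_mul (1 + a.1 ^ 2 + a.2 ^ 2)).sub
      ((Real.hasDerivAt_sin t).const_mul (2 * a.1))).add
      ((Real.hasDerivAt_cos t).const_mul (2 * a.2))
    refine this.congr_deriv ?_
    simp only [sqArc]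
    linear_combination -(Real.sin_sq_add_cos_sq t)
  rw [intervalIntegral.integral_eq_sub_of_hasDerivAt h
    ((continuous_sqArc a).intervalIntegrable _ _)]
  ring

theorem quadratic_pos {A D E x y : ℝ} (hA : 0 < A) (hD : 0 < A * D - E ^ 2) (h : x ≠ 0 ∨ y ≠ 0) :
    0 < A * x ^ 2 + D * y ^ 2 - 2 * E * x * y := by
  have e : A * (A * x ^ 2 + D * y ^ 2 - 2 * E * x * y) =
      (A * x - E * y) ^ 2 + (A * D - E ^ 2) * y ^ 2 := by ring
  refine pos_of_mul_pos_right (a := A) ?_ hA.le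
  rw [e]
  by_cases hy : y = 0
  · have hx : x ≠ 0 := by tauto
    subst hy
    have : 0 < (A * x) ^ 2 := by positivity
    simpa using this
  · have : 0 < (A * D - E ^ 2) * y ^ 2 := by positivity
    have := sq_nonneg (A * x - E * y)
    linarith

/-- Near the centroid `p` the saving is largest at `p`. -/
theorem gain_le_cornerGain {b θ B R c e s : ℝ} {p a : ℝ × ℝ} (hp : IsCentroid b θ p)
    (hB : B = (p.1 - b) ^ 2 + p.2 ^ 2) (hR : R = (Real.cos θ - p.1) ^ 2 + (Real.sin θ - p.2) ^ 2)
    (hb0 : -1 ≤ b) (hb1 : b ≤ 1) (hθ0 : 0 ≤ θ) (hθ1 : θ ≤ Real.pi / 2) (ha1 : 0 ≤ a.1)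
    (ha2 : 0 ≤ a.2) (hs : 0 ≤ s) (hc : 0 < c) (he : 0 < e)
    (h1 : c ≤ 2 * (a.1 - b))
    (h2 : 0 ≤ c * (2 * (a.1 - b) - c) - ((a.1 - p.1) ^ 2 + (a.2 - p.2) ^ 2 +
      2 * ((a.1 - p.1) * (p.1 - b) + (a.2 - p.2) * p.2)))
    (h3 : (1 - a.1) ^ 2 + a.2 ^ 2 ≤ B) (h4 : (1 - a.1) ^ 2 + a.2 ^ 2 ≤ R)
    (h5 : 0 ≤ a.1 * Real.sin θ - a.2 * Real.cos θ)
    (h6 : 2 * ((a.1 - p.1) * (Real.cos θ - p.1) + (a.2 - p.2) * (Real.sin θ - p.2)) -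
      ((a.1 - p.1) ^ 2 + (a.2 - p.2) ^ 2) ≤ e * s)
    (h7 : -(2 * ((a.1 - p.1) * (Real.cos θ - p.1) + (a.2 - p.2) * (Real.sin θ - p.2)) -
      ((a.1 - p.1) ^ 2 + (a.2 - p.2) ^ 2)) ≤ e * s)
    (h8 : e / 2 ≤ (a.1 * Real.sin θ - a.2 * Real.cos θ) * (1 - s ^ 2 / 6) -
      (a.1 * Real.cos θ + a.2 * Real.sin θ) * s / 2)
    {kb ka M A D E : ℝ} (hkb : kb = 1 / (8 * c)) (hka : ka = 1 / (4 * e) * Real.pi⁻¹)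
    (hM : M = (1 - b) / 4 + θ / (2 * Real.pi) - kb * ((a.1 - p.1) ^ 2 + (a.2 - p.2) ^ 2 +
      4 * ((a.1 - p.1) * (p.1 - b) + (a.2 - p.2) * p.2)) - ka * ((a.1 - p.1) ^ 2 +
      (a.2 - p.2) ^ 2 - 4 * ((a.1 - p.1) * (Real.cos θ - p.1) + (a.2 - p.2) * (Real.sin θ - p.2))))
    (hA : A = M - 4 * (kb * (p.1 - b) ^ 2 + ka * (Real.cos θ - p.1) ^ 2))
    (hD : D = M - 4 * (kb * p.2 ^ 2 + ka * (Real.sin θ - p.2) ^ 2))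
    (hE : E = 4 * (kb * ((p.1 - b) * p.2) + ka * ((Real.cos θ - p.1) * (Real.sin θ - p.2))))
    (h9 : 0 < A) (h10 : 0 < A * D - E ^ 2) :
    gain (fun _ => B) (fun _ => R) a ≤ cornerGain b θ B R p ∧
      (a ≠ p → gain (fun _ => B) (fun _ => R) a < cornerGain b θ B R p) := by
  have hpi := Real.pi_pos
  have hsc := Real.sin_sq_add_cos_sq θ
  have g1 := base_gain_le (B := B) (b := b) (c := c) (ε := B - sqBase a b) (a := a) hb0 hb1 hc rfl h1
    (by simp only [sqBase]; rw [hB]; linarith) (by simp only [sqBase]; exact h3)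
  have ha : R - sqArc a θ = 2 * ((a.1 - p.1) * (Real.cos θ - p.1) +
      (a.2 - p.2) * (Real.sin θ - p.2)) - ((a.1 - p.1) ^ 2 + (a.2 - p.2) ^ 2) := by
    simp only [sqArc]; rw [hR]; ring
  have g2 := arc_gain_le (R := R) (θ := θ) (c := e) (ε := R - sqArc a θ) (s1 := s) (a := a) hθ0 hθ1 he
    ha1 ha2 rfl hs (by rw [ha]; exact h6) (by rw [ha]; exact h7) h5 h8
    (by simp only [sqArc, Real.cos_zero, Real.sin_zero]; linarith)
  have i1 : ∫ t in b..1, (B - sqBase a t) = (1 - b) * B - ((1 - b ^ 3) / 3 - a.1 * (1 - b ^ 2) +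
      (a.1 ^ 2 + a.2 ^ 2) * (1 - b)) := by
    rw [intervalIntegral.integral_sub (continuous_const.intervalIntegrable _ _)
      ((continuous_sqBase a).intervalIntegrable _ _), intervalIntegral.integral_const,
      integral_sqBase]
    simp
  have i2 : ∫ t in (0 : ℝ)..θ, (R - sqArc a t) = θ * R - ((1 + a.1 ^ 2 + a.2 ^ 2) * θ -
      2 * a.1 * Real.sin θ + 2 * a.2 * (Real.cos θ - 1)) := by
    rw [intervalIntegral.integral_sub (continuous_const.intervalIntegrable _ _)
      ((continuous_sqArc a).intervalIntegrable _ _), intervalIntegral.integral_const,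
      integral_sqArc]
    simp
  rw [i1] at g1
  rw [i2] at g2
  -- Let `d = a - p`. Serving the fixed cell from `a` instead of its centroid costs the mass times
  -- `|d|²`; moving the boundaries of the served region regains at most a multiple of the squared
  -- price excess there. That excess is `±|d|²` plus a linear form in `d`, so its square is the
  -- square of the linear form plus `|d|²` times a number. Those numbers are absorbed into `M`, and
  -- the net loss is exactly a quadratic form in `d`, with coefficients depending on `a`.
  have key : gain (fun _ => B) (fun _ => R) a ≤ cornerGain b θ B R p -
      (A * (a.1 - p.1) ^ 2 + D * (a.2 - p.2) ^ 2 - 2 * E * (a.1 - p.1) * (a.2 - p.2)) := by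
    unfold gain
    have w1 := mul_le_mul_of_nonneg_left g1 (by norm_num : (0 : ℝ) ≤ 1 / 4)
    have w2 := mul_le_mul_of_nonneg_left g2 (by positivity : (0 : ℝ) ≤ 1 / (2 * Real.pi))
    refine (add_le_add w1 w2).trans (le_of_eq ?_)
    have k1 : 1 / 4 * ((B - sqBase a b) ^ 2 / (2 * c)) = kb * (B - sqBase a b) ^ 2 := by
      rw [hkb]; field_simp; ring
    have k2 : 1 / (2 * Real.pi) * ((R - sqArc a θ) ^ 2 / (2 * e)) = ka * (R - sqArc a θ) ^ 2 := by
      rw [hka]; field_simp; ring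
    rw [mul_add, mul_add, k1, k2, ha]
    have hb' : B - sqBase a b = -((a.1 - p.1) ^ 2 + (a.2 - p.2) ^ 2 +
      2 * ((a.1 - p.1) * (p.1 - b) + (a.2 - p.2) * p.2)) := by
      simp only [sqBase]; rw [hB]; ring
    rw [hb', hA, hD, hE, hM, cornerGain]
    obtain ⟨c1, c2⟩ := hp
    linear_combination (-2 * a.1) * c1 + (-2 * a.2) * c2
  constructor
  · by_cases h : a.1 - p.1 ≠ 0 ∨ a.2 - p.2 ≠ 0
    · have := quadratic_pos h9 h10 h
      linarith
    · push Not at h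
      rw [h.1, h.2] at key
      linarith
  · intro hne
    have h : a.1 - p.1 ≠ 0 ∨ a.2 - p.2 ≠ 0 := by
      by_contra hcon
      push Not at hcon
      exact hne (Prod.ext (by linarith [hcon.1]) (by linarith [hcon.2]))
    have := quadratic_pos h9 h10 h
    linarith

end HalfDisc

/-! ### Interval verification of the local maximum -/

namespace HalfDisc

namespace Ex

instance : Add Ex := ⟨.add⟩

instance : Neg Ex := ⟨.neg⟩

instance : Sub Ex := ⟨fun e f => .add e (.neg f)⟩

instance : Mul Ex := ⟨.mul⟩

/-- A natural number as an expression. -/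
def nat (n : ℕ) : Ex := .const n 1

variable (ρ : ℕ → ℝ) (e f : Ex)

theorem eval_add : (e + f).eval ρ = e.eval ρ + f.eval ρ := rfl

theorem eval_neg : (-e).eval ρ = -e.eval ρ := rfl

theorem eval_sub : (e - f).eval ρ = e.eval ρ - f.eval ρ := by
  change e.eval ρ + -f.eval ρ = _
  ring

theorem eval_mul : (e * f).eval ρ = e.eval ρ * f.eval ρ := rfl

theorem eval_sq : (sq e).eval ρ = e.eval ρ ^ 2 := rfl

theorem eval_inv : (inv e).eval ρ = (e.eval ρ)⁻¹ := rfl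

theorem eval_sin : (sin e).eval ρ = Real.sin (e.eval ρ) := rfl

theorem eval_cos : (cos e).eval ρ = Real.cos (e.eval ρ) := rfl

theorem eval_var (i : ℕ) : (var i).eval ρ = ρ i := rfl

theorem eval_const (a : ℤ) (b : ℕ) : (const a b).eval ρ = a / b := rfl

theorem eval_nat (n : ℕ) : (nat n).eval ρ = n := by simp [nat, eval]

end Ex

/-- The values of the variables in the expressions for a corner. -/
noncomputable def cornerVal (b θ : ℝ) (p a : ℝ × ℝ) : ℕ → ℝ
  | 0 => Real.pi
  | 1 => b
  | 2 => θ
  | 3 => Real.cos θ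
  | 4 => Real.sin θ
  | 5 => p.1
  | 6 => p.2
  | 7 => a.1
  | 8 => a.2
  | _ => 0

/-- Enclosures of the variables. -/
def cornerItv (l : List Itv) (x y : Itv) : ℕ → Itv
  | 7 => x
  | 8 => y
  | i => l.getD i ⟨0, 0⟩

/-- The enclosures `l` of `π`, `b`, `θ`, `cos θ`, `sin θ` and the coordinates of `p` hold. -/
def CornerMem (l : List Itv) (b θ : ℝ) (p : ℝ × ℝ) : Prop :=
  ∀ x y a, x.Mem a.1 → y.Mem a.2 → ∀ i, (cornerItv l x y i).Mem (cornerVal b θ p a i)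

theorem cornerMem_of {b θ : ℝ} {p : ℝ × ℝ} {I0 I1 I2 I3 I4 I5 I6 : Itv} (h0 : I0.Mem Real.pi)
    (h1 : I1.Mem b) (h2 : I2.Mem θ) (h3 : I3.Mem (Real.cos θ)) (h4 : I4.Mem (Real.sin θ))
    (h5 : I5.Mem p.1) (h6 : I6.Mem p.2) : CornerMem [I0, I1, I2, I3, I4, I5, I6] b θ p := by
  intro x y a hx hy i
  match i with
  | 0 => exact h0
  | 1 => exact h1
  | 2 => exact h2
  | 3 => exact h3
  | 4 => exact h4
  | 5 => exact h5
  | 6 => exact h6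
  | 7 => exact hx
  | 8 => exact hy
  | i + 9 => simp [cornerItv, cornerVal, Itv.Mem]

section

variable (c e s : ℕ)

open Ex

/-- The expressions whose positivity implies that the saving on a box is largest at `p`; the
parameters are given in multiples of `10⁻³`. -/
def cornerExs : List Ex :=
  let C : Ex := .const c 1000
  let E : Ex := .const e 1000
  let S : Ex := .const s 1000
  let b : Ex := var 1
  let w1 : Ex := var 3 - var 5
  let w2 : Ex := var 4 - var 6
  let d1 : Ex := var 7 - var 5
  let d2 : Ex := var 8 - var 6
  let u1 : Ex := var 5 - b
  let D : Ex := sq d1 + sq d2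
  let du : Ex := d1 * u1 + d2 * var 6
  let dw : Ex := d1 * w1 + d2 * w2
  -- `1 / (8 c)` with `c` counted in thousandths; likewise `250 / e` below is `1 / (4 e)`.
  let kb : Ex := .const 125 c
  let ka : Ex := .const 250 e * inv (var 0)
  let L : Ex := nat 2 * (var 7 - b)
  let ea : Ex := nat 2 * dw - D
  let end' : Ex := sq (nat 1 - var 7) + sq (var 8)
  let sg : Ex := var 7 * var 4 - var 8 * var 3
  let M : Ex := .const 1 4 * (nat 1 - b) + .const 1 2 * (var 2 * inv (var 0)) -
    kb * (D + nat 4 * du) - ka * (D - nat 4 * dw)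
  let A : Ex := M - nat 4 * (kb * sq u1 + ka * sq w1)
  let G : Ex := M - nat 4 * (kb * sq (var 6) + ka * sq w2)
  let F : Ex := nat 4 * (kb * (u1 * var 6) + ka * (w1 * w2))
  [C, E, var 7, L - C, C * (L - C) - (D + nat 2 * du), sq u1 + sq (var 6) - end',
    sq w1 + sq w2 - end', sg, E * S - ea, E * S + ea,
    sg * (nat 1 - .const 1 6 * sq S) - .const 1 2 * ((var 7 * var 3 + var 8 * var 4) * S) -
      .const 1 2 * E, A, A * G - sq F]

end

/-- The verification of the local optimality on a box with end points in `ℤ / 256`. -/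
def boxCheck (l : List Itv) (x w y h : ℕ) (t : ℕ × ℕ × ℕ) : Bool :=
  (cornerExs t.1 t.2.1 t.2.2).all fun e => e.pos (cornerItv l
    ⟨x * 390625000000000000, (x + w : ℕ) * 390625000000000000⟩
    ⟨y * 390625000000000000, (y + h : ℕ) * 390625000000000000⟩)

theorem gain_le_of_boxCheck {b θ B R : ℝ} {p a : ℝ × ℝ} {l : List Itv} (hl : CornerMem l b θ p)
    (hp : IsCentroid b θ p) (hB : B = (p.1 - b) ^ 2 + p.2 ^ 2)
    (hR : R = (Real.cos θ - p.1) ^ 2 + (Real.sin θ - p.2) ^ 2)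
    (hb0 : -1 ≤ b) (hb1 : b ≤ 1) (hθ0 : 0 ≤ θ) (hθ1 : θ ≤ Real.pi / 2) (ha2 : 0 ≤ a.2)
    {x w y h : ℕ} {t : ℕ × ℕ × ℕ} (hbox : boxCheck l x w y h t = true)
    (h1 : (x : ℝ) ≤ 256 * a.1) (h2 : 256 * a.1 ≤ x + w) (h3 : (y : ℝ) ≤ 256 * a.2)
    (h4 : 256 * a.2 ≤ y + h) :
    gain (fun _ => B) (fun _ => R) a ≤ cornerGain b θ B R p ∧
      (a ≠ p → gain (fun _ => B) (fun _ => R) a < cornerGain b θ B R p) := by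
  -- `390625000000000000` is `prec / 256`.
  have hm := hl ⟨x * 390625000000000000, (x + w : ℕ) * 390625000000000000⟩
    ⟨y * 390625000000000000, (y + h : ℕ) * 390625000000000000⟩ a
    (by constructor <;> simp only [prec] <;> push_cast <;> linarith)
    (by constructor <;> simp only [prec] <;> push_cast <;> linarith)
  obtain ⟨c, e, s⟩ := t
  have hall := fun f hf => Ex.eval_pos hm (List.all_eq_true.1 hbox f hf)
  simp only [cornerExs, List.forall_mem_cons, List.not_mem_nil, false_imp_iff, implies_true,
    Ex.eval_add, Ex.eval_sub, Ex.eval_mul, Ex.eval_sq, Ex.eval_inv, Ex.eval_var, Ex.eval_const,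
    Ex.eval_nat, cornerVal, and_true] at hall
  push_cast at hall
  obtain ⟨k1, k2, k3, k4, k5, k6, k7, k8, k9, k10, k11, k12, k13⟩ := hall
  have hc : (0 : ℝ) < c := by linarith
  have he : (0 : ℝ) < e := by linarith
  refine gain_le_cornerGain (c := c / 1000) (e := e / 1000) (s := s / 1000) hp hB hR hb0 hb1 hθ0 hθ1
    k3.le ha2 (by positivity) k1 k2 (by linarith) (by linarith) (by linarith) (by linarith) k8.le
    (by linarith) (by linarith) (by linarith) (kb := 125 / c) (ka := 250 / e * Real.pi⁻¹)
    (by field_simp; norm_num) (by field_simp; norm_num) rfl rfl rfl rfl ?_ ?_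
  · refine k12.trans_le (le_of_eq ?_); ring
  · refine k13.trans_le (le_of_eq ?_); ring

/-- The verification of the local optimality on a rectangle that is divided into `S ^ 2` boxes. -/
noncomputable def localCheck (l : List Itv) (x w y h S : ℕ) (ts : List (ℕ × ℕ × ℕ)) : Bool :=
  allBelow (fun i => allBelow (fun j =>
    -- A missing entry defaults to `(0, 0, 0)`, which fails the positivity of the first expression.
    boxCheck l (x + i * w) w (y + j * h) h (ts.getD (i * S + j) (0, 0, 0))) S) S

theorem gain_le_of_localCheck {b θ B R : ℝ} {p a : ℝ × ℝ} {l : List Itv} (hl : CornerMem l b θ p)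
    (hp : IsCentroid b θ p) (hB : B = (p.1 - b) ^ 2 + p.2 ^ 2)
    (hR : R = (Real.cos θ - p.1) ^ 2 + (Real.sin θ - p.2) ^ 2)
    (hb0 : -1 ≤ b) (hb1 : b ≤ 1) (hθ0 : 0 ≤ θ) (hθ1 : θ ≤ Real.pi / 2) (ha2 : 0 ≤ a.2)
    {x w y h S : ℕ} (hw : 0 < w) (hh : 0 < h) (hS : 0 < S) {ts : List (ℕ × ℕ × ℕ)}
    (hbox : localCheck l x w y h S ts = true)
    (h1 : (x : ℝ) ≤ 256 * a.1) (h2 : 256 * a.1 ≤ x + S * w) (h3 : (y : ℝ) ≤ 256 * a.2)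
    (h4 : 256 * a.2 ≤ y + S * h) :
    gain (fun _ => B) (fun _ => R) a ≤ cornerGain b θ B R p ∧
      (a ≠ p → gain (fun _ => B) (fun _ => R) a < cornerGain b θ B R p) := by
  have hw' : (0 : ℝ) < w := Nat.cast_pos.2 hw
  have hh' : (0 : ℝ) < h := Nat.cast_pos.2 hh
  obtain ⟨i, hi, s, hs0, hs1, hs⟩ := exists_cell (x := 0) (z := (256 * a.1 - x) / w) hS
    (by push_cast; exact div_nonneg (by linarith) hw'.le)
    (by rw [div_le_iff₀ hw']; push_cast; linarith)
  obtain ⟨j, hj, r, hr0, hr1, hr⟩ := exists_cell (x := 0) (z := (256 * a.2 - y) / h) hS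
    (by push_cast; exact div_nonneg (by linarith) hh'.le)
    (by rw [div_le_iff₀ hh']; push_cast; linarith)
  rw [div_eq_iff hw'.ne'] at hs
  rw [div_eq_iff hh'.ne'] at hr
  push_cast at hs hr
  simp only [localCheck, allBelow_iff] at hbox
  refine gain_le_of_boxCheck hl hp hB hR hb0 hb1 hθ0 hθ1 ha2 (hbox i hi j hj) ?_ ?_ ?_ ?_ <;>
  push_cast <;> nlinarith

end HalfDisc

/-! ### The cost of a symmetric partition and its gradient -/

namespace HalfDisc

/-- The mass of the part `[b, 1]` of the base and the arc up to `θ`. -/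
noncomputable def cornerMass (b θ : ℝ) : ℝ := (1 - b) / 4 + θ / (2 * Real.pi)

/-- The centroid of the part `[b, 1]` of the base and the arc up to `θ`. -/
noncomputable def cornerPoint (b θ : ℝ) : ℝ × ℝ :=
  (((1 - b ^ 2) / 8 + Real.sin θ / (2 * Real.pi)) / cornerMass b θ,
    ((1 - Real.cos θ) / (2 * Real.pi)) / cornerMass b θ)

/-- Half of the angle of each of `m` equal parts of the arc between the angles `θ` and `π - θ`. -/
noncomputable def halfAngle (m : ℕ) (θ : ℝ) : ℝ := (Real.pi - 2 * θ) / (2 * m)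

/-- The cost of the partition of `[-b, b]` and of the arc between the angles `θ` and `π - θ` into
`k` and `m` equal parts, and of the rest into two symmetric parts. -/
noncomputable def partitionCost (k m : ℕ) (b θ : ℝ) : ℝ :=
  2 * ((1 - b ^ 3) / 12 + θ / (2 * Real.pi) - (((1 - b ^ 2) / 8 + Real.sin θ / (2 * Real.pi)) ^ 2 +
    ((1 - Real.cos θ) / (2 * Real.pi)) ^ 2) / cornerMass b θ) + b ^ 3 / (6 * k ^ 2) +
    m / Real.pi * (halfAngle m θ - Real.sin (halfAngle m θ) ^ 2 / halfAngle m θ)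

theorem isCentroid_cornerPoint {b θ : ℝ} (h : 0 < cornerMass b θ) :
    IsCentroid b θ (cornerPoint b θ) := by
  have h' := h.ne'
  constructor
  · change cornerMass b θ * (_ / cornerMass b θ) = _
    field_simp
  · change cornerMass b θ * (_ / cornerMass b θ) = _
    field_simp

/-- Envelope principle: the centroids are stationary, so moving a cell boundary changes the cost
only through the difference of the squared distances to the two neighbouring centroids. The point
`b` is at distance `b / k` from the midpoint of its base cell, and `1/2` is twice the density `1/4`,
for the boundaries `b` and `-b`. -/
theorem hasDerivAt_partitionCost_left (k m : ℕ) {b θ : ℝ} (h : 0 < cornerMass b θ) :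
    HasDerivAt (fun b => partitionCost k m b θ)
      (1 / 2 * ((b / k) ^ 2 - sqBase (cornerPoint b θ) b)) b := by
  have h' := h.ne'
  have hM : HasDerivAt (fun b => cornerMass b θ) (-1 / 4) b := by
    unfold cornerMass
    have := (((hasDerivAt_id b).const_sub 1).div_const 4).add_const (θ / (2 * Real.pi))
    exact this.congr_deriv (by ring)
  have hX : HasDerivAt (fun b : ℝ => (1 - b ^ 2) / 8 + Real.sin θ / (2 * Real.pi)) (-b / 4) b := by
    have := (((hasDerivAt_pow 2 b).const_sub 1).div_const 8).add_const (Real.sin θ / (2 * Real.pi))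
    exact this.congr_deriv (by push_cast; ring)
  have hT : HasDerivAt (fun b : ℝ => (1 - b ^ 3) / 12 + θ / (2 * Real.pi)) (-b ^ 2 / 4) b := by
    have := (((hasDerivAt_pow 3 b).const_sub 1).div_const 12).add_const (θ / (2 * Real.pi))
    exact this.congr_deriv (by push_cast; ring)
  have hC : HasDerivAt (fun b : ℝ => b ^ 3 / (6 * (k : ℝ) ^ 2)) (1 / 2 * (b / k) ^ 2) b := by
    have := (hasDerivAt_pow 3 b).div_const (6 * (k : ℝ) ^ 2)
    exact this.congr_deriv (by push_cast; ring)
  have := (((hT.sub (((hX.pow 2).add_const (((1 - Real.cos θ) / (2 * Real.pi)) ^ 2)).div hM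
    h')).const_mul 2).add hC).add_const
    (m / Real.pi * (halfAngle m θ - Real.sin (halfAngle m θ) ^ 2 / halfAngle m θ))
  refine this.congr_deriv ?_
  have hpi := Real.pi_ne_zero
  simp only [sqBase, cornerPoint, Pi.pow_apply, Nat.cast_ofNat, Nat.add_one_sub_one, pow_one]
  field_simp
  ring

/-- The same principle at the angles `θ` and `π - θ`, with twice the density `1 / (2 π)`; `arcPrice`
is the squared distance from an arc centroid to the end of its arc. -/
theorem hasDerivAt_partitionCost_right (k : ℕ) {m : ℕ} (hm : 0 < m) {b θ : ℝ}
    (h : 0 < cornerMass b θ) (hθ : θ < Real.pi / 2) :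
    HasDerivAt (fun θ => partitionCost k m b θ)
      (1 / Real.pi * (sqArc (cornerPoint b θ) θ - arcPrice (halfAngle m θ))) θ := by
  have h' := h.ne'
  have hpi := Real.pi_ne_zero
  have hm' : (m : ℝ) ≠ 0 := Nat.cast_ne_zero.2 hm.ne'
  have hh : halfAngle m θ ≠ 0 := by
    have : 0 < Real.pi - 2 * θ := by linarith
    unfold halfAngle
    positivity
  have hM : HasDerivAt (fun θ => cornerMass b θ) (1 / (2 * Real.pi)) θ := by
    unfold cornerMass
    exact ((hasDerivAt_id θ).div_const (2 * Real.pi)).const_add ((1 - b) / 4)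
  have hX : HasDerivAt (fun θ : ℝ => (1 - b ^ 2) / 8 + Real.sin θ / (2 * Real.pi))
      (Real.cos θ / (2 * Real.pi)) θ :=
    ((Real.hasDerivAt_sin θ).div_const (2 * Real.pi)).const_add ((1 - b ^ 2) / 8)
  have hY : HasDerivAt (fun θ : ℝ => (1 - Real.cos θ) / (2 * Real.pi))
      (Real.sin θ / (2 * Real.pi)) θ := by
    have := ((Real.hasDerivAt_cos θ).const_sub 1).div_const (2 * Real.pi)
    exact this.congr_deriv (by ring)
  have hT : HasDerivAt (fun θ : ℝ => (1 - b ^ 3) / 12 + θ / (2 * Real.pi)) (1 / (2 * Real.pi)) θ :=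
    ((hasDerivAt_id θ).div_const (2 * Real.pi)).const_add ((1 - b ^ 3) / 12)
  have hH : HasDerivAt (fun θ => halfAngle m θ) (-1 / m) θ := by
    unfold halfAngle
    have := (((hasDerivAt_id θ).const_mul 2).const_sub Real.pi).div_const (2 * (m : ℝ))
    exact this.congr_deriv (by field_simp)
  have hS : HasDerivAt (fun θ => Real.sin (halfAngle m θ)) _ θ := hH.sin
  have := (((hT.sub (((hX.pow 2).add (hY.pow 2)).div hM h')).const_mul 2).add_const
    (b ^ 3 / (6 * (k : ℝ) ^ 2))).add ((hH.sub ((hS.pow 2).div hH hh)).const_mul (m / Real.pi))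
  refine this.congr_deriv ?_
  simp only [sqArc, cornerPoint, arcPrice, Pi.add_apply, Pi.pow_apply, Nat.cast_ofNat,
    Nat.add_one_sub_one, pow_one]
  have hsc := Real.sin_sq_add_cos_sq θ
  generalize hz : halfAngle m θ = z at *
  have e : Real.cos θ ^ 2 = 1 - Real.sin θ ^ 2 := by linarith
  field_simp
  ring_nf
  simp only [e]
  ring

end HalfDisc

/-! ### Existence and enclosure of a stationary pair -/

namespace HalfDisc

/-- A minimum on an interval is a critical point if the function decreases at the left end point
and increases at the right end point. -/
theorem eq_zero_of_isMinOn {f : ℝ → ℝ} {x0 x1 x d : ℝ} (hx : x ∈ Set.Icc x0 x1)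
    (hmin : IsMinOn f (Set.Icc x0 x1) x) (h01 : x0 < x1) (hd : HasDerivAt f d x)
    (h0 : x = x0 → d < 0) (h1 : x = x1 → 0 < d) : d = 0 := by
  -- The first-order condition as a variational inequality. At an end point it gives the derivative
  -- a sign that the hypotheses exclude.
  have key : ∀ y ∈ Set.Icc x0 x1, 0 ≤ (y - x) * d := by
    intro y hy
    have hseg : segment ℝ x (x + (y - x)) ⊆ Set.Icc x0 x1 := by
      rw [add_sub_cancel]
      exact (convex_Icc x0 x1).segment_subset hx hy
    have := hmin.localize.hasFDerivWithinAt_nonneg hd.hasFDerivAt.hasFDerivWithinAt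
      (mem_posTangentConeAt_of_segment_subset hseg)
    simpa using this
  have k0 := key x0 ⟨le_rfl, h01.le⟩
  have k1 := key x1 ⟨h01.le, le_rfl⟩
  rcases eq_or_lt_of_le hx.1 with e | e
  · have := h0 e.symm
    rw [← e] at k1
    nlinarith
  · rcases eq_or_lt_of_le hx.2 with e' | e'
    · have := h1 e'
      rw [e'] at k0
      nlinarith
    · refine le_antisymm ?_ ?_
      · by_contra hcon
        push Not at hcon
        nlinarith
      · by_contra hcon
        push Not at hcon
        nlinarith

theorem cornerMass_pos {b θ : ℝ} (hb : b < 1) (hθ : 0 ≤ θ) : 0 < cornerMass b θ := by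
  have := Real.pi_pos
  have : 0 ≤ θ / (2 * Real.pi) := by positivity
  unfold cornerMass
  linarith

theorem halfAngle_pos {m : ℕ} (hm : 0 < m) {θ : ℝ} (hθ : θ < Real.pi / 2) : 0 < halfAngle m θ := by
  have : (0 : ℝ) < m := Nat.cast_pos.2 hm
  have : 0 < Real.pi - 2 * θ := by linarith
  unfold halfAngle
  positivity

theorem continuousOn_partitionCost (k : ℕ) {m : ℕ} (hm : 0 < m) :
    ContinuousOn (fun z : ℝ × ℝ => partitionCost k m z.1 z.2)
      {z | z.1 < 1 ∧ 0 ≤ z.2 ∧ z.2 < Real.pi / 2} := by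
  have h1 : ContinuousOn (fun z : ℝ × ℝ => cornerMass z.1 z.2)
      {z | z.1 < 1 ∧ 0 ≤ z.2 ∧ z.2 < Real.pi / 2} := by
    unfold cornerMass; fun_prop
  have h2 : ContinuousOn (fun z : ℝ × ℝ => halfAngle m z.2)
      {z | z.1 < 1 ∧ 0 ≤ z.2 ∧ z.2 < Real.pi / 2} := by
    unfold halfAngle; fun_prop
  have h3 : ∀ z ∈ {z : ℝ × ℝ | z.1 < 1 ∧ 0 ≤ z.2 ∧ z.2 < Real.pi / 2}, cornerMass z.1 z.2 ≠ 0 :=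
    fun z hz => (cornerMass_pos hz.1 hz.2.1).ne'
  have h4 : ∀ z ∈ {z : ℝ × ℝ | z.1 < 1 ∧ 0 ≤ z.2 ∧ z.2 < Real.pi / 2}, halfAngle m z.2 ≠ 0 :=
    fun z hz => (halfAngle_pos hm hz.2.2).ne'
  have h5 : ContinuousOn (fun z : ℝ × ℝ => Real.sin (halfAngle m z.2) ^ 2)
      {z | z.1 < 1 ∧ 0 ≤ z.2 ∧ z.2 < Real.pi / 2} := (Real.continuous_sin.comp_continuousOn h2).pow 2
  unfold partitionCost
  refine (((ContinuousOn.sub (by fun_prop) (ContinuousOn.div (by fun_prop) h1 h3)).const_mul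
    _).add (by fun_prop)).add ((h2.sub (h5.div h2 h4)).const_mul _)

/-- A stationary point of the cost on a rectangle on whose boundary the gradient points
outwards. -/
theorem exists_stationary {k m : ℕ} (hm : 0 < m) {b0 b1 θ0 θ1 : ℝ} (hb : b0 < b1) (hb1 : b1 < 1)
    (hθ : θ0 < θ1) (hθ0 : 0 ≤ θ0) (hθ1 : θ1 < Real.pi / 2)
    (h1 : ∀ θ ∈ Set.Icc θ0 θ1, 0 < sqBase (cornerPoint b0 θ) b0 - (b0 / k) ^ 2)
    (h2 : ∀ θ ∈ Set.Icc θ0 θ1, 0 < (b1 / k) ^ 2 - sqBase (cornerPoint b1 θ) b1)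
    (h3 : ∀ b ∈ Set.Icc b0 b1, 0 < arcPrice (halfAngle m θ0) - sqArc (cornerPoint b θ0) θ0)
    (h4 : ∀ b ∈ Set.Icc b0 b1, 0 < sqArc (cornerPoint b θ1) θ1 - arcPrice (halfAngle m θ1)) :
    ∃ b ∈ Set.Icc b0 b1, ∃ θ ∈ Set.Icc θ0 θ1, sqBase (cornerPoint b θ) b = (b / k) ^ 2 ∧
      sqArc (cornerPoint b θ) θ = arcPrice (halfAngle m θ) := by
  have hpi := Real.pi_pos
  -- A minimum over the rectangle minimises along both coordinate lines through it, so the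
  -- one-variable criterion applies to each coordinate.
  obtain ⟨⟨b, θ⟩, ⟨hbm, hθm⟩, hmin⟩ := (isCompact_Icc.prod isCompact_Icc).exists_isMinOn
    (s := Set.Icc b0 b1 ×ˢ Set.Icc θ0 θ1) ⟨(b0, θ0), ⟨le_rfl, hb.le⟩, ⟨le_rfl, hθ.le⟩⟩
    ((continuousOn_partitionCost k hm).mono (fun z hz => ⟨hz.1.2.trans_lt hb1, hθ0.trans hz.2.1,
      hz.2.2.trans_lt hθ1⟩))
  have hM := cornerMass_pos (hbm.2.trans_lt hb1) (hθ0.trans hθm.1)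
  have m1 : IsMinOn (fun b => partitionCost k m b θ) (Set.Icc b0 b1) b :=
    isMinOn_iff.2 fun c hc => isMinOn_iff.1 hmin (c, θ) ⟨hc, hθm⟩
  have m2 : IsMinOn (fun θ => partitionCost k m b θ) (Set.Icc θ0 θ1) θ :=
    isMinOn_iff.2 fun c hc => isMinOn_iff.1 hmin (b, c) ⟨hbm, hc⟩
  have e1 := eq_zero_of_isMinOn hbm m1 hb (hasDerivAt_partitionCost_left k m hM)
    (fun e => by subst e; linarith [h1 θ hθm]) (fun e => by subst e; linarith [h2 θ hθm])
  have e2 := eq_zero_of_isMinOn hθm m2 hθ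
    (hasDerivAt_partitionCost_right k hm hM (hθm.2.trans_lt hθ1))
    (fun e => by
      subst e
      exact mul_neg_of_pos_of_neg (by positivity) (by linarith [h3 b hbm]))
    (fun e => by
      subst e
      exact mul_pos (by positivity) (by linarith [h4 b hbm]))
  refine ⟨b, hbm, θ, hθm, by linarith, ?_⟩
  have : (1 : ℝ) / Real.pi ≠ 0 := by positivity
  have := (mul_eq_zero.1 e2).resolve_left this
  linarith

/-- The variant without points on the base. -/
theorem exists_stationary_angle {m : ℕ} (hm : 0 < m) {b θ0 θ1 : ℝ} (hb1 : b < 1)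
    (hθ : θ0 < θ1) (hθ0 : 0 ≤ θ0) (hθ1 : θ1 < Real.pi / 2)
    (h3 : 0 < arcPrice (halfAngle m θ0) - sqArc (cornerPoint b θ0) θ0)
    (h4 : 0 < sqArc (cornerPoint b θ1) θ1 - arcPrice (halfAngle m θ1)) :
    ∃ θ ∈ Set.Icc θ0 θ1, sqArc (cornerPoint b θ) θ = arcPrice (halfAngle m θ) := by
  have hpi := Real.pi_pos
  have hc : ContinuousOn (fun θ => partitionCost 0 m b θ) (Set.Icc θ0 θ1) := fun θ hθm =>
    (hasDerivAt_partitionCost_right 0 hm (cornerMass_pos hb1 (hθ0.trans hθm.1))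
      (hθm.2.trans_lt hθ1)).continuousAt.continuousWithinAt
  obtain ⟨θ, hθm, hmin⟩ := isCompact_Icc.exists_isMinOn (Set.nonempty_Icc.2 hθ.le) hc
  have e2 := eq_zero_of_isMinOn hθm hmin hθ (hasDerivAt_partitionCost_right 0 hm
    (cornerMass_pos hb1 (hθ0.trans hθm.1)) (hθm.2.trans_lt hθ1))
    (fun e => by
      subst e
      exact mul_neg_of_pos_of_neg (by positivity) (by linarith))
    (fun e => by
      subst e
      exact mul_pos (by positivity) (by linarith))
  refine ⟨θ, hθm, ?_⟩
  have : (1 : ℝ) / Real.pi ≠ 0 := by positivity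
  have := (mul_eq_zero.1 e2).resolve_left this
  linarith

/-- The values of the variables `π`, `b` and `θ`. -/
noncomputable def edgeVal (b θ : ℝ) : ℕ → ℝ
  | 0 => Real.pi
  | 1 => b
  | 2 => θ
  | _ => 0

def edgeItv (I J : Itv) : ℕ → Itv
  | 0 => ⟨314159265358979323846, 314159265358979323847⟩
  | 1 => I
  | 2 => J
  | _ => ⟨0, 0⟩

theorem edge_mem {I J : Itv} {b θ : ℝ} (hb : I.Mem b) (hθ : J.Mem θ) (i : ℕ) :
    (edgeItv I J i).Mem (edgeVal b θ i) := by
  match i with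
  | 0 => exact pi_mem
  | 1 => exact hb
  | 2 => exact hθ
  | i + 3 => simp [edgeItv, edgeVal, Itv.Mem]

section

open Ex

def massEx : Ex := .const 1 4 * (nat 1 - var 1) + .const 1 2 * (var 2 * inv (var 0))

def cornerXEx : Ex :=
  (.const 1 8 * (nat 1 - sq (var 1)) + .const 1 2 * (sin (var 2) * inv (var 0))) * inv massEx

def cornerYEx : Ex := (.const 1 2 * ((nat 1 - cos (var 2)) * inv (var 0))) * inv massEx

def halfAngleEx (m : ℕ) : Ex := .const 1 (2 * m) * (var 0 - nat 2 * var 2)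

def baseGapEx (k : ℕ) : Ex := sq (var 1 - cornerXEx) + sq cornerYEx - sq (var 1 * .const 1 k)

def arcGapEx (m : ℕ) : Ex :=
  sq (cos (var 2) - cornerXEx) + sq (sin (var 2) - cornerYEx) - arcPriceEx (halfAngleEx m)

theorem eval_massEx (b θ : ℝ) : massEx.eval (edgeVal b θ) = cornerMass b θ := by
  simp only [massEx, eval_add, eval_sub, eval_mul, eval_inv, eval_var, eval_const, eval_nat,
    edgeVal, cornerMass]
  push_cast
  ring

theorem eval_cornerXEx (b θ : ℝ) : cornerXEx.eval (edgeVal b θ) = (cornerPoint b θ).1 := by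
  rw [cornerXEx, eval_mul, eval_inv, eval_massEx]
  simp only [eval_add, eval_sub, eval_mul, eval_inv, eval_var, eval_const, eval_nat, eval_sq,
    eval_sin, edgeVal, cornerPoint]
  push_cast
  ring

theorem eval_cornerYEx (b θ : ℝ) : cornerYEx.eval (edgeVal b θ) = (cornerPoint b θ).2 := by
  rw [cornerYEx, eval_mul, eval_inv, eval_massEx]
  simp only [eval_sub, eval_mul, eval_inv, eval_var, eval_const, eval_nat,
    eval_cos, edgeVal, cornerPoint]
  push_cast
  ring

theorem eval_halfAngleEx (m : ℕ) (b θ : ℝ) :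
    (halfAngleEx m).eval (edgeVal b θ) = halfAngle m θ := by
  simp only [halfAngleEx, eval_sub, eval_mul, eval_var, eval_const, eval_nat, edgeVal, halfAngle]
  push_cast
  ring

theorem eval_baseGapEx (k : ℕ) (b θ : ℝ) :
    (baseGapEx k).eval (edgeVal b θ) = sqBase (cornerPoint b θ) b - (b / k) ^ 2 := by
  simp only [baseGapEx, eval_add, eval_sub, eval_mul, eval_sq, eval_cornerXEx, eval_cornerYEx,
    eval_var, eval_const, edgeVal, sqBase]
  push_cast
  ring

theorem eval_arcGapEx (m : ℕ) (b θ : ℝ) : (arcGapEx m).eval (edgeVal b θ) =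
    sqArc (cornerPoint b θ) θ - arcPrice (halfAngle m θ) := by
  simp only [arcGapEx, eval_add, eval_sub, eval_sq, eval_cornerXEx, eval_cornerYEx, eval_sin,
    eval_cos, eval_arcPriceEx, eval_halfAngleEx, eval_var, edgeVal, sqArc]

end

/-- The interval of `4` pieces of length `w` that begins at `x`. -/
def piece (x w : ℤ) (i : ℕ) : Itv := ⟨x + i * w, x + (i + 1) * w⟩

theorem exists_piece {x w : ℤ} {z : ℝ} (hz : Itv.Mem z ⟨x, x + 4 * w⟩) :
    ∃ i < 4, (piece x w i).Mem z := by
  obtain ⟨h0, h4⟩ := hz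
  simp only at h0 h4
  push_cast at h0 h4
  simp only [piece, Itv.Mem]
  rcases le_total (z * prec) (x + 1 * w) with h | h
  · exact ⟨0, by norm_num, by push_cast; constructor <;> linarith⟩
  rcases le_total (z * prec) (x + 2 * w) with h' | h'
  · exact ⟨1, by norm_num, by push_cast; constructor <;> linarith⟩
  rcases le_total (z * prec) (x + 3 * w) with h'' | h''
  · exact ⟨2, by norm_num, by push_cast; constructor <;> linarith⟩
  · exact ⟨3, by norm_num, by push_cast; constructor <;> linarith⟩

/-- The verification of the signs on the boundary of the rectangle. -/
noncomputable def stationaryCheck (k m : ℕ) (x y w : ℤ) : Bool :=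
  -- Each side of the rectangle is cut into four pieces, and the sign of the normal derivative is
  -- enclosed on each of them.
  allBelow (fun i =>
    ((baseGapEx k).pos (edgeItv ⟨x, x⟩ (piece y w i)) &&
    (-baseGapEx k).pos (edgeItv ⟨x + 4 * w, x + 4 * w⟩ (piece y w i))) &&
    ((-arcGapEx m).pos (edgeItv (piece x w i) ⟨y, y⟩) &&
    (arcGapEx m).pos (edgeItv (piece x w i) ⟨y + 4 * w, y + 4 * w⟩))) 4

theorem itv_mem_div (a : ℤ) : Itv.Mem ((a : ℝ) / prec) ⟨a, a⟩ := Itv.mem_point a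

theorem mem_of_mem_Icc {a b : ℤ} {z : ℝ} (h : z ∈ Set.Icc ((a : ℝ) / prec) ((b : ℝ) / prec)) :
    Itv.Mem z ⟨a, b⟩ := ⟨(div_le_iff₀ prec_pos).1 h.1, (le_div_iff₀ prec_pos).1 h.2⟩

theorem exists_stationary_of_check {k m : ℕ} {x y w : ℤ} (hm : 0 < m) (hw : 0 < w)
    (hx : x + 4 * w < prec) (hy : 0 ≤ y) (hy1 : 2 * (y + 4 * w) < 3 * prec)
    (h : stationaryCheck k m x y w = true) :
    ∃ b θ : ℝ, Itv.Mem b ⟨x, x + 4 * w⟩ ∧ Itv.Mem θ ⟨y, y + 4 * w⟩ ∧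
      sqBase (cornerPoint b θ) b = (b / k) ^ 2 ∧
      sqArc (cornerPoint b θ) θ = arcPrice (halfAngle m θ) := by
  have hp := prec_pos
  simp only [stationaryCheck, allBelow_iff, Bool.and_eq_true] at h
  have hw' : (0 : ℝ) < w := by exact_mod_cast hw
  have hx' : (x : ℝ) + 4 * w < prec := by exact_mod_cast hx
  have hy' : (0 : ℝ) ≤ y := by exact_mod_cast hy
  have hy1' : 2 * ((y : ℝ) + 4 * w) < 3 * prec := by exact_mod_cast hy1
  have hpi := Real.pi_gt_three
  have e1 : (x : ℝ) / prec < ((x + 4 * w : ℤ) : ℝ) / prec := by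
    rw [div_lt_div_iff_of_pos_right hp]; push_cast; linarith
  have e2 : ((x + 4 * w : ℤ) : ℝ) / prec < 1 := by rw [div_lt_one hp]; push_cast; exact hx'
  have e3 : (y : ℝ) / prec < ((y + 4 * w : ℤ) : ℝ) / prec := by
    rw [div_lt_div_iff_of_pos_right hp]; push_cast; linarith
  have e4 : ((y + 4 * w : ℤ) : ℝ) / prec < Real.pi / 2 := by
    rw [div_lt_iff₀ hp]; push_cast; nlinarith
  suffices hs : ∃ b ∈ Set.Icc ((x : ℝ) / prec) (((x + 4 * w : ℤ) : ℝ) / prec),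
      ∃ θ ∈ Set.Icc ((y : ℝ) / prec) (((y + 4 * w : ℤ) : ℝ) / prec),
      sqBase (cornerPoint b θ) b = (b / k) ^ 2 ∧
      sqArc (cornerPoint b θ) θ = arcPrice (halfAngle m θ) by
    obtain ⟨b, hb, θ, hθ, h1, h2⟩ := hs
    exact ⟨b, θ, mem_of_mem_Icc hb, mem_of_mem_Icc hθ, h1, h2⟩
  refine exists_stationary hm e1 e2 e3 (by positivity) e4 ?_ ?_ ?_ ?_
  · intro θ hθ
    obtain ⟨i, hi, hm⟩ := exists_piece (mem_of_mem_Icc hθ)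
    have := Ex.eval_pos (edge_mem (itv_mem_div x) hm) (h i hi).1.1
    rwa [eval_baseGapEx] at this
  · intro θ hθ
    obtain ⟨i, hi, hm⟩ := exists_piece (mem_of_mem_Icc hθ)
    have := Ex.eval_pos (edge_mem (itv_mem_div (x + 4 * w)) hm) (h i hi).1.2
    rw [Ex.eval_neg, eval_baseGapEx] at this
    linarith
  · intro b hb
    obtain ⟨i, hi, hm⟩ := exists_piece (mem_of_mem_Icc hb)
    have := Ex.eval_pos (edge_mem hm (itv_mem_div y)) (h i hi).2.1
    rw [Ex.eval_neg, eval_arcGapEx] at this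
    linarith
  · intro b hb
    obtain ⟨i, hi, hm⟩ := exists_piece (mem_of_mem_Icc hb)
    have := Ex.eval_pos (edge_mem hm (itv_mem_div (y + 4 * w))) (h i hi).2.2
    rwa [eval_arcGapEx] at this

theorem exists_stationary_angle_of_check {m : ℕ} {y w : ℤ} (hm : 0 < m) (hw : 0 < w)
    (hy : 0 ≤ y) (hy1 : 2 * (y + 4 * w) < 3 * prec)
    (h : ((-arcGapEx m).pos (edgeItv ⟨0, 0⟩ ⟨y, y⟩) &&
      (arcGapEx m).pos (edgeItv ⟨0, 0⟩ ⟨y + 4 * w, y + 4 * w⟩)) = true) :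
    ∃ θ : ℝ, Itv.Mem θ ⟨y, y + 4 * w⟩ ∧
      sqArc (cornerPoint 0 θ) θ = arcPrice (halfAngle m θ) := by
  have hp := prec_pos
  simp only [Bool.and_eq_true] at h
  have hw' : (0 : ℝ) < w := by exact_mod_cast hw
  have hy' : (0 : ℝ) ≤ y := by exact_mod_cast hy
  have hy1' : 2 * ((y : ℝ) + 4 * w) < 3 * prec := by exact_mod_cast hy1
  have hpi := Real.pi_gt_three
  have h00 : Itv.Mem 0 ⟨0, 0⟩ := by simp [Itv.Mem]
  have e3 : (y : ℝ) / prec < ((y + 4 * w : ℤ) : ℝ) / prec := by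
    rw [div_lt_div_iff_of_pos_right hp]; push_cast; linarith
  have e4 : ((y + 4 * w : ℤ) : ℝ) / prec < Real.pi / 2 := by
    rw [div_lt_iff₀ hp]; push_cast; nlinarith
  suffices hs : ∃ θ ∈ Set.Icc ((y : ℝ) / prec) (((y + 4 * w : ℤ) : ℝ) / prec),
      sqArc (cornerPoint 0 θ) θ = arcPrice (halfAngle m θ) by
    obtain ⟨θ, hθ, h2⟩ := hs
    exact ⟨θ, mem_of_mem_Icc hθ, h2⟩
  refine exists_stationary_angle hm zero_lt_one e3 (by positivity) e4 ?_ ?_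
  · have := Ex.eval_pos (edge_mem h00 (itv_mem_div y)) h.1
    rw [Ex.eval_neg, eval_arcGapEx] at this
    linarith
  · have := Ex.eval_pos (edge_mem h00 (itv_mem_div (y + 4 * w))) h.2
    rwa [eval_arcGapEx] at this

end HalfDisc

/-! ### The centroid is the best point of the whole corner zone -/

namespace HalfDisc

/-- Data for the verification that the centroid of a corner part is the best point of the corner
zone: the numbers of points on the base and near the top, the zones, the rectangle near the
centroid in multiples of `1 / 64`, its division into boxes with their parameters, upper bounds of
the prices, the bound of the gain outside the rectangle, an upper bound of the distance to the arc
in multiples of `10⁻⁹`, and enclosures of the variables. -/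
structure Design where
  x : ℕ
  y : ℤ
  t : ℕ
  X0 : ℕ
  X1 : ℕ
  Y0 : ℕ
  Y1 : ℕ
  w : ℕ
  h : ℕ
  S : ℕ
  ts : List (ℕ × ℕ × ℕ)
  B : ℕ
  R : ℕ
  C : ℕ
  ρ : ℕ
  l : List Itv

namespace Design

variable (D : Design)

def cert : Cert := ⟨64, D.B, D.R, 0, 0, 0, 0⟩

section

open Ex

def basePriceEx : Ex := sq (var 5 - var 1) + sq (var 6)

def arcPriceEx : Ex := sq (var 3 - var 5) + sq (var 4 - var 6)

def cornerGainEx : Ex :=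
  let θ : Ex := .const 1 2 * (var 2 * inv (var 0))
  let b : Ex := .const 1 4 * (nat 1 - var 1)
  b * basePriceEx + θ * arcPriceEx - (.const 1 12 * (nat 1 - var 1 * sq (var 1)) + θ -
    (b + θ) * (sq (var 5) + sq (var 6)))

/-- The comparison of the values at the centroid with the rational bounds. -/
def priceCheck : Bool :=
  let ι := cornerItv D.l ⟨0, 0⟩ ⟨0, 0⟩
  (.const D.B scale - basePriceEx).pos ι && ((.const D.R scale - arcPriceEx).pos ι &&
    (cornerGainEx - .const D.C (384 * scale * 4096)).pos ι)

end

/-- The verification of the bound of the gain outside the rectangle. -/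
noncomputable def outerCheck : Bool :=
  let T := min (2 * D.t) 64
  D.cert.bounds D.C ⟨D.X1, 64 - D.X1, 0, T⟩ &&
  (D.cert.bounds D.C ⟨2 * D.x, D.X0 - 2 * D.x, 0, T⟩ &&
  (D.cert.bounds D.C ⟨D.X0, D.X1 - D.X0, D.Y1, T - D.Y1⟩ &&
  ((decide (D.Y0 = 0) || D.cert.bounds D.C ⟨D.X0, D.X1 - D.X0, 0, D.Y0⟩) &&
  (decide (D.x = 0) || D.cert.bounds D.C ⟨0, 2 * D.x, 2 * D.y.toNat, T - 2 * D.y.toNat⟩))))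

def sizeCheck : Bool :=
  decide (2 * D.x < D.X0) && (decide (D.X0 < D.X1) && (decide (D.X1 < 64) &&
  (decide (D.Y0 < D.Y1) && (decide (D.Y1 < min (2 * D.t) 64) && (decide (0 < D.w) &&
  (decide (0 < D.h) && (decide (0 < D.S) && (decide (D.S * D.w = 4 * (D.X1 - D.X0)) &&
  (decide (D.S * D.h = 4 * (D.Y1 - D.Y0)) && (decide (D.x = 0 ∨ D.t ≤ 32) &&
  decide (D.y < D.t)))))))))))

variable {D}

/-- The right zone without the central rectangle is covered by at most five rectangles: beyond it,
between the base zone and it, above it, below it, and the strip over the base zone. The mesh is `1 /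
64`, hence the factors `2` in front of zone parameters and `4096 = 64²`. -/
theorem gain_le_of_outerCheck (h : D.outerCheck = true) (hs : D.sizeCheck = true) {q : ℝ × ℝ}
    (hq : InHalfDisc q) (hz : (zones D.x D.y D.t).of q = .right)
    (hout : ¬ ((D.X0 : ℝ) ≤ 64 * q.1 ∧ 64 * q.1 ≤ D.X1 ∧ (D.Y0 : ℝ) ≤ 64 * q.2 ∧
      64 * q.2 ≤ D.Y1)) :
    gain (fun _ => (D.B : ℝ) / scale) (fun _ => (D.R : ℝ) / scale) q ≤
      D.C / (384 * scale * 4096) := by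
  simp only [outerCheck, Bool.and_eq_true, Bool.or_eq_true, decide_eq_true_eq] at h
  simp only [sizeCheck, Bool.and_eq_true, decide_eq_true_eq] at hs
  obtain ⟨r1, r2, r3, r4, r5⟩ := h
  obtain ⟨s1, s2, s3, s4, s5, s6, s7, s8, s9, s10, s11, s12⟩ := hs
  have hqb := mem_bounds_of_inHalfDisc hq
  have hz' : q.2 < D.t / 32 ∧ ¬ (|q.1| ≤ D.x / 32 ∧ q.2 ≤ D.y / 32) ∧ 0 ≤ q.1 := by
    unfold Zones.of at hz
    split_ifs at hz with h1 h2 h3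
    exact ⟨not_le.1 h1, h2, h3⟩
  obtain ⟨hz1, hz2, hz3⟩ := hz'
  rw [abs_of_nonneg hz3] at hz2
  have hScale : ((pieces * pieces * unit : ℕ) : ℝ) = scale := by norm_num [pieces, unit, scale]
  have hG : D.cert.G = 64 := rfl
  have main : ∀ r : Rect, D.cert.bounds D.C r = true → r.Mem 64 q →
      gain (fun _ => (D.B : ℝ) / scale) (fun _ => (D.R : ℝ) / scale) q ≤
        D.C / (384 * scale * 4096) := by
    intro r hr hm
    have := D.cert.gain_le D.C r hr hq.2 hm
    have e1 : D.cert.gB pieces unit = fun _ => (D.B : ℝ) / scale := by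
      funext t
      simp [Cert.gB, hScale, cert]
    have e2 : D.cert.gA pieces unit = fun _ => (D.R : ℝ) / scale := by
      funext t
      simp [Cert.gA, hScale, cert]
    rw [e1, e2, hG] at this
    refine this.trans (le_of_eq ?_)
    norm_num
  have hT : 64 * q.2 ≤ ((min (2 * D.t) 64 : ℕ) : ℝ) := by
    push_cast
    exact le_min (by linarith) (by linarith)
  have e1 : ((64 - D.X1 : ℕ) : ℝ) = 64 - D.X1 := by rw [Nat.cast_sub s3.le]; norm_num
  have e2 : ((D.X0 - 2 * D.x : ℕ) : ℝ) = D.X0 - 2 * D.x := by rw [Nat.cast_sub s1.le]; norm_num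
  have e3 : ((D.X1 - D.X0 : ℕ) : ℝ) = D.X1 - D.X0 := by rw [Nat.cast_sub s2.le]
  have e4 : ((min (2 * D.t) 64 - D.Y1 : ℕ) : ℝ) = (min (2 * D.t) 64 : ℕ) - D.Y1 := by
    rw [Nat.cast_sub s5.le]
  rcases le_or_gt (D.X1 : ℝ) (64 * q.1) with h1 | h1
  · refine main _ r1 ⟨h1, ?_, ?_, ?_⟩ <;> simp only [e1] <;> push_cast at hT ⊢ <;> linarith
  rcases le_or_gt (D.X0 : ℝ) (64 * q.1) with h2 | h2
  · rcases le_or_gt (D.Y1 : ℝ) (64 * q.2) with h3 | h3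
    · refine main _ r3 ⟨h2, ?_, h3, ?_⟩ <;> simp only [e3, e4, Nat.cast_ofNat] <;> linarith
    · have h4 : 64 * q.2 < D.Y0 := by
        by_contra hcon
        exact hout ⟨h2, h1.le, not_lt.1 hcon, h3.le⟩
      have h5 : D.Y0 ≠ 0 := by
        intro h0
        rw [h0] at h4
        push_cast at h4
        linarith
      refine main _ (r4.resolve_left h5) ⟨h2, ?_, ?_, ?_⟩ <;> simp only [e3] <;> push_cast <;>
        linarith
  rcases le_or_gt (2 * D.x : ℝ) (64 * q.1) with h3 | h3
  · refine main _ r2 ⟨?_, ?_, ?_, ?_⟩ <;> simp only [e2] <;> push_cast at hT ⊢ <;> linarith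
  · have hx0 : D.x ≠ 0 := by
      intro h0
      rw [h0] at h3
      push_cast at h3
      linarith
    have hy : (D.y : ℝ) / 32 < q.2 := by
      by_contra hcon
      exact hz2 ⟨by linarith, not_lt.1 hcon⟩
    have ht : D.t ≤ 32 := s11.resolve_left hx0
    have e5 : ((D.y.toNat : ℕ) : ℝ) = max (D.y : ℝ) 0 := by
      have := Int.toNat_eq_max D.y
      exact_mod_cast this
    have e6 : ((min (2 * D.t) 64 - 2 * D.y.toNat : ℕ) : ℝ) =
        (min (2 * D.t) 64 : ℕ) - 2 * D.y.toNat := by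
      rw [Nat.cast_sub (by omega)]; norm_num
    have e7 : max (D.y : ℝ) 0 ≤ 32 * q.2 := max_le (by linarith) (by linarith)
    refine main _ (r5.resolve_left hx0) ⟨?_, ?_, ?_, ?_⟩ <;> simp only [e6] <;>
      push_cast [e5] at hT ⊢ <;> linarith

variable (D) in
/-- The complete verification. -/
noncomputable def check : Bool :=
  D.sizeCheck && (D.priceCheck && (D.outerCheck &&
    localCheck D.l (4 * D.X0) D.w (4 * D.Y0) D.h D.S D.ts))

variable {b θ : ℝ} {p : ℝ × ℝ}

/-- The true prices are known only by enclosure. The rational prices of the certificate are slightly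
larger, and the certified outer gain still lies strictly below the gain of the centroid. -/
theorem price_bounds (h : D.check = true) (hl : CornerMem D.l b θ p) :
    sqBase p b < D.B / scale ∧ sqArc p θ < D.R / scale ∧
      (D.C : ℝ) / (384 * scale * 4096) < cornerGain b θ (sqBase p b) (sqArc p θ) p := by
  simp only [check, priceCheck, Bool.and_eq_true] at h
  obtain ⟨-, ⟨h1, h2, h3⟩, -⟩ := h
  have hm := hl ⟨0, 0⟩ ⟨0, 0⟩ (0, 0) (by simp [Itv.Mem]) (by simp [Itv.Mem])
  have k1 := Ex.eval_pos hm h1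
  have k2 := Ex.eval_pos hm h2
  have k3 := Ex.eval_pos hm h3
  simp only [cornerGainEx, basePriceEx, arcPriceEx, Ex.eval_add, Ex.eval_sub, Ex.eval_mul,
    Ex.eval_sq, Ex.eval_inv, Ex.eval_var, Ex.eval_const, Ex.eval_nat, cornerVal] at k1 k2 k3
  push_cast at k1 k2 k3
  have e1 : sqBase p b = (p.1 - b) ^ 2 + p.2 ^ 2 := by simp only [sqBase]; ring
  refine ⟨by rw [e1]; linarith, by simp only [sqArc]; linarith, ?_⟩
  rw [e1]
  simp only [sqArc, cornerGain]
  have e2 : θ / (2 * Real.pi) = 1 / 2 * (θ * Real.pi⁻¹) := by ring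
  rw [e2]
  have e3 : (D.C : ℝ) / (384 * scale * 4096) < 1 / 4 * (1 - b) * ((p.1 - b) ^ 2 + p.2 ^ 2) +
      1 / 2 * (θ * Real.pi⁻¹) * ((Real.cos θ - p.1) ^ 2 + (Real.sin θ - p.2) ^ 2) -
      (1 / 12 * (1 - b * b ^ 2) + 1 / 2 * (θ * Real.pi⁻¹) -
        (1 / 4 * (1 - b) + 1 / 2 * (θ * Real.pi⁻¹)) * (p.1 ^ 2 + p.2 ^ 2)) := by
    linarith
  refine e3.trans_le (le_of_eq ?_)
  ring

/-- The centroid is the unique best point of the corner zone. -/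
theorem gain_le (h : D.check = true) (hl : CornerMem D.l b θ p) (hp : IsCentroid b θ p)
    (hb0 : -1 ≤ b) (hb1 : b ≤ 1) (hθ0 : 0 ≤ θ) (hθ1 : θ ≤ Real.pi / 2) {q : ℝ × ℝ}
    (hq : InHalfDisc q) (hz : (zones D.x D.y D.t).of q = .right) :
    gain (fun _ => sqBase p b) (fun _ => sqArc p θ) q ≤
        cornerGain b θ (sqBase p b) (sqArc p θ) p ∧
      (q ≠ p → gain (fun _ => sqBase p b) (fun _ => sqArc p θ) q <
        cornerGain b θ (sqBase p b) (sqArc p θ) p) := by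
  obtain ⟨h1, h2, h3⟩ := price_bounds h hl
  simp only [check, Bool.and_eq_true] at h
  obtain ⟨hs, -, ho, hloc⟩ := h
  by_cases hin : (D.X0 : ℝ) ≤ 64 * q.1 ∧ 64 * q.1 ≤ D.X1 ∧ (D.Y0 : ℝ) ≤ 64 * q.2 ∧
      64 * q.2 ≤ D.Y1
  · simp only [sizeCheck, Bool.and_eq_true, decide_eq_true_eq] at hs
    obtain ⟨s1, s2, s3, s4, s5, s6, s7, s8, s9, s10, s11, s12⟩ := hs
    have e9 : (D.S : ℝ) * D.w = 4 * (D.X1 - D.X0) := by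
      rw [← Nat.cast_sub s2.le]; exact_mod_cast s9
    have e10 : (D.S : ℝ) * D.h = 4 * (D.Y1 - D.Y0) := by
      rw [← Nat.cast_sub s4.le]; exact_mod_cast s10
    obtain ⟨i1, i2, i3, i4⟩ := hin
    refine gain_le_of_localCheck hl hp (by simp only [sqBase]; ring) rfl hb0 hb1 hθ0 hθ1 hq.1 s6 s7
      s8 hloc ?_ ?_ ?_ ?_ <;> push_cast <;> linarith
  · have k1 := gain_le_of_outerCheck ho hs hq hz hin
    -- Away from the centroid there is room to replace the true prices by the larger rational ones,
    -- since gains increase with the prices.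
    have k2 : gain (fun _ => sqBase p b) (fun _ => sqArc p θ) q ≤
        gain (fun _ => (D.B : ℝ) / scale) (fun _ => (D.R : ℝ) / scale) q :=
      gain_mono continuous_const continuous_const continuous_const continuous_const
        (fun t _ => by linarith) (fun t _ => by linarith)
    have k3 := (k2.trans k1).trans_lt h3
    exact ⟨k3.le, fun _ => k3⟩

/-- The conditions for the bounds of the gains in the zones near the top and near the base. -/
def zoneCheck (D : Design) (k m : ℕ) : Bool :=
  (decide (m = 0) || (decide (1024 * D.B ≤ scale * D.t ^ 2) && decide (D.R ≤ scale))) &&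
  (decide (k = 0) || decide (10 ^ 18 * D.R ≤ scale * D.ρ ^ 2 ∧ D.ρ ≤ 10 ^ 9 ∧
    (D.x ^ 2 + D.y ^ 2) * 10 ^ 18 ≤ 1024 * (10 ^ 9 - (D.ρ : ℤ)) ^ 2))

end Design

end HalfDisc

/-! ### The lower bound: the partition cost is a dual value -/

namespace HalfDisc

/-- For each cell, cost equals price times mass minus the saving of its centroid. Stationarity
identifies the prices of the base and arc cells with those at the boundary of the corner cell, so
the identities for all cells can be added. When `k = 0` or `m = 0` the corresponding cells are
absent and the conditions `b = 0` or `θ = π / 2` make the formula consistent. -/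
theorem partitionCost_eq {k m : ℕ} {b θ : ℝ} (hM : 0 < cornerMass b θ)
    (hk : k = 0 → b = 0) (hk' : k ≠ 0 → sqBase (cornerPoint b θ) b = (b / k) ^ 2)
    (hm : m = 0 → θ = Real.pi / 2)
    (hm' : m ≠ 0 → sqArc (cornerPoint b θ) θ = arcPrice (halfAngle m θ) ∧ θ < Real.pi / 2) :
    partitionCost k m b θ = 1 / 2 * sqBase (cornerPoint b θ) b +
      1 / 2 * sqArc (cornerPoint b θ) θ - (m * arcGain (halfAngle m θ) + k * ((b / k) ^ 3 / 3) +
      2 * cornerGain b θ (sqBase (cornerPoint b θ) b) (sqArc (cornerPoint b θ) θ)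
        (cornerPoint b θ)) := by
  have hpi := Real.pi_ne_zero
  have e0 : (((1 - b ^ 2) / 8 + Real.sin θ / (2 * Real.pi)) ^ 2 +
      ((1 - Real.cos θ) / (2 * Real.pi)) ^ 2) / cornerMass b θ =
      cornerMass b θ * ((cornerPoint b θ).1 ^ 2 + (cornerPoint b θ).2 ^ 2) := by
    have := hM.ne'
    simp only [cornerPoint]
    field_simp
  have e1 : b ^ 3 / (6 * (k : ℝ) ^ 2) = b / 2 * sqBase (cornerPoint b θ) b - k * ((b / k) ^ 3 / 3) := by
    rcases Nat.eq_zero_or_pos k with h | h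
    · rw [hk h, h]; simp
    · have h' : (k : ℝ) ≠ 0 := Nat.cast_ne_zero.2 h.ne'
      rw [hk' h.ne']
      field_simp
      ring
  have e2 : m / Real.pi * (halfAngle m θ - Real.sin (halfAngle m θ) ^ 2 / halfAngle m θ) =
      (1 / 2 - θ / Real.pi) * sqArc (cornerPoint b θ) θ - m * arcGain (halfAngle m θ) := by
    rcases Nat.eq_zero_or_pos m with h | h
    · rw [hm h, h]
      have : (1 : ℝ) / 2 - Real.pi / 2 / Real.pi = 0 := by field_simp; ring
      rw [this]; simp
    · obtain ⟨h1, h2⟩ := hm' h.ne'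
      have h3 := (halfAngle_pos h h2).ne'
      have h4 : (1 : ℝ) / 2 - θ / Real.pi = m * halfAngle m θ / Real.pi := by
        have h' : (m : ℝ) ≠ 0 := Nat.cast_ne_zero.2 h.ne'
        unfold halfAngle
        field_simp
      rw [h1, h4]
      generalize halfAngle m θ = z at *
      simp only [arcPrice, arcGain]
      field_simp
      ring
  rw [partitionCost, e0, e1, e2]
  simp only [cornerGain]
  change _ = _ - (_ + 2 * (_ - (_ - cornerMass b θ * _)))
  have e3 : ∀ z : ℝ, θ / (2 * Real.pi) * z = θ / Real.pi * z / 2 := fun z => by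
    field_simp
  rw [e3]
  ring

namespace Design

variable {D : Design} {b θ : ℝ} {k m n : ℕ}

/-- Duality with the constant prices read off at `b` and `θ`: a point of any zone gains at most as
much as the partition point of that zone. With the counts `(m, k, 1, 1)` the bound is exactly the
dual value in `partitionCost_eq`. -/
theorem partitionCost_le_cost [NeZero n] (h : D.check = true) (hzc : D.zoneCheck k m = true)
    (hl : CornerMem D.l b θ (cornerPoint b θ)) (hb0 : 0 ≤ b) (hb1 : b < 1) (hθ0 : 0 ≤ θ)
    (hθ1 : θ ≤ Real.pi / 2)
    (hk : k = 0 → b = 0) (hk' : k ≠ 0 → sqBase (cornerPoint b θ) b = (b / k) ^ 2)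
    (hm : m = 0 → θ = Real.pi / 2)
    (hm' : m ≠ 0 → sqArc (cornerPoint b θ) θ = arcPrice (halfAngle m θ) ∧ θ < Real.pi / 2)
    {P : Fin n → ℝ × ℝ} (hP : ∀ i, InHalfDisc (P i))
    (hc : (zones D.x D.y D.t).count P .top = m ∧ (zones D.x D.y D.t).count P .base = k ∧
      (zones D.x D.y D.t).count P .right = 1 ∧ (zones D.x D.y D.t).count P .left = 1) :
    partitionCost k m b θ ≤ cost P := by
  have hM := cornerMass_pos hb1 hθ0
  have hcen := isCentroid_cornerPoint hM
  obtain ⟨p1, p2, -⟩ := price_bounds h hl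
  have hS : (0 : ℝ) < scale := by norm_num [scale]
  obtain ⟨c1, c2, c3, c4⟩ := hc
  -- A zone of count zero contains no point of the family, so no gain bound is needed there when `k`
  -- or `m` vanishes.
  have hcount : ∀ z, (zones D.x D.y D.t).count P z = 0 → ∀ q, (∃ i, P i = q) →
      (zones D.x D.y D.t).of q ≠ z := by
    rintro z h0 q ⟨i, rfl⟩ hz
    exact Finset.card_ne_zero_of_mem (Finset.mem_filter.2 ⟨Finset.mem_univ i, hz⟩) h0
  simp only [zoneCheck, Bool.and_eq_true, Bool.or_eq_true, decide_eq_true_eq] at hzc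
  set p := cornerPoint b θ with hp
  have hd := dual_bound P (fun _ => sqBase p b) (fun _ => sqArc p θ) continuous_const
    continuous_const
  set v : Zone → ℝ := fun z => match z with
    | Zone.top => arcGain (halfAngle m θ) | Zone.base => (b / k) ^ 3 / 3
    | Zone.right => cornerGain b θ (sqBase p b) (sqArc p θ) p
    | Zone.left => cornerGain b θ (sqBase p b) (sqArc p θ) p with hv
  have hsum : ∑ i, gain (fun _ => sqBase p b) (fun _ => sqArc p θ) (P i) ≤
      ∑ i, v ((zones D.x D.y D.t).of (P i)) := by
    refine Finset.sum_le_sum fun i _ => ?_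
    rcases hz : (zones D.x D.y D.t).of (P i) with _ | _ | _ | _
    · have hm0 : m ≠ 0 := fun h0 => hcount _ (c1.trans h0) _ ⟨i, rfl⟩ hz
      obtain ⟨q1, q2⟩ := hzc.1.resolve_left hm0
      obtain ⟨m1, m2⟩ := hm' hm0
      have q1' : 1024 * (D.B : ℝ) ≤ scale * D.t ^ 2 := by exact_mod_cast q1
      have q2' : (D.R : ℝ) ≤ scale := by exact_mod_cast q2
      have hT : (D.t : ℝ) / 32 ≤ (P i).2 := by
        unfold Zones.of at hz
        split_ifs at hz with h1
        exact h1
      have hpos : 0 < halfAngle m θ := halfAngle_pos (Nat.pos_of_ne_zero hm0) m2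
      have hle : halfAngle m θ ≤ Real.pi / 2 := by
        have : (1 : ℝ) ≤ m := by exact_mod_cast Nat.one_le_iff_ne_zero.2 hm0
        have hpi := Real.pi_pos
        unfold halfAngle
        rw [div_le_iff₀ (by positivity)]
        nlinarith
      refine gain_le_of_far_from_base (R := sqArc p θ) (hP i).1 continuous_const
        (p2.le.trans ((div_le_one hS).2 q2')) hpos hle m1.le (fun t _ => p1.le.trans ?_)
        (fun t _ => le_rfl)
      rw [div_le_iff₀ hS]
      have : ((D.t : ℝ) / 32) ^ 2 ≤ (P i).2 ^ 2 := pow_le_pow_left₀ (by positivity) hT 2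
      nlinarith
    · have hk0 : k ≠ 0 := fun h0 => hcount _ (c2.trans h0) _ ⟨i, rfl⟩ hz
      obtain ⟨h1, h2, h3⟩ := hzc.2.resolve_left hk0
      have h1' : 10 ^ 18 * (D.R : ℝ) ≤ scale * D.ρ ^ 2 := by exact_mod_cast h1
      have h2' : (D.ρ : ℝ) ≤ 10 ^ 9 := by exact_mod_cast h2
      have h3' : ((D.x : ℝ) ^ 2 + D.y ^ 2) * 10 ^ 18 ≤ 1024 * (10 ^ 9 - D.ρ) ^ 2 := by
        exact_mod_cast h3
      have hB : |(P i).1| ≤ D.x / 32 ∧ (P i).2 ≤ D.y / 32 := by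
        unfold Zones.of at hz
        split_ifs at hz with h1 h2
        exact h2
      have h4 : (P i).1 ^ 2 + (P i).2 ^ 2 ≤ (1 - D.ρ / 10 ^ 9 : ℝ) ^ 2 := by
        have a1 : (P i).1 ^ 2 ≤ (D.x / 32 : ℝ) ^ 2 := by
          rw [← sq_abs]; exact pow_le_pow_left₀ (abs_nonneg _) hB.1 2
        have a2 : (P i).2 ^ 2 ≤ (D.y / 32 : ℝ) ^ 2 := pow_le_pow_left₀ (hP i).1 hB.2 2
        have : (1 - D.ρ / 10 ^ 9 : ℝ) ^ 2 = (10 ^ 9 - D.ρ) ^ 2 / 10 ^ 18 := by field_simp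
        rw [this, le_div_iff₀ (by positivity)]
        nlinarith
      refine gain_le_of_far_from_arc (β := b / k) (by positivity) continuous_const
        (fun t _ => (hk' hk0).le) (fun s _ => ?_)
      refine p2.le.trans (le_trans ?_ (le_sqArc_of_norm_le (by positivity)
        ((div_le_one (by norm_num)).2 h2') h4 s))
      rw [div_le_iff₀ hS, div_pow, div_mul_eq_mul_div, le_div_iff₀ (by positivity)]
      linarith
    · exact (gain_le h hl hcen (by linarith) hb1.le hθ0 hθ1 (hP i) hz).1
    · have hd : InHalfDisc (-(P i).1, (P i).2) := by
        have := hP i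
        simpa [InHalfDisc] using this
      have := (gain_le h hl hcen (by linarith) hb1.le hθ0 hθ1 hd (Zones.of_mirror _ hz)).1
      rwa [gain_mirror] at this
  rw [Zones.sum_of, c1, c2, c3, c4] at hsum
  rw [intervalIntegral.integral_const, intervalIntegral.integral_const] at hd
  rw [partitionCost_eq hM hk hk' hm hm']
  have hpi := Real.pi_ne_zero
  have e : 1 / (2 * Real.pi) * (Real.pi - 0) • sqArc p θ = 1 / 2 * sqArc p θ := by
    rw [smul_eq_mul]; field_simp; ring
  rw [e, smul_eq_mul] at hd
  simp only [hv] at hsum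
  push_cast at hsum
  linarith

end Design

end HalfDisc

/-! ### The upper bound: the centroids realise the partition cost -/

namespace HalfDisc

/-- An integral over an interval that is divided into equal parts. -/
theorem integral_le_of_parts {f : ℝ → ℝ} (hf : Continuous f) (x w c : ℝ) (k : ℕ)
    (h : ∀ j < k, ∫ t in (x + j * w)..(x + (j + 1) * w), f t ≤ c) :
    ∫ t in x..(x + k * w), f t ≤ k * c := by
  have := intervalIntegral.sum_integral_adjacent_intervals (f := f) (μ := volume)
    (a := fun j : ℕ => x + j * w) (n := k) fun j _ => hf.intervalIntegrable _ _
  simp only [Nat.cast_zero, zero_mul, add_zero] at this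
  rw [← this]
  refine (Finset.sum_le_sum fun j hj => ?_).trans_eq (b := ∑ j ∈ Finset.range k, c) (by simp)
  push_cast
  exact h j (Finset.mem_range.1 hj)

theorem integral_sqBase_midpoint (x w : ℝ) :
    ∫ t in x..(x + 2 * w), sqBase (x + w, 0) t = 2 * w ^ 3 / 3 := by
  rw [integral_sqBase]
  ring

theorem integral_sqArc_centroid {φ h : ℝ} (hh : h ≠ 0) :
    ∫ t in (φ - h)..(φ + h), sqArc (Real.sin h / h * Real.cos φ, Real.sin h / h * Real.sin φ) t =
      2 * (h - Real.sin h ^ 2 / h) := by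
  rw [integral_sqArc, Real.sin_add, Real.sin_sub, Real.cos_add, Real.cos_sub]
  have e := Real.sin_sq_add_cos_sq φ
  field_simp
  linear_combination (-2 * h * Real.sin h ^ 2) * e

/-- The cost of a set of points that contains the centroids of the partition. -/
theorem cost_le_partitionCost {ι : Type*} [Fintype ι] [Nonempty ι] {P : ι → ℝ × ℝ} {k m : ℕ}
    {b θ : ℝ} (hb0 : 0 ≤ b) (hb1 : b < 1) (hθ0 : 0 ≤ θ)
    (hk : k = 0 → b = 0) (hm : m = 0 → θ = Real.pi / 2) (hm' : m ≠ 0 → θ < Real.pi / 2)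
    (hr : ∃ i, P i = cornerPoint b θ) (hl : ∃ i, P i = (-(cornerPoint b θ).1, (cornerPoint b θ).2))
    (hbase : ∀ j < k, ∃ i, P i = (-b + (2 * j + 1) * (b / k), 0))
    (harc : ∀ j < m, ∃ i, P i = (Real.sin (halfAngle m θ) / halfAngle m θ *
      Real.cos (θ + (2 * j + 1) * halfAngle m θ), Real.sin (halfAngle m θ) / halfAngle m θ *
      Real.sin (θ + (2 * j + 1) * halfAngle m θ))) :
    cost P ≤ partitionCost k m b θ := by
  have hM := cornerMass_pos hb1 hθ0
  have hpi := Real.pi_pos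
  obtain ⟨c1, c2⟩ := isCentroid_cornerPoint hM
  set f : ℝ → ℝ := fun t => Finset.univ.inf' Finset.univ_nonempty fun i => sqBase (P i) t with hf
  set g : ℝ → ℝ := fun t => Finset.univ.inf' Finset.univ_nonempty fun i => sqArc (P i) t with hg
  have cf : Continuous f := Continuous.finset_inf'_apply _ fun i _ => continuous_sqBase _
  have cg : Continuous g := Continuous.finset_inf'_apply _ fun i _ => continuous_sqArc _
  -- On each cell the nearest point is at least as good as the point assigned to the cell; no
  -- knowledge of Voronoi cells is needed.
  have hf' : ∀ q, (∃ i, P i = q) → ∀ x y, x ≤ y → ∫ t in x..y, f t ≤ ∫ t in x..y, sqBase q t := by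
    rintro q ⟨i, rfl⟩ x y hxy
    exact intervalIntegral.integral_mono_on hxy (cf.intervalIntegrable _ _)
      ((continuous_sqBase _).intervalIntegrable _ _)
      fun t _ => Finset.inf'_le (fun i => sqBase (P i) t) (Finset.mem_univ i)
  have hg' : ∀ q, (∃ i, P i = q) → ∀ x y, x ≤ y → ∫ t in x..y, g t ≤ ∫ t in x..y, sqArc q t := by
    rintro q ⟨i, rfl⟩ x y hxy
    exact intervalIntegral.integral_mono_on hxy (cg.intervalIntegrable _ _)
      ((continuous_sqArc _).intervalIntegrable _ _)
      fun t _ => Finset.inf'_le (fun i => sqArc (P i) t) (Finset.mem_univ i)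
  have hbk : -b + k * (2 * (b / k)) = b := by
    rcases Nat.eq_zero_or_pos k with h | h
    · rw [hk h, h]; simp
    · have h' : (k : ℝ) ≠ 0 := Nat.cast_ne_zero.2 h.ne'
      field_simp
      ring
  have hθm : θ + m * (2 * halfAngle m θ) = Real.pi - θ := by
    rcases Nat.eq_zero_or_pos m with h | h
    · rw [hm h, h]; simp; ring
    · have h' : (m : ℝ) ≠ 0 := Nat.cast_ne_zero.2 h.ne'
      unfold halfAngle
      field_simp
      ring
  have b1 : ∫ t in (-b)..b, f t ≤ k * (2 * (b / k) ^ 3 / 3) := by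
    have := integral_le_of_parts cf (-b) (2 * (b / k)) (2 * (b / k) ^ 3 / 3) k fun j hj => by
      have hn : 0 ≤ b / k := by positivity
      refine (hf' _ (hbase j hj) _ _ (by nlinarith)).trans (le_of_eq ?_)
      have := integral_sqBase_midpoint (-b + j * (2 * (b / k))) (b / k)
      rw [← this]
      congr 1
      · funext t; congr 2; ring
      · ring
    rwa [hbk] at this
  have a1 : ∫ t in θ..(Real.pi - θ), g t ≤ m * (2 * (halfAngle m θ -
      Real.sin (halfAngle m θ) ^ 2 / halfAngle m θ)) := by
    have := integral_le_of_parts cg θ (2 * halfAngle m θ) (2 * (halfAngle m θ -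
      Real.sin (halfAngle m θ) ^ 2 / halfAngle m θ)) m fun j hj => by
      have hn : 0 < halfAngle m θ := halfAngle_pos (by omega) (hm' (by omega))
      refine (hg' _ (harc j hj) _ _ (by nlinarith)).trans (le_of_eq ?_)
      rw [← integral_sqArc_centroid (φ := θ + (2 * j + 1) * halfAngle m θ) hn.ne']
      congr 1 <;> ring
    rwa [hθm] at this
  have b2 := hf' _ hr b 1 hb1.le
  have b3 := hf' _ hl (-1) (-b) (by linarith)
  have a2 := hg' _ hr 0 θ hθ0
  have a3 := hg' _ hl (Real.pi - θ) Real.pi (by linarith)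
  have sb : ∫ t in (-1 : ℝ)..1, f t =
      (∫ t in (-1 : ℝ)..(-b), f t) + (∫ t in (-b)..b, f t) + ∫ t in b..1, f t := by
    rw [intervalIntegral.integral_add_adjacent_intervals,
      intervalIntegral.integral_add_adjacent_intervals] <;> exact cf.intervalIntegrable _ _
  have sa : ∫ t in (0 : ℝ)..Real.pi, g t = (∫ t in (0 : ℝ)..θ, g t) +
      (∫ t in θ..(Real.pi - θ), g t) + ∫ t in (Real.pi - θ)..Real.pi, g t := by
    rw [intervalIntegral.integral_add_adjacent_intervals,
      intervalIntegral.integral_add_adjacent_intervals] <;> exact cg.intervalIntegrable _ _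
  rw [integral_sqBase] at b2 b3
  rw [integral_sqArc] at a2 a3
  rw [Real.sin_pi_sub, Real.cos_pi_sub, Real.sin_pi, Real.cos_pi] at a3
  rw [Real.sin_zero, Real.cos_zero] at a2
  have hcost : cost P = 1 / 4 * (∫ t in (-1 : ℝ)..1, f t) +
      1 / (2 * Real.pi) * ∫ t in (0 : ℝ)..Real.pi, g t := rfl
  have e0 : (((1 - b ^ 2) / 8 + Real.sin θ / (2 * Real.pi)) ^ 2 +
      ((1 - Real.cos θ) / (2 * Real.pi)) ^ 2) / cornerMass b θ =
      cornerMass b θ * ((cornerPoint b θ).1 ^ 2 + (cornerPoint b θ).2 ^ 2) := by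
    have := hM.ne'
    simp only [cornerPoint]
    field_simp
  have e1 : b ^ 3 / (6 * (k : ℝ) ^ 2) = 1 / 4 * (k * (2 * (b / k) ^ 3 / 3)) := by
    rcases Nat.eq_zero_or_pos k with h | h
    · rw [hk h, h]; simp
    · have h' : (k : ℝ) ≠ 0 := Nat.cast_ne_zero.2 h.ne'
      field_simp
      ring
  rw [hcost, sb, sa, partitionCost, e0, e1]
  have u : 0 ≤ 1 / (2 * Real.pi) := by positivity
  have v1 := mul_le_mul_of_nonneg_left a1 u
  have v2 := mul_le_mul_of_nonneg_left a2 u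
  have v3 := mul_le_mul_of_nonneg_left a3 u
  have e2 : 1 / (2 * Real.pi) * (m * (2 * (halfAngle m θ -
      Real.sin (halfAngle m θ) ^ 2 / halfAngle m θ))) = m / Real.pi * (halfAngle m θ -
      Real.sin (halfAngle m θ) ^ 2 / halfAngle m θ) := by field_simp
  rw [e2] at v1
  set p := cornerPoint b θ
  -- The four integrals over the two corner cells. The centroid equations replace the terms linear
  -- in `p` by multiples of the mass times `|p|²`.
  have key : 1 / 4 * ((1 ^ 3 - b ^ 3) / 3 - p.1 * (1 ^ 2 - b ^ 2) + (p.1 ^ 2 + p.2 ^ 2) * (1 - b)) +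
      1 / 4 * (((-b) ^ 3 - (-1) ^ 3) / 3 - -p.1 * ((-b) ^ 2 - (-1) ^ 2) +
        ((-p.1) ^ 2 + p.2 ^ 2) * (-b - -1)) +
      1 / (2 * Real.pi) * ((1 + p.1 ^ 2 + p.2 ^ 2) * (θ - 0) - 2 * p.1 * (Real.sin θ - 0) +
        2 * p.2 * (Real.cos θ - 1)) +
      1 / (2 * Real.pi) * ((1 + (-p.1) ^ 2 + p.2 ^ 2) * (Real.pi - (Real.pi - θ)) -
        2 * -p.1 * (0 - Real.sin θ) + 2 * p.2 * (-1 - -Real.cos θ)) =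
      2 * ((1 - b ^ 3) / 12 + θ / (2 * Real.pi) - cornerMass b θ * (p.1 ^ 2 + p.2 ^ 2)) := by
    unfold cornerMass
    linear_combination (4 * p.1) * c1 + (4 * p.2) * c2
  linarith

end HalfDisc

/-! ### From families to sets of means, and from enclosures to decimals -/

namespace HalfDisc

theorem distortion_anti {α β : Set (EuclideanSpace ℝ (Fin 2))} (h : α ⊆ β) :
    distortion semicircleMixed β ≤ distortion semicircleMixed α :=
  lintegral_mono fun _ => biInf_mono fun _ ha => h ha

/-- Unused indices receive an arbitrary value, so the empty set is covered as well. Only inclusion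
is asserted, because additional points can only lower the distortion. -/
theorem exists_range_of_encard_le {n : ℕ} {α : Set (EuclideanSpace ℝ (Fin 2))}
    (h : α.encard ≤ n) : ∃ P : Fin n → ℝ × ℝ, α ⊆ Set.range fun i => toPlane (P i) := by
  have hfin : α.Finite := Set.finite_of_encard_le_coe h
  have : Fintype α := hfin.fintype
  have hcard : Fintype.card α ≤ Fintype.card (Fin n) := by
    rw [Fintype.card_fin, ← Nat.card_eq_fintype_card, Nat.card_coe_set_eq]
    rw [hfin.encard_eq_coe] at h
    exact_mod_cast h
  obtain ⟨e⟩ := Function.Embedding.nonempty_of_card_le hcard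
  obtain ⟨g, hg⟩ := toPlane_surjective.hasRightInverse
  refine ⟨Function.extend e (fun a => g a) 0, fun a ha => ⟨e ⟨a, ha⟩, ?_⟩⟩
  simp only [e.injective.extend_apply]
  exact hg a

/-- A retraction of the points of a set to the half disc does not increase the cost. -/
theorem exists_inHalfDisc_of_encard_le {n : ℕ} [NeZero n] {P : Fin n → ℝ × ℝ}
    {α : Set (EuclideanSpace ℝ (Fin 2))} (h : α ⊆ Set.range fun i => toPlane (P i)) :
    ∃ Q : Fin n → ℝ × ℝ, (∀ i, InHalfDisc (Q i)) ∧
      (∀ i, 0 < (Q i).2 → (Q i).1 ^ 2 + (Q i).2 ^ 2 < 1 → Q i = P i) ∧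
      ENNReal.ofReal (cost Q) ≤ distortion semicircleMixed α := by
  choose Q h1 h2 h3 h4 using fun i => exists_retract (P i)
  refine ⟨Q, h1, h4, ?_⟩
  refine le_trans (ENNReal.ofReal_le_ofReal (cost_mono h2 h3)) ?_
  rw [← distortion_range]
  exact distortion_anti h

/-- Any admissible set is covered by a family of `n` points, and projecting that family to the half
disc does not increase its cost; so `c` bounds the infimum from below, and the given family attains
it. -/
theorem isOptimalSetOfMeans_of_cost {n : ℕ} [NeZero n] {c : ℝ} (hc : 0 ≤ c)
    (hlow : ∀ P : Fin n → ℝ × ℝ, (∀ i, InHalfDisc (P i)) → c ≤ cost P) (P : Fin n → ℝ × ℝ)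
    (hup : cost P ≤ c) :
    IsOptimalSetOfMeans semicircleMixed n (Set.range fun i => toPlane (P i)) ∧
      (quantizationError semicircleMixed n).toReal = c := by
  have h1 : ENNReal.ofReal c ≤ quantizationError semicircleMixed n := by
    refine le_iInf₂ fun α hα => ?_
    obtain ⟨P, hP⟩ := exists_range_of_encard_le hα
    obtain ⟨Q, hQ, -, hle⟩ := exists_inHalfDisc_of_encard_le hP
    exact (ENNReal.ofReal_le_ofReal (hlow Q hQ)).trans hle
  have h2 : (Set.range fun i => toPlane (P i)).encard ≤ n := by
    rw [← Set.image_univ]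
    refine (Set.encard_image_le _ _).trans (le_of_eq ?_)
    simp [Set.encard_univ]
  have h3 : distortion semicircleMixed (Set.range fun i => toPlane (P i)) ≤ ENNReal.ofReal c := by
    rw [distortion_range]
    exact ENNReal.ofReal_le_ofReal hup
  have h4 : quantizationError semicircleMixed n ≤
      distortion semicircleMixed (Set.range fun i => toPlane (P i)) := 
    iInf₂_le (f := fun α _ => distortion semicircleMixed α) _ h2
  refine ⟨⟨h2, le_antisymm (h3.trans h1) h4⟩, ?_⟩
  rw [le_antisymm (h4.trans h3) h1, ENNReal.toReal_ofReal hc]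

namespace Ex

/-- The value of the expression is verified to lie in the interval. -/
def within (ι : ℕ → Itv) (e : Ex) (I : Itv) : Bool :=
  e.ok ι && (decide (I.lo ≤ (e.itv ι).lo) && decide ((e.itv ι).hi ≤ I.hi))

theorem mem_of_within {ρ : ℕ → ℝ} {ι : ℕ → Itv} (h : ∀ i, (ι i).Mem (ρ i)) {e : Ex} {I : Itv}
    (hw : e.within ι I = true) : I.Mem (e.eval ρ) := by
  simp only [within, Bool.and_eq_true, decide_eq_true_eq] at hw
  have h1 := mem_itv h e hw.1
  have h2 : (I.lo : ℝ) ≤ (e.itv ι).lo := by exact_mod_cast hw.2.1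
  have h3 : ((e.itv ι).hi : ℝ) ≤ I.hi := by exact_mod_cast hw.2.2
  exact ⟨h2.trans h1.1, h1.2.trans h3⟩

/-- The case `k = 0` is separate because a constant with denominator `0` fails `ok`. The corner term
is written as mass times `|centroid|²` instead of `|moment|²` over mass. -/
def partitionCostEx (k m : ℕ) : Ex :=
  nat 2 * (.const 1 12 * (nat 1 - var 1 * sq (var 1)) + .const 1 2 * (var 2 * inv (var 0)) -
    massEx * (sq cornerXEx + sq cornerYEx)) +
  (if k = 0 then nat 0 else .const 1 (6 * k ^ 2) * (var 1 * sq (var 1))) +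
  (nat m * inv (var 0)) * (halfAngleEx m - sq (sin (halfAngleEx m)) * inv (halfAngleEx m))

def radiusEx (m : ℕ) : Ex := sin (halfAngleEx m) * inv (halfAngleEx m)

def angleEx (m j : ℕ) : Ex := var 2 + nat (2 * j + 1) * halfAngleEx m

def arcXEx (m j : ℕ) : Ex := radiusEx m * cos (angleEx m j)

def arcYEx (m j : ℕ) : Ex := radiusEx m * sin (angleEx m j)

theorem eval_partitionCostEx (k m : ℕ) (b θ : ℝ) (h : 0 < cornerMass b θ) :
    (partitionCostEx k m).eval (edgeVal b θ) = partitionCost k m b θ := by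
  have e : (if k = 0 then nat 0 else Ex.const 1 (6 * k ^ 2) * (var 1 * sq (var 1))).eval
      (edgeVal b θ) = b ^ 3 / (6 * (k : ℝ) ^ 2) := by
    split_ifs with hk
    · simp [hk, eval_nat]
    · simp only [eval_mul, eval_sq, eval_const, eval_var, edgeVal]
      push_cast
      ring
  have e0 : (((1 - b ^ 2) / 8 + Real.sin θ / (2 * Real.pi)) ^ 2 +
      ((1 - Real.cos θ) / (2 * Real.pi)) ^ 2) / cornerMass b θ =
      cornerMass b θ * ((cornerPoint b θ).1 ^ 2 + (cornerPoint b θ).2 ^ 2) := by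
    have := h.ne'
    simp only [cornerPoint]
    field_simp
  rw [partitionCostEx, eval_add, eval_add, e, partitionCost, e0]
  simp only [eval_add, eval_sub, eval_mul, eval_sq, eval_inv, eval_var, eval_const, eval_nat,
    eval_massEx, eval_cornerXEx, eval_cornerYEx, eval_halfAngleEx, eval_sin, edgeVal]
  push_cast
  ring

end Ex

/-- The centroid of the `j`th of the `m` equal parts of the arc between `θ` and `π - θ`. -/
noncomputable def arcPoint (m : ℕ) (θ : ℝ) (j : ℕ) : ℝ × ℝ :=
  (Real.sin (halfAngle m θ) / halfAngle m θ * Real.cos (θ + (2 * j + 1) * halfAngle m θ),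
    Real.sin (halfAngle m θ) / halfAngle m θ * Real.sin (θ + (2 * j + 1) * halfAngle m θ))

theorem Ex.eval_radiusEx (m : ℕ) (b θ : ℝ) : (radiusEx m).eval (edgeVal b θ) =
    Real.sin (halfAngle m θ) / halfAngle m θ := by
  simp only [radiusEx, eval_mul, eval_inv, eval_sin, eval_halfAngleEx]
  ring

theorem Ex.eval_arcXEx (m j : ℕ) (b θ : ℝ) :
    (arcXEx m j).eval (edgeVal b θ) = (arcPoint m θ j).1 := by
  simp only [arcXEx, angleEx, eval_mul, eval_cos, eval_add, eval_nat, eval_var, eval_radiusEx,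
    eval_halfAngleEx, edgeVal, arcPoint]
  push_cast
  ring

theorem Ex.eval_arcYEx (m j : ℕ) (b θ : ℝ) :
    (arcYEx m j).eval (edgeVal b θ) = (arcPoint m θ j).2 := by
  simp only [arcYEx, angleEx, eval_mul, eval_sin, eval_add, eval_nat, eval_var, eval_radiusEx,
    eval_halfAngleEx, edgeVal, arcPoint]
  push_cast
  ring

theorem arcPoint_mirror {m i j : ℕ} (h : i + j + 1 = m) (θ : ℝ) :
    arcPoint m θ i = (-(arcPoint m θ j).1, (arcPoint m θ j).2) := by
  have hm : (m : ℝ) = i + j + 1 := by rw [← h]; push_cast; ring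
  have hm0 : (m : ℝ) ≠ 0 := by rw [hm]; positivity
  have e : θ + (2 * i + 1) * halfAngle m θ = Real.pi - (θ + (2 * j + 1) * halfAngle m θ) := by
    have : halfAngle m θ * (2 * m) = Real.pi - 2 * θ := by unfold halfAngle; field_simp
    rw [hm] at this
    linear_combination this
  simp only [arcPoint, e, Real.cos_pi_sub, Real.sin_pi_sub]
  simp

theorem arcPoint_middle {m j : ℕ} (h : 2 * j + 1 = m) (θ : ℝ) :
    arcPoint m θ j = (0, Real.sin (halfAngle m θ) / halfAngle m θ) := by
  have hm : (m : ℝ) = 2 * j + 1 := by rw [← h]; push_cast; ring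
  have hm0 : (m : ℝ) ≠ 0 := by rw [hm]; positivity
  have e : θ + (2 * j + 1) * halfAngle m θ = Real.pi / 2 := by
    have : halfAngle m θ * (2 * m) = Real.pi - 2 * θ := by unfold halfAngle; field_simp
    rw [hm] at this
    linear_combination this / 2
  simp [arcPoint, e]

/-- The numbers that round to `a / 10 ^ k` at `k` places. -/
def roundItv (a k : ℕ) : Itv :=
  ⟨a * 10 ^ (20 - k) - 5 * 10 ^ (19 - k), a * 10 ^ (20 - k) + 5 * 10 ^ (19 - k)⟩

theorem roundsTo_of_mem {x c : ℝ} {a k : ℕ} (hk : k ≤ 19) (h : (roundItv a k).Mem x)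
    (hc : c = a / 10 ^ k) : RoundsTo x c k := by
  obtain ⟨h1, h2⟩ := h
  simp only [roundItv] at h1 h2
  push_cast at h1 h2
  obtain ⟨j, hj⟩ := Nat.exists_eq_add_of_le hk
  have e1 : 19 - k = j := by omega
  have e2 : 20 - k = j + 1 := by omega
  have e3 : ((prec : ℕ) : ℝ) = 10 ^ k * 10 ^ (j + 1) := by
    rw [← pow_add, show k + (j + 1) = 20 by omega, prec]
    norm_num
  rw [e1, e2, e3] at h1 h2
  have hj0 : (0 : ℝ) < 10 ^ j := by positivity
  have hk0 : (0 : ℝ) < 10 ^ k := by positivity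
  have k1 : 10 * (a : ℝ) - 5 ≤ 10 * (x * 10 ^ k) := by
    refine le_of_mul_le_mul_right ?_ hj0
    rw [pow_succ] at h1
    linarith
  have k2 : 10 * (x * 10 ^ k) ≤ 10 * (a : ℝ) + 5 := by
    refine le_of_mul_le_mul_right ?_ hj0
    rw [pow_succ] at h2
    linarith
  unfold RoundsTo
  rw [hc, abs_le, one_div_pow]
  have e4 : x - (a : ℝ) / 10 ^ k = (x * 10 ^ k - a) / 10 ^ k := by field_simp
  rw [e4]
  constructor
  · rw [le_div_iff₀ hk0]
    have : -(1 / 2 * (1 / (10 : ℝ) ^ k)) * 10 ^ k = -(1 / 2) := by field_simp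
    rw [this]; linarith
  · rw [div_le_iff₀ hk0]
    have : 1 / 2 * (1 / (10 : ℝ) ^ k) * 10 ^ k = 1 / 2 := by field_simp
    rw [this]; linarith

namespace Design

/-- The enclosures of the variables for a corner follow from those of `b` and `θ`, and the cost of
the partition is at most `V / 10⁹`. -/
def enclosureCheck (k m : ℕ) (V : ℤ) : List Itv → Bool
  | [_, I, J, Ic, Is, Ip, Iq] =>
    let ι := edgeItv I J
    (Ex.cos (.var 2)).within ι Ic && ((Ex.sin (.var 2)).within ι Is &&
    (cornerXEx.within ι Ip && (cornerYEx.within ι Iq &&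
    (Ex.const V (10 ^ 9) - Ex.partitionCostEx k m).pos ι)))
  | _ => false

variable {D : Design} {k m n : ℕ} {b θ : ℝ}

/-- Either the cost of `P` exceeds `V / 10⁹`, which is above the partition cost, or the distribution
of its points over the zones is known and duality applies. -/
theorem forall_partitionCost_le_cost [NeZero n] {V : ℤ} {I J Ic Is Ip Iq : Itv}
    (hl : D.l = [⟨314159265358979323846, 314159265358979323847⟩, I, J, Ic, Is, Ip, Iq])
    (henc : enclosureCheck k m V D.l = true) (h : D.check = true) (hzc : D.zoneCheck k m = true)
    (hbI : I.Mem b) (hθJ : J.Mem θ) (hb0 : 0 ≤ b) (hb1 : b < 1) (hθ0 : 0 ≤ θ)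
    (hθ1 : θ < Real.pi / 2) (hm0 : m ≠ 0) (hk : k = 0 → b = 0)
    (hk' : k ≠ 0 → sqBase (cornerPoint b θ) b = (b / k) ^ 2)
    (hm : sqArc (cornerPoint b θ) θ = arcPrice (halfAngle m θ))
    (hcounts : ∀ P : Fin n → ℝ × ℝ, (∀ i, InHalfDisc (P i)) → 10 ^ 9 * cost P ≤ V →
      (zones D.x D.y D.t).count P .top = m ∧ (zones D.x D.y D.t).count P .base = k ∧
      (zones D.x D.y D.t).count P .right = 1 ∧ (zones D.x D.y D.t).count P .left = 1)
    (P : Fin n → ℝ × ℝ) (hP : ∀ i, InHalfDisc (P i)) : partitionCost k m b θ ≤ cost P := by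
  have hM := cornerMass_pos hb1 hθ0
  have hmem := edge_mem hbI hθJ
  rw [hl] at henc
  simp only [enclosureCheck, Bool.and_eq_true] at henc
  obtain ⟨w1, w2, w3, w4, w5⟩ := henc
  have k1 := Ex.mem_of_within hmem w1
  have k2 := Ex.mem_of_within hmem w2
  have k3 := Ex.mem_of_within hmem w3
  have k4 := Ex.mem_of_within hmem w4
  have k5 := Ex.eval_pos hmem w5
  rw [eval_cornerXEx] at k3
  rw [eval_cornerYEx] at k4
  rw [Ex.eval_sub, Ex.eval_partitionCostEx k m b θ hM, Ex.eval_const] at k5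
  push_cast at k5
  have hc : CornerMem D.l b θ (cornerPoint b θ) := by
    rw [hl]
    exact cornerMem_of pi_mem hbI hθJ k1 k2 k3 k4
  rcases le_or_gt (10 ^ 9 * cost P) (V : ℝ) with hV | hV
  · exact partitionCost_le_cost h hzc hc hb0 hb1 hθ0 hθ1.le hk hk' (fun h0 => absurd h0 hm0)
      (fun _ => ⟨hm, hθ1⟩) hP (hcounts P hP hV)
  · linarith

end Design

end HalfDisc

/-! ### Best partitions for three to nine points -/

namespace HalfDisc

/-- The parameters `b` and `θ` lie in the given intervals, and the cost of the partition that they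
define is a lower bound of the cost of all sets of `n` points. -/
structure IsBestPartition (n k m : ℕ) [NeZero n] (I J : Itv) (b θ : ℝ) : Prop where
  memLeft : I.Mem b
  memRight : J.Mem θ
  nonneg_left : 0 ≤ b
  lt_one : b < 1
  nonneg_right : 0 ≤ θ
  lt_pi_div_two : θ < Real.pi / 2
  le_cost : ∀ P : Fin n → ℝ × ℝ, (∀ i, InHalfDisc (P i)) → partitionCost k m b θ ≤ cost P

theorem bounds_of_mem {b θ : ℝ} {x y w : ℤ} (hx0 : 0 ≤ x) (hx : x + 4 * w < prec) (hy : 0 ≤ y)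
    (hy1 : 2 * (y + 4 * w) < 3 * prec) (hb : Itv.Mem b ⟨x, x + 4 * w⟩)
    (hθ : Itv.Mem θ ⟨y, y + 4 * w⟩) : 0 ≤ b ∧ b < 1 ∧ 0 ≤ θ ∧ θ < Real.pi / 2 := by
  have hp := prec_pos
  have hx0' : (0 : ℝ) ≤ x := by exact_mod_cast hx0
  have hy' : (0 : ℝ) ≤ y := by exact_mod_cast hy
  have hx' : ((x + 4 * w : ℤ) : ℝ) < prec := by exact_mod_cast hx
  have hy1' : 2 * ((y + 4 * w : ℤ) : ℝ) < 3 * prec := by exact_mod_cast hy1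
  have hpi := Real.pi_gt_three
  obtain ⟨b0, b1⟩ := hb
  obtain ⟨t0, t1⟩ := hθ
  simp only at b0 b1 t0 t1
  refine ⟨?_, ?_, ?_, ?_⟩
  · by_contra h
    nlinarith
  · by_contra h
    nlinarith
  · by_contra h
    nlinarith
  · by_contra h
    nlinarith

namespace Design

variable {D : Design} {k m n : ℕ} [NeZero n] {x y w V : ℤ} {Ic Is Ip Iq : Itv}

/-- The sign conditions on the size of the intervals. -/
def rangeCheck (x y w : ℤ) : Bool :=
  decide (0 < w) && (decide (0 ≤ x) && (decide (x + 4 * w < prec) && (decide (0 ≤ y) &&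
    decide (2 * (y + 4 * w) < 3 * prec))))

theorem exists_isBestPartition
    (hl : D.l = [⟨314159265358979323846, 314159265358979323847⟩, ⟨x, x + 4 * w⟩, ⟨y, y + 4 * w⟩,
      Ic, Is, Ip, Iq])
    (hk : k ≠ 0) (hm : m ≠ 0) (hD : D.check = true)
    (h : (rangeCheck x y w && (stationaryCheck k m x y w && (D.zoneCheck k m &&
      enclosureCheck k m V D.l))) = true)
    (hcounts : ∀ P : Fin n → ℝ × ℝ, (∀ i, InHalfDisc (P i)) → 10 ^ 9 * cost P ≤ V →
      (zones D.x D.y D.t).count P .top = m ∧ (zones D.x D.y D.t).count P .base = k ∧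
      (zones D.x D.y D.t).count P .right = 1 ∧ (zones D.x D.y D.t).count P .left = 1) :
    ∃ b θ, IsBestPartition n k m ⟨x, x + 4 * w⟩ ⟨y, y + 4 * w⟩ b θ := by
  simp only [Bool.and_eq_true, rangeCheck, decide_eq_true_eq] at h
  obtain ⟨⟨h1, h2, h3, h4, h5⟩, h6, h7, h8⟩ := h
  obtain ⟨b, θ, hb, hθ, e1, e2⟩ := exists_stationary_of_check (Nat.pos_of_ne_zero hm) h1 h3 h4 h5 h6
  obtain ⟨k1, k2, k3, k4⟩ := bounds_of_mem h2 h3 h4 h5 hb hθ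
  exact ⟨b, θ, hb, hθ, k1, k2, k3, k4, forall_partitionCost_le_cost hl h8 hD h7 hb hθ k1 k2 k3 k4 hm
    (fun h0 => absurd h0 hk) (fun _ => e1) e2 hcounts⟩

/-- Without base points the corner cells meet at `b = 0` by symmetry, and only the angle has to be
found. -/
theorem exists_isBestPartition_of_angle
    (hl : D.l = [⟨314159265358979323846, 314159265358979323847⟩, ⟨0, 0⟩, ⟨y, y + 4 * w⟩,
      Ic, Is, Ip, Iq])
    (hm : m ≠ 0) (hD : D.check = true)
    (h : (rangeCheck 0 y w && (((-arcGapEx m).pos (edgeItv ⟨0, 0⟩ ⟨y, y⟩) &&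
      (arcGapEx m).pos (edgeItv ⟨0, 0⟩ ⟨y + 4 * w, y + 4 * w⟩)) && (D.zoneCheck 0 m &&
      enclosureCheck 0 m V D.l))) = true)
    (hcounts : ∀ P : Fin n → ℝ × ℝ, (∀ i, InHalfDisc (P i)) → 10 ^ 9 * cost P ≤ V →
      (zones D.x D.y D.t).count P .top = m ∧ (zones D.x D.y D.t).count P .base = 0 ∧
      (zones D.x D.y D.t).count P .right = 1 ∧ (zones D.x D.y D.t).count P .left = 1) :
    ∃ θ, IsBestPartition n 0 m ⟨0, 0⟩ ⟨y, y + 4 * w⟩ 0 θ := by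
  rw [Bool.and_eq_true, Bool.and_eq_true, Bool.and_eq_true (D.zoneCheck 0 m)] at h
  obtain ⟨h0, h6, h7, h8⟩ := h
  simp only [Bool.and_eq_true, rangeCheck, decide_eq_true_eq] at h0
  obtain ⟨h1, h2, h3, h4, h5⟩ := h0
  obtain ⟨θ, hθ, e2⟩ := exists_stationary_angle_of_check (Nat.pos_of_ne_zero hm) h1 h4 h5 h6
  have hb : Itv.Mem 0 ⟨0, 0⟩ := by simp [Itv.Mem]
  have hb' : Itv.Mem 0 ⟨0, 0 + 4 * w⟩ := by
    have : (0 : ℝ) < w := by exact_mod_cast h1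
    refine ⟨by simp, ?_⟩
    push_cast
    linarith
  obtain ⟨k1, k2, k3, k4⟩ := bounds_of_mem h2 h3 h4 h5 hb' hθ
  exact ⟨θ, hb, hθ, k1, k2, k3, k4, forall_partitionCost_le_cost hl h8 hD h7 hb hθ k1 k2 k3 k4 hm
    (fun _ => rfl) (fun h0 => absurd rfl h0) e2 hcounts⟩

end Design

namespace IsBestPartition

variable {n k m : ℕ} [NeZero n] {I J : Itv} {b θ : ℝ}

theorem roundsTo_eval (h : IsBestPartition n k m I J b θ) {e : Ex} {a l : ℕ} {c : ℝ} (hl : l ≤ 19)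
    (hc : c = a / 10 ^ l) (hw : e.within (edgeItv I J) (roundItv a l) = true) :
    RoundsTo (e.eval (edgeVal b θ)) c l :=
  roundsTo_of_mem hl (Ex.mem_of_within (edge_mem h.memLeft h.memRight) hw) hc

/-- The points of the partition are an optimal set. -/
theorem isOptimal (h : IsBestPartition n k m I J b θ) (hm : m ≠ 0) (hk : k = 0 → b = 0)
    {V : ℝ} {l : ℕ} (hV : RoundsTo (partitionCost k m b θ) V l) (hV0 : 1 ≤ V * 10 ^ l)
    (P : Fin n → ℝ × ℝ)
    (hr : ∃ i, P i = cornerPoint b θ) (hl : ∃ i, P i = (-(cornerPoint b θ).1, (cornerPoint b θ).2))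
    (hbase : ∀ j < k, ∃ i, P i = (-b + (2 * j + 1) * (b / k), 0))
    (harc : ∀ j < m, ∃ i, P i = arcPoint m θ j) :
    IsOptimalSetOfMeans semicircleMixed n (Set.range fun i => toPlane (P i)) ∧
      RoundsTo (quantizationError semicircleMixed n).toReal V l := by
  have h0 : 0 ≤ partitionCost k m b θ := by
    have h1 := (abs_le.1 hV).1
    have h2 : 1 / (10 : ℝ) ^ l ≤ V := by rw [div_le_iff₀ (by positivity)]; exact hV0
    rw [one_div_pow] at h1
    have h3 : 0 < 1 / (10 : ℝ) ^ l := by positivity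
    linarith
  obtain ⟨h1, h2⟩ := isOptimalSetOfMeans_of_cost h0 h.le_cost P (cost_le_partitionCost
    h.nonneg_left h.lt_one h.nonneg_right hk (fun h => absurd h hm) (fun _ => h.lt_pi_div_two)
    hr hl hbase harc)
  exact ⟨h1, by rw [h2]; exact hV⟩

end IsBestPartition

/-- The zones agree with those of `counts_four`, so that the counts can be used. The last seven
intervals enclose `π`, `b`, `θ`, `cos θ`, `sin θ` and the centroid; those of `b` and `θ` have width
`2 * 10⁻¹²`. The other designs are built alike. -/
def design_four : Design :=
  ⟨11, 4, 16, 46, 54, 10, 18, 16, 16, 2,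
    [(580, 825, 97), (530, 715, 138), (635, 910, 112), (585, 845, 89)],
    108882387, 226546342, 48801708069888, 612445333,
    [⟨314159265358979323846, 314159265358979323847⟩,
    ⟨42458790196535279743, 42458790196735279743⟩,
    ⟨92959036945237894329, 92959036945437894329⟩,
    ⟨59816230013445134060, 59816230013605409060⟩,
    ⟨80137498257429096291, 80137498257548728755⟩,
    ⟨78823478450408198856, 78823478450767249017⟩,
    ⟨21917078116197018637, 21917078116345898814⟩]⟩

theorem design_four_check : design_four.check = true := by decide +kernel

theorem exists_best_four : ∃ b θ, IsBestPartition 4 1 1 ⟨42458790196535279743, 42458790196535279743 + 4 * 50000000⟩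
    ⟨92959036945237894329, 92959036945237894329 + 4 * 50000000⟩ b θ :=
  Design.exists_isBestPartition (D := design_four) (V := 98412010) rfl (by norm_num) (by norm_num)
    design_four_check (by decide +kernel) fun _ hP hV => counts_four hP hV

def design_five : Design :=
  ⟨15, 4, 14, 47, 55, 4, 12, 16, 16, 2,
    [(640, 570, 111), (610, 440, 141), (695, 650, 95), (665, 520, 123)],
    100414001, 129178265, 27841363198976, 462469958,
    [⟨314159265358979323846, 314159265358979323847⟩,
    ⟨40774245599753909059, 40774245599953909059⟩,
    ⟨62239647910487700712, 62239647910687700712⟩,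
    ⟨81248368227627519631, 81248368227744116420⟩,
    ⟨58298393291143971172, 58298393291306467911⟩,
    ⟨79718983216778033707, 79718983217229163843⟩,
    ⟨12076693097333473069, 12076693097448555700⟩]⟩

theorem design_five_check : design_five.check = true := by decide +kernel

theorem exists_best_five : ∃ b θ, IsBestPartition 5 1 2 ⟨40774245599753909059, 40774245599753909059 + 4 * 50000000⟩
    ⟨62239647910487700712, 62239647910487700712 + 4 * 50000000⟩ b θ :=
  Design.exists_isBestPartition (D := design_five) (V := 65435830) rfl (by norm_num) (by norm_num)
    design_five_check (by decide +kernel) fun _ hP hV => counts_five hP hV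

def design_six : Design :=
  ⟨18, 4, 13, 46, 54, 0, 8, 8, 8, 4,
    [(650, 425, 167), (650, 405, 113), (650, 385, 61), (650, 290, 109), (710, 475, 127), (710,
    455, 77), (705, 420, 47), (695, 290, 140), (740, 515, 101), (740, 495, 55), (735, 430, 64),
    (725, 290, 168), (770, 555, 85), (765, 530, 42), (760, 445, 77), (750, 295, 188)],
    93597681, 84420690, 20357978958592, 373863659,
    [⟨314159265358979323846, 314159265358979323847⟩,
    ⟨39366004936839494453, 39366004937039494453⟩,
    ⟨43104355878988994850, 43104355879188994850⟩,
    ⟨90853022562428551076, 90853022562512114905⟩,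
    ⟨41781913446558004451, 41781913446739710498⟩,
    ⟨78172827406362042335, 78172827406873297138⟩,
    ⟨6611571258140075259, 6611571258225047814⟩]⟩

theorem design_six_check : design_six.check = true := by decide +kernel

theorem exists_best_six : ∃ b θ, IsBestPartition 6 1 3 ⟨39366004936839494453, 39366004936839494453 + 4 * 50000000⟩
    ⟨43104355878988994850, 43104355878988994850 + 4 * 50000000⟩ b θ :=
  Design.exists_isBestPartition (D := design_six) (V := 49956540) rfl (by norm_num) (by norm_num)
    design_six_check (by decide +kernel) fun _ hP hV => counts_six hP hV

def design_seven : Design :=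
  ⟨18, 6, 11, 51, 59, 2, 10, 8, 8, 4,
    [(415, 525, 117), (415, 505, 71), (415, 480, 33), (415, 365, 103), (475, 565, 100), (475, 545,
    57), (470, 505, 37), (450, 390, 103), (515, 600, 91), (510, 575, 50), (500, 530, 38), (480,
    420, 100), (545, 625, 89), (540, 605, 49), (525, 555, 38), (505, 450, 95)],
    52300361, 78144587, 11367684053504, 359698191,
    [⟨314159265358979323846, 314159265358979323847⟩,
    ⟨58853342707231872162, 58853342707431872162⟩,
    ⟨47557892150539631691, 47557892150739631691⟩,
    ⟨88902780955145296357, 88902780955236866999⟩,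
    ⟨45785320119282479667, 45785320119460285231⟩,
    ⟨86567775207209085625, 86567775207929103902⟩,
    ⟨9891370893117013340, 9891370893243964845⟩]⟩

theorem design_seven_check : design_seven.check = true := by decide +kernel

theorem exists_best_seven : ∃ b θ, IsBestPartition 7 2 3 ⟨58853342707231872162, 58853342707231872162 + 4 * 50000000⟩
    ⟨47557892150539631691, 47557892150539631691 + 4 * 50000000⟩ b θ :=
  Design.exists_isBestPartition (D := design_seven) (V := 36666810) rfl (by norm_num) (by norm_num)
    design_seven_check (by decide +kernel) fun _ hP hV => counts_seven hP hV

def design_eight : Design :=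
  ⟨19, 6, 10, 51, 59, 0, 7, 8, 7, 4,
    [(445, 400, 130), (445, 380, 89), (445, 365, 47), (445, 285, 79), (500, 445, 100), (500, 425,
    61), (495, 395, 33), (480, 290, 97), (530, 475, 84), (525, 455, 47), (520, 405, 45), (510,
    295, 113), (555, 505, 75), (555, 480, 41), (550, 420, 52), (535, 305, 122)],
    49667990, 54433513, 8528554130944, 300207809,
    [⟨314159265358979323846, 314159265358979323847⟩,
    ⟨57353124654321752360, 57353124654521752360⟩,
    ⟨35761595925075004881, 35761595925275004881⟩,
    ⟨93673399935484893700, 93673399935554902106⟩,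
    ⟨35004201812262236788, 35004201812449583589⟩,
    ⟨85360874311394164434, 85360874312178990506⟩,
    ⟨6157206025153077990, 6157206025252022147⟩]⟩

theorem design_eight_check : design_eight.check = true := by decide +kernel

theorem exists_best_eight : ∃ b θ, IsBestPartition 8 2 4 ⟨57353124654321752360, 57353124654321752360 + 4 * 50000000⟩
    ⟨35761595925075004881, 35761595925075004881 + 4 * 50000000⟩ b θ :=
  Design.exists_isBestPartition (D := design_eight) (V := 29057310) rfl (by norm_num) (by norm_num)
    design_eight_check (by decide +kernel) fun _ hP hV => counts_eight hP hV

def design_nine : Design :=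
  ⟨21, 4, 9, 54, 61, 2, 9, 7, 7, 4,
    [(310, 450, 89), (310, 430, 51), (310, 390, 38), (300, 280, 107), (365, 480, 76), (360, 460,
    40), (350, 405, 42), (325, 295, 109), (395, 505, 69), (385, 485, 34), (375, 425, 43), (350,
    315, 107), (415, 525, 67), (410, 505, 34), (395, 445, 43), (375, 340, 101)],
    31810710, 51978115, 5697206224896, 293358764,
    [⟨314159265358979323846, 314159265358979323847⟩,
    ⟨68848855802658770610, 68848855802858770610⟩,
    ⟨38585232737176812212, 38585232737376812212⟩,
    ⟨92647799673734383686, 92647799673809653475⟩,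
    ⟨37634893590943443338, 37634893591128738939⟩,
    ⟨90205604352910748511, 90205604353899571075⟩,
    ⟨8400850270716688884, 8400850270852048978⟩]⟩

theorem design_nine_check : design_nine.check = true := by decide +kernel

theorem exists_best_nine : ∃ b θ, IsBestPartition 9 3 4 ⟨68848855802658770610, 68848855802658770610 + 4 * 50000000⟩
    ⟨38585232737176812212, 38585232737176812212 + 4 * 50000000⟩ b θ :=
  Design.exists_isBestPartition (D := design_nine) (V := 23398320) rfl (by norm_num) (by norm_num)
    design_nine_check (by decide +kernel) fun _ hP hV => counts_nine hP hV

/-- There is no base cell: `b = 0` exactly, and `y = -1` leaves the base zone empty. -/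
def design_three : Design :=
  ⟨0, -1, 21, 37, 45, 6, 14, 32, 32, 1,
    [(1000, 535, 166)],
    257894736, 241757927, 99364189700864, 632672801,
    [⟨314159265358979323846, 314159265358979323847⟩,
    ⟨0, 0⟩,
    ⟨90613336932120941266, 90613336932320941266⟩,
    ⟨61679387326203835341, 61679387326361260287⟩,
    ⟨78712471559751609310, 78712471559874968088⟩,
    ⟨63486778872224506097, 63486778872325571685⟩,
    ⟨15471013462229296836, 15471013462305345417⟩]⟩

theorem design_three_check : design_three.check = true := by decide +kernel

theorem exists_best_three : ∃ θ, IsBestPartition 3 0 1 ⟨0, 0⟩ ⟨90613336932120941266, 90613336932120941266 + 4 * 50000000⟩ 0 θ :=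
  Design.exists_isBestPartition_of_angle (D := design_three) (V := 147821100) rfl (by norm_num)
    design_three_check (by decide +kernel) fun _ hP hV => counts_three hP hV

end HalfDisc

/-! ### The statements for three to nine points -/

namespace HalfDisc

namespace IsBestPartition

variable {n k m : ℕ} [NeZero n] {I J : Itv} {b θ : ℝ} {a l : ℕ} {c : ℝ}

theorem roundsTo_fst (h : IsBestPartition n k m I J b θ)
    (hw : cornerXEx.within (edgeItv I J) (roundItv a l) = true)
    (hc : c = a / 10 ^ l := by norm_num) (hl : l ≤ 19 := by norm_num) :
    RoundsTo (cornerPoint b θ).1 c l := by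
  rw [← eval_cornerXEx]
  exact h.roundsTo_eval hl hc hw

theorem roundsTo_snd (h : IsBestPartition n k m I J b θ)
    (hw : cornerYEx.within (edgeItv I J) (roundItv a l) = true)
    (hc : c = a / 10 ^ l := by norm_num) (hl : l ≤ 19 := by norm_num) :
    RoundsTo (cornerPoint b θ).2 c l := by
  rw [← eval_cornerYEx]
  exact h.roundsTo_eval hl hc hw

theorem roundsTo_radius (h : IsBestPartition n k m I J b θ)
    (hw : (Ex.radiusEx m).within (edgeItv I J) (roundItv a l) = true)
    (hc : c = a / 10 ^ l := by norm_num) (hl : l ≤ 19 := by norm_num) :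
    RoundsTo (Real.sin (halfAngle m θ) / halfAngle m θ) c l := by
  rw [← Ex.eval_radiusEx m b]
  exact h.roundsTo_eval hl hc hw

theorem roundsTo_arc_fst (h : IsBestPartition n k m I J b θ) (j : ℕ)
    (hw : (Ex.arcXEx m j).within (edgeItv I J) (roundItv a l) = true)
    (hc : c = a / 10 ^ l := by norm_num) (hl : l ≤ 19 := by norm_num) :
    RoundsTo (arcPoint m θ j).1 c l := by
  rw [← Ex.eval_arcXEx m j b]
  exact h.roundsTo_eval hl hc hw

theorem roundsTo_arc_snd (h : IsBestPartition n k m I J b θ) (j : ℕ)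
    (hw : (Ex.arcYEx m j).within (edgeItv I J) (roundItv a l) = true)
    (hc : c = a / 10 ^ l := by norm_num) (hl : l ≤ 19 := by norm_num) :
    RoundsTo (arcPoint m θ j).2 c l := by
  rw [← Ex.eval_arcYEx m j b]
  exact h.roundsTo_eval hl hc hw

theorem roundsTo_base (h : IsBestPartition n k m I J b θ) (i j : ℕ)
    (hw : (Ex.const i j * .var 1).within (edgeItv I J) (roundItv a l) = true)
    (hc : c = a / 10 ^ l := by norm_num) (hl : l ≤ 19 := by norm_num) :
    RoundsTo (i / j * b) c l := by
  have := h.roundsTo_eval hl hc hw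
  rw [Ex.eval_mul, Ex.eval_const, Ex.eval_var] at this
  push_cast at this
  exact this

theorem roundsTo_cost (h : IsBestPartition n k m I J b θ)
    (hw : (Ex.partitionCostEx k m).within (edgeItv I J) (roundItv a l) = true)
    (hc : c = a / 10 ^ l := by norm_num) (hl : l ≤ 19 := by norm_num) :
    RoundsTo (partitionCost k m b θ) c l := by
  rw [← Ex.eval_partitionCostEx k m b θ (cornerMass_pos h.lt_one h.nonneg_right)]
  exact h.roundsTo_eval hl hc hw

end IsBestPartition

theorem three_means :
    (∃ p q r : ℝ,
        RoundsTo p 0.634868 6 ∧ RoundsTo q 0.154710 6 ∧ RoundsTo r 0.927980 6 ∧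
        IsOptimalSetOfMeans semicircleMixed 3 {!₂[-p, q], !₂[0, r], !₂[p, q]}) ∧
      RoundsTo (quantizationError semicircleMixed 3).toReal 0.147821 6 := by
  obtain ⟨θ, h⟩ := exists_best_three
  obtain ⟨k1, k2⟩ := h.isOptimal (by norm_num) (by simp)
    (h.roundsTo_cost (a := 147821) (l := 6) (c := 0.147821) (by decide +kernel)) (by norm_num)
    ![(-(cornerPoint 0 θ).1, (cornerPoint 0 θ).2), arcPoint 1 θ 0, cornerPoint 0 θ]
    ⟨2, rfl⟩ ⟨0, rfl⟩ (by simp)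
    (fun j hj => by
      interval_cases j
      · exact ⟨1, rfl⟩)
  refine ⟨⟨_, _, _,
    h.roundsTo_fst (a := 634868) (by decide +kernel),
    h.roundsTo_snd (a := 154710) (by decide +kernel),
    h.roundsTo_radius (a := 927980) (by decide +kernel), ?_⟩, k2⟩
  convert k1 using 1
  ext v
  simp [Fin.exists_fin_succ, arcPoint_middle, toPlane, eq_comm]

theorem four_means :
    (∃ p q r : ℝ,
        RoundsTo p 0.788235 6 ∧ RoundsTo q 0.219171 6 ∧ RoundsTo r 0.932871 6 ∧
        IsOptimalSetOfMeans semicircleMixed 4 {!₂[0, 0], !₂[p, q], !₂[0, r], !₂[-p, q]}) ∧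
      RoundsTo (quantizationError semicircleMixed 4).toReal 0.0984120 7 := by
  obtain ⟨b, θ, h⟩ := exists_best_four
  obtain ⟨k1, k2⟩ := h.isOptimal (by norm_num) (by simp)
    -- For a value between `1/100` and `1/10` the sixth significant digit is the seventh decimal
    -- place.
    (h.roundsTo_cost (a := 984120) (l := 7) (c := 0.0984120) (by decide +kernel)) (by norm_num)
    ![(0, 0), cornerPoint b θ, arcPoint 1 θ 0, (-(cornerPoint b θ).1, (cornerPoint b θ).2)]
    ⟨1, rfl⟩ ⟨3, rfl⟩ (fun j hj => by
      interval_cases j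
      · exact ⟨0, Prod.ext (by simp [div_eq_mul_inv]; try ring) rfl⟩)
    (fun j hj => by
      interval_cases j
      · exact ⟨2, rfl⟩)
  refine ⟨⟨_, _, _,
    h.roundsTo_fst (a := 788235) (by decide +kernel),
    h.roundsTo_snd (a := 219171) (by decide +kernel),
    h.roundsTo_radius (a := 932871) (by decide +kernel), ?_⟩, k2⟩
  convert k1 using 1
  ext v
  simp [Fin.exists_fin_succ, arcPoint_middle, toPlane, eq_comm]

theorem five_means :
    (∃ p q u v : ℝ,
        RoundsTo p 0.797190 6 ∧ RoundsTo q 0.120767 6 ∧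
        RoundsTo u 0.439705 6 ∧ RoundsTo v 0.856689 6 ∧
        IsOptimalSetOfMeans semicircleMixed 5
          {!₂[0, 0], !₂[p, q], !₂[u, v], !₂[-u, v], !₂[-p, q]}) ∧
      RoundsTo (quantizationError semicircleMixed 5).toReal 0.0654358 7 := by
  obtain ⟨b, θ, h⟩ := exists_best_five
  obtain ⟨k1, k2⟩ := h.isOptimal (by norm_num) (by simp)
    (h.roundsTo_cost (a := 654358) (l := 7) (c := 0.0654358) (by decide +kernel)) (by norm_num)
    ![(0, 0), cornerPoint b θ, arcPoint 2 θ 0, arcPoint 2 θ 1, (-(cornerPoint b θ).1, (cornerPoint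
      b θ).2)]
    ⟨1, rfl⟩ ⟨4, rfl⟩ (fun j hj => by
      interval_cases j
      · exact ⟨0, Prod.ext (by simp [div_eq_mul_inv]; try ring) rfl⟩)
    (fun j hj => by
      interval_cases j
      · exact ⟨2, rfl⟩
      · exact ⟨3, rfl⟩)
  refine ⟨⟨_, _, _, _,
    h.roundsTo_fst (a := 797190) (by decide +kernel),
    h.roundsTo_snd (a := 120767) (by decide +kernel),
    h.roundsTo_arc_fst (a := 439705) 0 (by decide +kernel),
    h.roundsTo_arc_snd (a := 856689) 0 (by decide +kernel), ?_⟩, k2⟩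
  convert k1 using 1
  ext v
  -- Points on the left half of the arc are rewritten as mirror images, so that the symmetry in the
  -- statement is exact and not merely up to rounding.
  rw [arcPoint_mirror (m := 2) (i := 1) (j := 0) rfl]
  simp [Fin.exists_fin_succ, toPlane, eq_comm]

theorem six_means :
    (∃ p q u v r : ℝ,
        RoundsTo p 0.781728 6 ∧ RoundsTo q 0.0661157 7 ∧
        RoundsTo u 0.672351 6 ∧ RoundsTo v 0.707635 6 ∧ RoundsTo r 0.976117 6 ∧
        IsOptimalSetOfMeans semicircleMixed 6
          {!₂[0, 0], !₂[p, q], !₂[u, v], !₂[0, r], !₂[-u, v], !₂[-p, q]}) ∧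
      RoundsTo (quantizationError semicircleMixed 6).toReal 0.0499565 7 := by
  obtain ⟨b, θ, h⟩ := exists_best_six
  obtain ⟨k1, k2⟩ := h.isOptimal (by norm_num) (by simp)
    (h.roundsTo_cost (a := 499565) (l := 7) (c := 0.0499565) (by decide +kernel)) (by norm_num)
    ![(0, 0), cornerPoint b θ, arcPoint 3 θ 0, arcPoint 3 θ 1, arcPoint 3 θ 2, (-(cornerPoint b
      θ).1, (cornerPoint b θ).2)]
    ⟨1, rfl⟩ ⟨5, rfl⟩ (fun j hj => by
      interval_cases j
      · exact ⟨0, Prod.ext (by simp [div_eq_mul_inv]; try ring) rfl⟩)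
    (fun j hj => by
      interval_cases j
      · exact ⟨2, rfl⟩
      · exact ⟨3, rfl⟩
      · exact ⟨4, rfl⟩)
  refine ⟨⟨_, _, _, _, _,
    h.roundsTo_fst (a := 781728) (by decide +kernel),
    h.roundsTo_snd (a := 661157) (by decide +kernel),
    h.roundsTo_arc_fst (a := 672351) 0 (by decide +kernel),
    h.roundsTo_arc_snd (a := 707635) 0 (by decide +kernel),
    h.roundsTo_radius (a := 976117) (by decide +kernel), ?_⟩, k2⟩
  convert k1 using 1
  ext v
  rw [arcPoint_mirror (m := 3) (i := 2) (j := 0) rfl]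
  simp [Fin.exists_fin_succ, arcPoint_middle, toPlane, eq_comm]

theorem seven_means :
    (∃ s p q u v r : ℝ,
        RoundsTo s 0.294267 6 ∧ RoundsTo p 0.865678 6 ∧ RoundsTo q 0.0989137 7 ∧
        RoundsTo u 0.652260 6 ∧ RoundsTo v 0.728637 6 ∧ RoundsTo r 0.977935 6 ∧
        IsOptimalSetOfMeans semicircleMixed 7
          {!₂[-s, 0], !₂[s, 0], !₂[p, q], !₂[u, v], !₂[0, r], !₂[-u, v], !₂[-p, q]}) ∧
      RoundsTo (quantizationError semicircleMixed 7).toReal 0.0366668 7 := by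
  obtain ⟨b, θ, h⟩ := exists_best_seven
  obtain ⟨k1, k2⟩ := h.isOptimal (by norm_num) (by simp)
    (h.roundsTo_cost (a := 366668) (l := 7) (c := 0.0366668) (by decide +kernel)) (by norm_num)
    ![(-(((1 : ℕ) : ℝ) / (2 : ℕ) * b), 0), (((1 : ℕ) : ℝ) / (2 : ℕ) * b, 0), cornerPoint b θ,
      arcPoint 3 θ 0, arcPoint 3 θ 1, arcPoint 3 θ 2, (-(cornerPoint b θ).1, (cornerPoint b θ).2)]
    ⟨2, rfl⟩ ⟨6, rfl⟩ (fun j hj => by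
      interval_cases j
      · exact ⟨0, Prod.ext (by simp [div_eq_mul_inv]; try ring) rfl⟩
      · exact ⟨1, Prod.ext (by simp [div_eq_mul_inv]; try ring) rfl⟩)
    (fun j hj => by
      interval_cases j
      · exact ⟨3, rfl⟩
      · exact ⟨4, rfl⟩
      · exact ⟨5, rfl⟩)
  refine ⟨⟨_, _, _, _, _, _,
    h.roundsTo_base (a := 294267) 1 2 (by decide +kernel),
    h.roundsTo_fst (a := 865678) (by decide +kernel),
    h.roundsTo_snd (a := 989137) (by decide +kernel),
    h.roundsTo_arc_fst (a := 652260) 0 (by decide +kernel),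
    h.roundsTo_arc_snd (a := 728637) 0 (by decide +kernel),
    h.roundsTo_radius (a := 977935) (by decide +kernel), ?_⟩, k2⟩
  convert k1 using 1
  ext v
  rw [arcPoint_mirror (m := 3) (i := 2) (j := 0) rfl]
  simp [Fin.exists_fin_succ, arcPoint_middle, toPlane, eq_comm]

theorem eight_means :
    (∃ s p q u v w z : ℝ,
        RoundsTo s 0.286766 6 ∧ RoundsTo p 0.853609 6 ∧ RoundsTo q 0.0615721 7 ∧
        RoundsTo u 0.777386 6 ∧ RoundsTo v 0.604469 6 ∧
        RoundsTo w 0.294109 6 ∧ RoundsTo z 0.939793 6 ∧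
        IsOptimalSetOfMeans semicircleMixed 8
          {!₂[-s, 0], !₂[s, 0], !₂[p, q], !₂[u, v], !₂[w, z], !₂[-w, z], !₂[-u, v],
            !₂[-p, q]}) ∧
      RoundsTo (quantizationError semicircleMixed 8).toReal 0.0290573 7 := by
  obtain ⟨b, θ, h⟩ := exists_best_eight
  obtain ⟨k1, k2⟩ := h.isOptimal (by norm_num) (by simp)
    (h.roundsTo_cost (a := 290573) (l := 7) (c := 0.0290573) (by decide +kernel)) (by norm_num)
    ![(-(((1 : ℕ) : ℝ) / (2 : ℕ) * b), 0), (((1 : ℕ) : ℝ) / (2 : ℕ) * b, 0), cornerPoint b θ,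
      arcPoint 4 θ 0, arcPoint 4 θ 1, arcPoint 4 θ 2, arcPoint 4 θ 3, (-(cornerPoint b θ).1,
      (cornerPoint b θ).2)]
    ⟨2, rfl⟩ ⟨7, rfl⟩ (fun j hj => by
      interval_cases j
      · exact ⟨0, Prod.ext (by simp [div_eq_mul_inv]; try ring) rfl⟩
      · exact ⟨1, Prod.ext (by simp [div_eq_mul_inv]; try ring) rfl⟩)
    (fun j hj => by
      interval_cases j
      · exact ⟨3, rfl⟩
      · exact ⟨4, rfl⟩
      · exact ⟨5, rfl⟩
      · exact ⟨6, rfl⟩)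
  refine ⟨⟨_, _, _, _, _, _, _,
    h.roundsTo_base (a := 286766) 1 2 (by decide +kernel),
    h.roundsTo_fst (a := 853609) (by decide +kernel),
    h.roundsTo_snd (a := 615721) (by decide +kernel),
    h.roundsTo_arc_fst (a := 777386) 0 (by decide +kernel),
    h.roundsTo_arc_snd (a := 604469) 0 (by decide +kernel),
    h.roundsTo_arc_fst (a := 294109) 1 (by decide +kernel),
    h.roundsTo_arc_snd (a := 939793) 1 (by decide +kernel), ?_⟩, k2⟩
  convert k1 using 1
  ext v
  rw [arcPoint_mirror (m := 4) (i := 3) (j := 0) rfl,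
    arcPoint_mirror (m := 4) (i := 2) (j := 1) rfl]
  simp [Fin.exists_fin_succ, toPlane, eq_comm]

theorem nine_means :
    (∃ s p q u v w z : ℝ,
        RoundsTo s 0.458992 6 ∧ RoundsTo p 0.902056 6 ∧ RoundsTo q 0.0840085 7 ∧
        RoundsTo u 0.764954 6 ∧ RoundsTo v 0.621235 6 ∧
        RoundsTo w 0.287671 6 ∧ RoundsTo z 0.942514 6 ∧
        IsOptimalSetOfMeans semicircleMixed 9
          {!₂[-s, 0], !₂[0, 0], !₂[s, 0], !₂[p, q], !₂[u, v], !₂[w, z], !₂[-w, z], !₂[-u, v],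
            !₂[-p, q]}) ∧
      RoundsTo (quantizationError semicircleMixed 9).toReal 0.0233983 7 := by
  obtain ⟨b, θ, h⟩ := exists_best_nine
  obtain ⟨k1, k2⟩ := h.isOptimal (by norm_num) (by simp)
    (h.roundsTo_cost (a := 233983) (l := 7) (c := 0.0233983) (by decide +kernel)) (by norm_num)
    -- The midpoints of the three equal parts of `[-b, b]` are `0` and `±2 b / 3`.
    ![(-(((2 : ℕ) : ℝ) / (3 : ℕ) * b), 0), (0, 0), (((2 : ℕ) : ℝ) / (3 : ℕ) * b, 0), cornerPoint b
      θ, arcPoint 4 θ 0, arcPoint 4 θ 1, arcPoint 4 θ 2, arcPoint 4 θ 3, (-(cornerPoint b θ).1,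
      (cornerPoint b θ).2)]
    ⟨3, rfl⟩ ⟨8, rfl⟩ (fun j hj => by
      interval_cases j
      · exact ⟨0, Prod.ext (by simp [div_eq_mul_inv]; try ring) rfl⟩
      · exact ⟨1, Prod.ext (by simp [div_eq_mul_inv]; try ring) rfl⟩
      · exact ⟨2, Prod.ext (by simp [div_eq_mul_inv]; try ring) rfl⟩)
    (fun j hj => by
      interval_cases j
      · exact ⟨4, rfl⟩
      · exact ⟨5, rfl⟩
      · exact ⟨6, rfl⟩
      · exact ⟨7, rfl⟩)
  refine ⟨⟨_, _, _, _, _, _, _,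
    h.roundsTo_base (a := 458992) 2 3 (by decide +kernel),
    h.roundsTo_fst (a := 902056) (by decide +kernel),
    h.roundsTo_snd (a := 840085) (by decide +kernel),
    h.roundsTo_arc_fst (a := 764954) 0 (by decide +kernel),
    h.roundsTo_arc_snd (a := 621235) 0 (by decide +kernel),
    h.roundsTo_arc_fst (a := 287671) 1 (by decide +kernel),
    h.roundsTo_arc_snd (a := 942514) 1 (by decide +kernel), ?_⟩, k2⟩
  convert k1 using 1
  ext v
  rw [arcPoint_mirror (m := 4) (i := 3) (j := 0) rfl,
    arcPoint_mirror (m := 4) (i := 2) (j := 1) rfl]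
  simp [Fin.exists_fin_succ, toPlane, eq_comm]

end HalfDisc

/-! ### Two points: explicit optimum and uniqueness -/

namespace HalfDisc

/-- The corner cells are the two halves of the boundary, with `b = 0` and `θ = π / 2` fixed by
symmetry; base and top zones are empty. -/
def design_two : Design :=
  ⟨0, -1, 64, 32, 40, 16, 24, 32, 32, 1,
    [(870, 925, 181)],
    256266996, 475741304, 172047639239680, 887511996,
    [⟨314159265358979323846, 314159265358979323847⟩,
    ⟨0, 0⟩,
    ⟨157079632679489661923, 157079632679489661924⟩,
    ⟨0, 0⟩,
    ⟨100000000000000000000, 100000000000000000000⟩,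
    ⟨56830988618379067153, 56830988618379067154⟩,
    ⟨31830988618379067153, 31830988618379067154⟩]⟩

theorem design_two_check : design_two.check = true := by decide +kernel

/-- The centroid of the right half of the boundary. -/
noncomputable def rightCentroid : ℝ × ℝ := (1 / 4 + 1 / Real.pi, 1 / Real.pi)

theorem cornerMass_half : cornerMass 0 (Real.pi / 2) = 1 / 2 := by
  have := Real.pi_ne_zero
  unfold cornerMass
  field_simp
  norm_num

theorem cornerPoint_half : cornerPoint 0 (Real.pi / 2) = rightCentroid := by
  have := Real.pi_ne_zero
  simp only [cornerPoint, cornerMass_half, rightCentroid, Real.sin_pi_div_two, Real.cos_pi_div_two]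
  ext
  · field_simp
    norm_num
    ring
  · field_simp
    norm_num

theorem partitionCost_half : partitionCost 0 0 0 (Real.pi / 2) =
    58 / 96 - 1 / 2 * Real.pi⁻¹ - 2 * Real.pi⁻¹ ^ 2 := by
  have := Real.pi_ne_zero
  simp only [partitionCost, cornerMass_half, Real.sin_pi_div_two, Real.cos_pi_div_two]
  field_simp
  norm_num
  ring

theorem cornerMem_half : CornerMem design_two.l 0 (Real.pi / 2) (cornerPoint 0 (Real.pi / 2)) := by
  rw [cornerPoint_half]
  have hpi := pi_mem
  simp only [Itv.Mem, prec] at hpi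
  push_cast at hpi
  refine cornerMem_of pi_mem (by simp [Itv.Mem]) ?_ (by simp [Itv.Mem]) ?_ ?_ ?_
  · simp only [Itv.Mem, prec]
    push_cast
    constructor <;> linarith [hpi.1, hpi.2]
  · rw [Real.sin_pi_div_two]
    simp only [Itv.Mem, prec]
    norm_num
  · have := Ex.mem_of_within pi_mem_piItv (e := Ex.const 1 4 + Ex.inv (Ex.var 0))
      (I := ⟨56830988618379067153, 56830988618379067154⟩) (by decide +kernel)
    rw [Ex.eval_add, Ex.eval_const, Ex.eval_inv, Ex.eval_var] at this
    simpa [rightCentroid] using this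
  · have := Ex.mem_of_within pi_mem_piItv (e := Ex.inv (Ex.var 0))
      (I := ⟨31830988618379067153, 31830988618379067154⟩) (by decide +kernel)
    rw [Ex.eval_inv, Ex.eval_var] at this
    simpa [rightCentroid] using this

theorem partitionCost_half_mem :
    (roundItv 242369 6).Mem (partitionCost 0 0 0 (Real.pi / 2)) := by
  have := Ex.mem_of_within pi_mem_piItv (e := Ex.const 58 96 - Ex.const 1 2 * Ex.inv (Ex.var 0) -
    Ex.nat 2 * Ex.sq (Ex.inv (Ex.var 0))) (I := roundItv 242369 6) (by decide +kernel)
  simp only [Ex.eval_sub, Ex.eval_mul, Ex.eval_const, Ex.eval_inv, Ex.eval_sq, Ex.eval_var,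
    Ex.eval_nat] at this
  rw [partitionCost_half]
  push_cast at this
  exact this

theorem partitionCost_half_le : 10 ^ 9 * partitionCost 0 0 0 (Real.pi / 2) ≤ 242369420 := by
  have := Ex.eval_pos pi_mem_piItv (e := Ex.const 242369420 (10 ^ 9) - (Ex.const 58 96 -
    Ex.const 1 2 * Ex.inv (Ex.var 0) - Ex.nat 2 * Ex.sq (Ex.inv (Ex.var 0)))) (by decide +kernel)
  simp only [Ex.eval_sub, Ex.eval_mul, Ex.eval_const, Ex.eval_inv, Ex.eval_sq, Ex.eval_var,
    Ex.eval_nat] at this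
  push_cast at this
  rw [partitionCost_half]
  linarith

theorem counts_two' {P : Fin 2 → ℝ × ℝ} (hP : ∀ i, InHalfDisc (P i))
    (h : cost P ≤ partitionCost 0 0 0 (Real.pi / 2)) :
    (zones 0 (-1) 64).count P .top = 0 ∧ (zones 0 (-1) 64).count P .base = 0 ∧
      (zones 0 (-1) 64).count P .right = 1 ∧ (zones 0 (-1) 64).count P .left = 1 := by
  refine counts_two hP ?_
  have := partitionCost_half_le
  push_cast
  linarith

theorem partitionCost_half_le_cost (P : Fin 2 → ℝ × ℝ) (hP : ∀ i, InHalfDisc (P i)) :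
    partitionCost 0 0 0 (Real.pi / 2) ≤ cost P := by
  have hpi := Real.pi_pos
  by_contra hcon
  refine hcon (Design.partitionCost_le_cost design_two_check (by decide +kernel) cornerMem_half
    le_rfl zero_lt_one (by positivity) le_rfl (fun _ => rfl) (fun h => absurd rfl h) (fun _ => rfl)
    (fun h => absurd rfl h) hP (counts_two' hP (not_le.1 hcon).le))

/-- The mirror image of a point. -/
def mirror (p : ℝ × ℝ) : ℝ × ℝ := (-p.1, p.2)

/-- Equality in duality: both gains must reach the maximal value, and the maximum in each corner
zone is attained only at the centroid of that half. -/
theorem eq_of_cost_le {P : Fin 2 → ℝ × ℝ} (hP : ∀ i, InHalfDisc (P i))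
    (h : cost P ≤ partitionCost 0 0 0 (Real.pi / 2)) :
    (P 0 = rightCentroid ∧ P 1 = mirror rightCentroid) ∨
      (P 0 = mirror rightCentroid ∧ P 1 = rightCentroid) := by
  have hpi := Real.pi_pos
  have hM := cornerMass_pos zero_lt_one (show 0 ≤ Real.pi / 2 by positivity)
  obtain ⟨-, -, c3, c4⟩ := counts_two' hP h
  have he := partitionCost_eq (k := 0) (m := 0) hM (fun _ => rfl) (fun h => absurd rfl h)
    (fun _ => rfl) (fun h => absurd rfl h)
  have hg := fun q hq hz => Design.gain_le design_two_check cornerMem_half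
    (isCentroid_cornerPoint hM) (by norm_num) zero_le_one (by positivity) le_rfl (q := q) hq hz
  rw [cornerPoint_half] at he hg
  set B := sqBase rightCentroid 0
  set R := sqArc rightCentroid (Real.pi / 2)
  set c := cornerGain 0 (Real.pi / 2) B R rightCentroid
  have hd := dual_bound P (fun _ => B) (fun _ => R) continuous_const continuous_const
  rw [intervalIntegral.integral_const, intervalIntegral.integral_const, Fin.sum_univ_two] at hd
  have e : 1 / (2 * Real.pi) * (Real.pi - 0) • R = 1 / 2 * R := by
    rw [smul_eq_mul]; field_simp; ring
  rw [e, smul_eq_mul] at hd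
  push_cast at he
  have hsum : 2 * c ≤ gain (fun _ => B) (fun _ => R) (P 0) + gain (fun _ => B) (fun _ => R) (P 1) := by
    linarith
  have hleft : ∀ q, InHalfDisc q → (zones 0 (-1) 64).of q = .left →
      gain (fun _ => B) (fun _ => R) q ≤ c ∧
        (mirror q ≠ rightCentroid → gain (fun _ => B) (fun _ => R) q < c) := by
    intro q hq hz
    have := hg (mirror q) (by simpa [mirror, InHalfDisc] using hq) (Zones.of_mirror _ hz)
    rwa [show gain (fun _ => B) (fun _ => R) (mirror q) = gain (fun _ => B) (fun _ => R) q from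
      gain_mirror _ _ q] at this
  have key : ∀ i j, gain (fun _ => B) (fun _ => R) (P i) + gain (fun _ => B) (fun _ => R) (P j) =
      gain (fun _ => B) (fun _ => R) (P 0) + gain (fun _ => B) (fun _ => R) (P 1) →
      (zones 0 (-1) 64).of (P i) = .right → (zones 0 (-1) 64).of (P j) = .left →
      P i = rightCentroid ∧ P j = mirror rightCentroid := by
    intro i j hij hi hj
    obtain ⟨g1, g2⟩ := hg _ (hP i) hi
    obtain ⟨g3, g4⟩ := hleft _ (hP j) hj
    constructor
    · by_contra hne
      have := g2 hne
      linarith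
    · have : mirror (P j) = rightCentroid := by
        by_contra hne
        have := g4 hne
        linarith
      rw [← this]
      simp [mirror]
  obtain ⟨i, hi⟩ := Finset.card_pos.1 (by rw [show Finset.card _ = 1 from c3]; norm_num)
  obtain ⟨j, hj⟩ := Finset.card_pos.1 (by rw [show Finset.card _ = 1 from c4]; norm_num)
  have hi' := (Finset.mem_filter.1 hi).2
  have hj' := (Finset.mem_filter.1 hj).2
  fin_cases i <;> fin_cases j
  · simp only [Fin.zero_eta] at hi' hj'
    rw [hi'] at hj'
    exact absurd hj' (by simp)
  · exact Or.inl (key 0 1 rfl hi' hj')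
  · exact Or.inr (key 1 0 (add_comm _ _) hi' hj').symm
  · simp only [Fin.mk_one] at hi' hj'
    rw [hi'] at hj'
    exact absurd hj' (by simp)

/-- Interior points are fixed by the retraction, so an optimal family whose projection consists of
the two centroids consists of them itself. -/
theorem rightCentroid_interior : 0 < rightCentroid.2 ∧ rightCentroid.1 ^ 2 + rightCentroid.2 ^ 2 < 1 := by
  have h3 := Real.pi_gt_three
  have h0 : 0 < 1 / Real.pi := by positivity
  have h1 : 1 / Real.pi < 1 / 3 := one_div_lt_one_div_of_lt (by norm_num) h3
  refine ⟨h0, ?_⟩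
  simp only [rightCentroid]
  nlinarith

theorem rightCentroid_ne_mirror : rightCentroid ≠ mirror rightCentroid := by
  intro h
  have h1 : rightCentroid.1 = -rightCentroid.1 := congrArg Prod.fst h
  have : 0 < 1 / Real.pi := by have := Real.pi_pos; positivity
  simp only [rightCentroid] at h1
  linarith

theorem range_two_centroids :
    (Set.range fun i => toPlane (![mirror rightCentroid, rightCentroid] i)) =
      {toPlane (mirror rightCentroid), toPlane rightCentroid} := by
  ext v
  simp [Fin.exists_fin_succ, eq_comm]

theorem two_centroids_optimal :
    IsOptimalSetOfMeans semicircleMixed 2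
        {toPlane (mirror rightCentroid), toPlane rightCentroid} ∧
      (quantizationError semicircleMixed 2).toReal = partitionCost 0 0 0 (Real.pi / 2) := by
  have hpi := Real.pi_pos
  have h0 : 0 ≤ partitionCost 0 0 0 (Real.pi / 2) := by
    have := partitionCost_half_mem.1
    have h1 : (0 : ℝ) ≤ ((roundItv 242369 6).lo : ℝ) := by norm_num [roundItv]
    exact nonneg_of_mul_nonneg_left (h1.trans this) prec_pos
  rw [← range_two_centroids]
  refine isOptimalSetOfMeans_of_cost h0 partitionCost_half_le_cost _
    (cost_le_partitionCost le_rfl zero_lt_one (by positivity) (fun _ => rfl) (fun _ => rfl)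
      (fun h => absurd rfl h) ⟨1, cornerPoint_half.symm⟩ ⟨0, ?_⟩ (by simp) (by simp))
  rw [cornerPoint_half]
  rfl

/-- The two centroids are the only optimal set. -/
theorem isOptimalSetOfMeans_two_iff (α : Set (EuclideanSpace ℝ (Fin 2))) :
    IsOptimalSetOfMeans semicircleMixed 2 α ↔
      α = {toPlane (mirror rightCentroid), toPlane rightCentroid} := by
  obtain ⟨h1, h2⟩ := two_centroids_optimal
  refine ⟨fun hα => ?_, fun hα => hα ▸ h1⟩
  have h0 : 0 ≤ partitionCost 0 0 0 (Real.pi / 2) := h2 ▸ ENNReal.toReal_nonneg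
  have hne : quantizationError semicircleMixed 2 ≠ ⊤ := by
    rw [← h1.2, ← range_two_centroids, distortion_range]
    exact ENNReal.ofReal_ne_top
  have hd : distortion semicircleMixed α = ENNReal.ofReal (partitionCost 0 0 0 (Real.pi / 2)) := by
    rw [hα.2, ← h2, ENNReal.ofReal_toReal hne]
  -- Every pair that covers `α` costs no more than `α` after projection, hence must be the pair of
  -- centroids.
  have main : ∀ P : Fin 2 → ℝ × ℝ, (α ⊆ Set.range fun i => toPlane (P i)) →
      (P 0 = rightCentroid ∧ P 1 = mirror rightCentroid) ∨
        (P 0 = mirror rightCentroid ∧ P 1 = rightCentroid) := by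
    intro P hP
    obtain ⟨Q, hQ, hi, hle⟩ := exists_inHalfDisc_of_encard_le hP
    rw [hd, ENNReal.ofReal_le_ofReal_iff h0] at hle
    obtain ⟨k1, k2⟩ := rightCentroid_interior
    have e1 : ∀ i, Q i = rightCentroid → P i = rightCentroid := fun i h => by
      rw [← hi i (by rw [h]; exact k1) (by rw [h]; exact k2), h]
    have e2 : ∀ i, Q i = mirror rightCentroid → P i = mirror rightCentroid := fun i h => by
      rw [← hi i (by rw [h]; exact k1) (by rw [h]; simpa [mirror] using k2), h]
    rcases eq_of_cost_le hQ hle with ⟨q0, q1⟩ | ⟨q0, q1⟩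
    · exact Or.inl ⟨e1 0 q0, e2 1 q1⟩
    · exact Or.inr ⟨e2 0 q0, e1 1 q1⟩
  -- If `α` were contained in a single point, a constant pair would cover it, but the two centroids
  -- are distinct. Therefore both centroids belong to `α`.
  have hconst : ∀ p, ¬ α ⊆ {toPlane p} := by
    intro p hp
    rcases main (fun _ => p) (by simpa using hp) with ⟨q0, q1⟩ | ⟨q0, q1⟩
    · exact rightCentroid_ne_mirror (q0.symm.trans q1)
    · exact rightCentroid_ne_mirror (q1.symm.trans q0)
  obtain ⟨P, hP⟩ := exists_range_of_encard_le hα.1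
  have hsub : α ⊆ {toPlane (mirror rightCentroid), toPlane rightCentroid} := by
    refine hP.trans ?_
    rintro _ ⟨i, rfl⟩
    rcases main P hP with ⟨q0, q1⟩ | ⟨q0, q1⟩ <;> fin_cases i <;> simp [q0, q1]
  refine hsub.antisymm ?_
  rintro v (rfl | rfl)
  · by_contra hv
    refine hconst rightCentroid fun u hu => ?_
    rcases hsub hu with rfl | h
    · exact absurd hu hv
    · exact h
  · by_contra hv
    refine hconst (mirror rightCentroid) fun u hu => ?_
    rcases hsub hu with h | rfl
    · exact h
    · exact absurd hu hv

theorem two_means :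
    (∀ α : Set (EuclideanSpace ℝ (Fin 2)),
        IsOptimalSetOfMeans semicircleMixed 2 α ↔
          α = {!₂[-(1 / 4) - 1 / Real.pi, 1 / Real.pi], !₂[1 / 4 + 1 / Real.pi, 1 / Real.pi]}) ∧
      (quantizationError semicircleMixed 2).toReal =
        2 * ((96 - 24 * Real.pi + 7 * Real.pi ^ 2) / (192 * Real.pi ^ 2) +
          (-96 - 8 * Real.pi + 17 * Real.pi ^ 2) / (64 * Real.pi ^ 2)) ∧
      RoundsTo (quantizationError semicircleMixed 2).toReal 0.242369 6 := by
  have e1 : toPlane (mirror rightCentroid) = !₂[-(1 / 4) - 1 / Real.pi, 1 / Real.pi] := by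
    simp only [toPlane, mirror, rightCentroid, neg_add, ← sub_eq_add_neg]
  have e2 : toPlane rightCentroid = !₂[1 / 4 + 1 / Real.pi, 1 / Real.pi] := rfl
  rw [← e1, ← e2, two_centroids_optimal.2]
  refine ⟨isOptimalSetOfMeans_two_iff, ?_,
    roundsTo_of_mem (by norm_num) partitionCost_half_mem (by norm_num)⟩
  have := Real.pi_ne_zero
  rw [partitionCost_half]
  field_simp
  ring

end HalfDisc

theorem mainTheorem9 :
    -- two means: the optimal set is unique and explicit
    ((∀ α : Set (EuclideanSpace ℝ (Fin 2)),
        IsOptimalSetOfMeans semicircleMixed 2 α ↔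
          α = {!₂[-(1 / 4) - 1 / Real.pi, 1 / Real.pi], !₂[1 / 4 + 1 / Real.pi, 1 / Real.pi]}) ∧
      (quantizationError semicircleMixed 2).toReal =
        2 * ((96 - 24 * Real.pi + 7 * Real.pi ^ 2) / (192 * Real.pi ^ 2) +
          (-96 - 8 * Real.pi + 17 * Real.pi ^ 2) / (64 * Real.pi ^ 2)) ∧
      RoundsTo (quantizationError semicircleMixed 2).toReal 0.242369 6) ∧
    -- three means
    ((∃ p q r : ℝ,
        RoundsTo p 0.634868 6 ∧ RoundsTo q 0.154710 6 ∧ RoundsTo r 0.927980 6 ∧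
        IsOptimalSetOfMeans semicircleMixed 3 {!₂[-p, q], !₂[0, r], !₂[p, q]}) ∧
      RoundsTo (quantizationError semicircleMixed 3).toReal 0.147821 6) ∧
    -- four means
    ((∃ p q r : ℝ,
        RoundsTo p 0.788235 6 ∧ RoundsTo q 0.219171 6 ∧ RoundsTo r 0.932871 6 ∧
        IsOptimalSetOfMeans semicircleMixed 4 {!₂[0, 0], !₂[p, q], !₂[0, r], !₂[-p, q]}) ∧
      RoundsTo (quantizationError semicircleMixed 4).toReal 0.0984120 7) ∧
    -- five means
    ((∃ p q u v : ℝ,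
        RoundsTo p 0.797190 6 ∧ RoundsTo q 0.120767 6 ∧
        RoundsTo u 0.439705 6 ∧ RoundsTo v 0.856689 6 ∧
        IsOptimalSetOfMeans semicircleMixed 5
          {!₂[0, 0], !₂[p, q], !₂[u, v], !₂[-u, v], !₂[-p, q]}) ∧
      RoundsTo (quantizationError semicircleMixed 5).toReal 0.0654358 7) ∧
    -- six means
    ((∃ p q u v r : ℝ,
        RoundsTo p 0.781728 6 ∧ RoundsTo q 0.0661157 7 ∧
        RoundsTo u 0.672351 6 ∧ RoundsTo v 0.707635 6 ∧ RoundsTo r 0.976117 6 ∧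
        IsOptimalSetOfMeans semicircleMixed 6
          {!₂[0, 0], !₂[p, q], !₂[u, v], !₂[0, r], !₂[-u, v], !₂[-p, q]}) ∧
      RoundsTo (quantizationError semicircleMixed 6).toReal 0.0499565 7) ∧
    -- seven means
    ((∃ s p q u v r : ℝ,
        RoundsTo s 0.294267 6 ∧ RoundsTo p 0.865678 6 ∧ RoundsTo q 0.0989137 7 ∧
        RoundsTo u 0.652260 6 ∧ RoundsTo v 0.728637 6 ∧ RoundsTo r 0.977935 6 ∧
        IsOptimalSetOfMeans semicircleMixed 7
          {!₂[-s, 0], !₂[s, 0], !₂[p, q], !₂[u, v], !₂[0, r], !₂[-u, v], !₂[-p, q]}) ∧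
      RoundsTo (quantizationError semicircleMixed 7).toReal 0.0366668 7) ∧
    -- eight means
    ((∃ s p q u v w z : ℝ,
        RoundsTo s 0.286766 6 ∧ RoundsTo p 0.853609 6 ∧ RoundsTo q 0.0615721 7 ∧
        RoundsTo u 0.777386 6 ∧ RoundsTo v 0.604469 6 ∧
        RoundsTo w 0.294109 6 ∧ RoundsTo z 0.939793 6 ∧
        IsOptimalSetOfMeans semicircleMixed 8
          {!₂[-s, 0], !₂[s, 0], !₂[p, q], !₂[u, v], !₂[w, z], !₂[-w, z], !₂[-u, v],
            !₂[-p, q]}) ∧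
      RoundsTo (quantizationError semicircleMixed 8).toReal 0.0290573 7) ∧
    -- nine means
    ((∃ s p q u v w z : ℝ,
        RoundsTo s 0.458992 6 ∧ RoundsTo p 0.902056 6 ∧ RoundsTo q 0.0840085 7 ∧
        RoundsTo u 0.764954 6 ∧ RoundsTo v 0.621235 6 ∧
        RoundsTo w 0.287671 6 ∧ RoundsTo z 0.942514 6 ∧
        IsOptimalSetOfMeans semicircleMixed 9
          {!₂[-s, 0], !₂[0, 0], !₂[s, 0], !₂[p, q], !₂[u, v], !₂[w, z], !₂[-w, z], !₂[-u, v],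
            !₂[-p, q]}) ∧
      RoundsTo (quantizationError semicircleMixed 9).toReal 0.0233983 7) := by
  exact ⟨HalfDisc.two_means, HalfDisc.three_means, HalfDisc.four_means, HalfDisc.five_means,
    HalfDisc.six_means, HalfDisc.seven_means, HalfDisc.eight_means, HalfDisc.nine_means⟩
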